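/- Let $S$ be the (oriented) three-holed sphere with boundary circles $C_1, C_2, C_3$, and let $T_i$ be the right-handed Dehn twist along (a curve parallel to) $C_i$. For a homeomorphism $\varphi$ of $S$ that is the identity on $\partial S$, let $M_{(S,\varphi)}$ be the closed 3-manifold obtained from the mapping torus $M_\varphi = S\times[0,1]/(x,1)\sim(\varphi(x),0)$ by gluing in a solid torus $S^1\times D^2$ along each of its three boundary tori, so that for every $p\in\partial S$ the circle $\{p\}\times S^1\subset\partial M_\varphi$ bounds a meridian disk $\{\ast\}\times D^2$ of the attached solid torus. Let $a,b,c$ be integers with $|a|\le|b|\le|c|$, and let $\varphi$ represent the mapping class $T_1^aT_2^bT_3^c$ (isotopies are relative to $\partial S$). Then $M_{(S,\varphi)}$ is simply connected if and only if $(a,b,c)$ is one of $$(0,-1,-1),\ (0,-1,1),\ (0,1,-1),\ (0,1,1),\quad (-1,1,n),\ (1,-1,n)\ (n\in\mathbb{Z}),\quad (-1,-1,1),\ (1,1,-1),\quad (-1,2,3),\ (1,-2,-3).$$ -/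

import Mathlib

open scoped unitInterval

noncomputable section

/-! ### Open books -/

/-- The gluing `(x, 1) ∼ (φ x, 0)` on `S × [0,1]`. -/
inductive MappingTorusRel {S : Type*} [TopologicalSpace S] (φ : S ≃ₜ S) :
    S × I → S × I → Prop
  | glue (x : S) : MappingTorusRel φ (x, 1) (φ x, 0)

/-- The mapping torus `S × [0,1] / (x, 1) ∼ (φ x, 0)`. -/
def MappingTorus {S : Type*} [TopologicalSpace S] (φ : S ≃ₜ S) : Type _ :=
  Quot (MappingTorusRel φ)

instance MappingTorus.instTopologicalSpace {S : Type*} [TopologicalSpace S] (φ : S ≃ₜ S) :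
    TopologicalSpace (MappingTorus φ) :=
  inferInstanceAs (TopologicalSpace (Quot (MappingTorusRel φ)))

/-- The class of `(x, t)` in the mapping torus. -/
def MappingTorus.mk {S : Type*} [TopologicalSpace S] (φ : S ≃ₜ S) (p : S × I) : MappingTorus φ :=
  Quot.mk _ p

/-- The gluing of the solid tori `B × D²` (where `B` is the boundary of `S`, on which `φ` is the
identity) to the mapping torus: the point `(p, t)` with `p ∈ B` is glued to `(p, exp (2πit))`.
Thus the circle `{p} × S¹` in the boundary of the mapping torus bounds the disk `{p} × D²`. -/
inductive OpenBookRel {S : Type*} [TopologicalSpace S] (B : Set S) (φ : S ≃ₜ S) :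
    MappingTorus φ ⊕ (B × Metric.closedBall (0 : ℂ) 1) →
      MappingTorus φ ⊕ (B × Metric.closedBall (0 : ℂ) 1) → Prop
  | glue (p : B) (t : I) (w : Metric.closedBall (0 : ℂ) 1)
      (hw : (w : ℂ) = Complex.exp (2 * Real.pi * (t : ℝ) * Complex.I)) :
      OpenBookRel B φ (Sum.inl (MappingTorus.mk φ (p, t))) (Sum.inr (p, w))

/-- The closed manifold with page `S` and monodromy `φ`, where `B` is the boundary of `S` and `φ`
is the identity on `B`: the mapping torus with one solid torus `S¹ × D²` glued in for each
component `S¹` of `B`. -/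
def OpenBookManifold {S : Type*} [TopologicalSpace S] (B : Set S) (φ : S ≃ₜ S) : Type _ :=
  Quot (OpenBookRel B φ)

instance OpenBookManifold.instTopologicalSpace {S : Type*} [TopologicalSpace S] (B : Set S)
    (φ : S ≃ₜ S) : TopologicalSpace (OpenBookManifold B φ) :=
  inferInstanceAs (TopologicalSpace (Quot (OpenBookRel B φ)))

/-- `φ` and `ψ` are isotopic through homeomorphisms that are the identity on `B`. With `B` the
boundary of a surface `S`, this says that they represent the same mapping class of `S`. -/
def IsotopicRel {S : Type*} [TopologicalSpace S] (B : Set S) (φ ψ : S ≃ₜ S) : Prop :=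
  ∃ F : I → (S ≃ₜ S), Continuous (fun q : I × S => F q.1 q.2) ∧
    (∀ t, ∀ p ∈ B, F t p = p) ∧ F 0 = φ ∧ F 1 = ψ

/-! ### The three-holed sphere and its boundary twists -/

/-- The three-holed sphere: the disk of radius `7` about `0` in the oriented plane, minus the open
disks of radius `1` about `-3` and `3`. -/
def ThreeHoledSphere : Type :=
  {z : ℂ // ‖z‖ ≤ 7 ∧ 1 ≤ ‖z - (-3)‖ ∧ 1 ≤ ‖z - 3‖}

instance ThreeHoledSphere.instTopologicalSpace : TopologicalSpace ThreeHoledSphere :=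
  inferInstanceAs (TopologicalSpace {z : ℂ // ‖z‖ ≤ 7 ∧ 1 ≤ ‖z - (-3)‖ ∧ 1 ≤ ‖z - 3‖})

/-- The boundary of the three-holed sphere, the union of the circles `C₁` (radius `7` about `0`),
`C₂` (radius `1` about `-3`) and `C₃` (radius `1` about `3`). -/
def ThreeHoledSphere.boundary : Set ThreeHoledSphere :=
  {z | ‖z.1‖ = 7 ∨ ‖z.1 - (-3)‖ = 1 ∨ ‖z.1 - 3‖ = 1}

/-- The map of the plane that rotates the circle of radius `ρ` about `p` by the angle
`2πε · clamp(ρ - r)`, where `clamp` truncates to `[0,1]`. It is the identity outside the annulus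
`r ≤ ρ ≤ r + 1`. -/
def annulusTwist (ε : ℝ) (p : ℂ) (r : ℝ) (z : ℂ) : ℂ :=
  p + (z - p) *
    Complex.exp (((ε * (2 * Real.pi * max 0 (min 1 (‖z - p‖ - r))) : ℝ) : ℂ) * Complex.I)

theorem norm_annulusTwist_sub (ε : ℝ) (p : ℂ) (r : ℝ) (z : ℂ) :
    ‖annulusTwist ε p r z - p‖ = ‖z - p‖ := by
  simp only [annulusTwist, add_sub_cancel_left, norm_mul, Complex.norm_exp_ofReal_mul_I, mul_one]

theorem annulusTwist_neg_annulusTwist (ε : ℝ) (p : ℂ) (r : ℝ) (z : ℂ) :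
    annulusTwist (-ε) p r (annulusTwist ε p r z) = z := by
  rw [annulusTwist, norm_annulusTwist_sub, annulusTwist, add_sub_cancel_left, mul_assoc,
    ← Complex.exp_add]
  push_cast
  simp

theorem continuous_annulusTwist (ε : ℝ) (p : ℂ) (r : ℝ) : Continuous (annulusTwist ε p r) := by
  unfold annulusTwist
  fun_prop

/-- The right-handed Dehn twist of the oriented plane in the annulus `r ≤ |z - p| ≤ r + 1`: the
angle decreases by `2π` as the radius increases, so that an arc crossing the annulus, in either
direction, is made to turn to the right. -/
def planeDehnTwist (p : ℂ) (r : ℝ) : ℂ ≃ₜ ℂ where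
  toFun := annulusTwist (-1) p r
  invFun := annulusTwist 1 p r
  left_inv z := by simpa using annulusTwist_neg_annulusTwist (-1) p r z
  right_inv z := annulusTwist_neg_annulusTwist 1 p r z
  continuous_toFun := continuous_annulusTwist _ _ _
  continuous_invFun := continuous_annulusTwist _ _ _

theorem annulusTwist_of_le {ε : ℝ} {p : ℂ} {r : ℝ} {z : ℂ} (h : ‖z - p‖ ≤ r) :
    annulusTwist ε p r z = z := by
  have : max 0 (min 1 (‖z - p‖ - r)) = 0 :=
    max_eq_left ((min_le_right _ _).trans (by linarith))
  simp [annulusTwist, this]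

theorem annulusTwist_of_ge {p : ℂ} {r : ℝ} {z : ℂ} (h : r + 1 ≤ ‖z - p‖) :
    annulusTwist (-1) p r z = z := by
  have h1 : max (0 : ℝ) (min 1 (‖z - p‖ - r)) = 1 := by
    rw [min_eq_left (by linarith)]; norm_num
  have h2 : Complex.exp (((-1 * (2 * Real.pi * 1) : ℝ) : ℂ) * Complex.I) = 1 := by
    rw [Complex.exp_eq_one_iff]
    exact ⟨-1, by push_cast; ring⟩
  rw [annulusTwist, h1, h2]
  ring

theorem norm_bounds_outer {z : ℂ} (h : 6 ≤ ‖z - 0‖) : 1 ≤ ‖z - (-3)‖ ∧ 1 ≤ ‖z - 3‖ := by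
  have h1 := norm_sub_norm_le z (-3)
  have h2 := norm_sub_norm_le z 3
  have h3 : ‖(-3 : ℂ)‖ = 3 := by simp
  have h4 : ‖(3 : ℂ)‖ = 3 := by simp
  rw [sub_zero] at h
  constructor <;> linarith

theorem norm_bounds_left {z : ℂ} (h : ‖z - (-3)‖ ≤ 2) : ‖z‖ ≤ 7 ∧ 1 ≤ ‖z - 3‖ := by
  have h1 := norm_sub_norm_le z (-3)
  have h2 := norm_sub_norm_le (6 : ℂ) (z - (-3))
  have h3 : ‖(-3 : ℂ)‖ = 3 := by simp
  have h4 : ‖(6 : ℂ)‖ = 6 := by simp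
  have h5 : ‖(6 : ℂ) - (z - (-3))‖ = ‖z - 3‖ := by rw [← norm_neg]; congr 1; ring
  constructor <;> linarith

theorem norm_bounds_right {z : ℂ} (h : ‖z - 3‖ ≤ 2) : ‖z‖ ≤ 7 ∧ 1 ≤ ‖z - (-3)‖ := by
  have h1 := norm_sub_norm_le z 3
  have h2 := norm_sub_norm_le (-6 : ℂ) (z - 3)
  have h3 : ‖(3 : ℂ)‖ = 3 := by simp
  have h4 : ‖(-6 : ℂ)‖ = 6 := by simp
  have h5 : ‖(-6 : ℂ) - (z - 3)‖ = ‖z - (-3)‖ := by rw [← norm_neg]; congr 1; ring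
  constructor <;> linarith

theorem planeDehnTwist_mem_one (z : ℂ) :
    (‖z‖ ≤ 7 ∧ 1 ≤ ‖z - (-3)‖ ∧ 1 ≤ ‖z - 3‖) ↔
      (‖planeDehnTwist 0 6 z‖ ≤ 7 ∧ 1 ≤ ‖planeDehnTwist 0 6 z - (-3)‖ ∧
        1 ≤ ‖planeDehnTwist 0 6 z - 3‖) := by
  change _ ↔ (‖annulusTwist (-1) 0 6 z‖ ≤ 7 ∧ 1 ≤ ‖annulusTwist (-1) 0 6 z - (-3)‖ ∧
    1 ≤ ‖annulusTwist (-1) 0 6 z - 3‖)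
  have hn := norm_annulusTwist_sub (-1) 0 6 z
  rcases le_total ‖z - 0‖ 6 with h | h
  · rw [annulusTwist_of_le h]
  · have h1 := norm_bounds_outer h
    have h2 := norm_bounds_outer (hn ▸ h)
    rw [sub_zero, sub_zero] at hn
    rw [hn]
    tauto

theorem planeDehnTwist_mem_two (z : ℂ) :
    (‖z‖ ≤ 7 ∧ 1 ≤ ‖z - (-3)‖ ∧ 1 ≤ ‖z - 3‖) ↔
      (‖planeDehnTwist (-3) 1 z‖ ≤ 7 ∧ 1 ≤ ‖planeDehnTwist (-3) 1 z - (-3)‖ ∧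
        1 ≤ ‖planeDehnTwist (-3) 1 z - 3‖) := by
  change _ ↔ (‖annulusTwist (-1) (-3) 1 z‖ ≤ 7 ∧ 1 ≤ ‖annulusTwist (-1) (-3) 1 z - (-3)‖ ∧
    1 ≤ ‖annulusTwist (-1) (-3) 1 z - 3‖)
  have hn := norm_annulusTwist_sub (-1) (-3) 1 z
  rcases le_total 2 ‖z - (-3)‖ with h | h
  · rw [annulusTwist_of_ge (by linarith)]
  · have h1 := norm_bounds_left h
    have h2 := norm_bounds_left (hn ▸ h)
    rw [hn]
    tauto

theorem planeDehnTwist_mem_three (z : ℂ) :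
    (‖z‖ ≤ 7 ∧ 1 ≤ ‖z - (-3)‖ ∧ 1 ≤ ‖z - 3‖) ↔
      (‖planeDehnTwist 3 1 z‖ ≤ 7 ∧ 1 ≤ ‖planeDehnTwist 3 1 z - (-3)‖ ∧
        1 ≤ ‖planeDehnTwist 3 1 z - 3‖) := by
  change _ ↔ (‖annulusTwist (-1) 3 1 z‖ ≤ 7 ∧ 1 ≤ ‖annulusTwist (-1) 3 1 z - (-3)‖ ∧
    1 ≤ ‖annulusTwist (-1) 3 1 z - 3‖)
  have hn := norm_annulusTwist_sub (-1) 3 1 z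
  rcases le_total 2 ‖z - 3‖ with h | h
  · rw [annulusTwist_of_ge (by linarith)]
  · have h1 := norm_bounds_right h
    have h2 := norm_bounds_right (hn ▸ h)
    rw [hn]
    tauto

namespace ThreeHoledSphere

/-- The right-handed Dehn twist along `C₁`, in the collar `6 ≤ |z| ≤ 7` of `C₁`. -/
def T₁ : ThreeHoledSphere ≃ₜ ThreeHoledSphere :=
  (planeDehnTwist 0 6).subtype planeDehnTwist_mem_one

/-- The right-handed Dehn twist along `C₂`, in the collar `1 ≤ |z + 3| ≤ 2` of `C₂`. -/
def T₂ : ThreeHoledSphere ≃ₜ ThreeHoledSphere :=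
  (planeDehnTwist (-3) 1).subtype planeDehnTwist_mem_two

/-- The right-handed Dehn twist along `C₃`, in the collar `1 ≤ |z - 3| ≤ 2` of `C₃`. -/
def T₃ : ThreeHoledSphere ≃ₜ ThreeHoledSphere :=
  (planeDehnTwist 3 1).subtype planeDehnTwist_mem_three

end ThreeHoledSphere

end

/-!
The proof computes enough of the fundamental group of the open book. The isotopy to the identity
that rotates the collars of the boundary circles (`PageRotation`) identifies the mapping torus with
the product of the three-holed sphere and `S¹`, at the price of a change of the meridians: in the
`i`-th solid torus the circle bounding a disk is `x i ^ k i * τ`, where `x i` is the loop around the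
`i`-th boundary circle, `τ` is the circle factor and `k = (-a, b, c)`. Hence the fundamental group
is generated by `x 0`, `x 1`, `x 2` and a central `τ`, with the relations `x 0 = x 2 * x 1` and
`x i ^ k i * τ = 1`.

This group is trivial exactly for the listed triples. Its abelianization has order `|ab + bc + ca|`,
so this number must be `1`. If moreover `|a| ≤ 1`, the triple is in the list
(`mem_sphereTriples_of_det`), and for these the relations collapse by hand
(`FillingRelations.eq_one`). If `|a|`, `|b|`, `|c|` are at least `2`, the group is not trivial since
it maps to `SL₂(ℂ)` with `τ ↦ -1`, the `x i` going to elements with prescribed traces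
(`exists_fillingRelations_of_two_le`).

The topological side is stated for a space with a `FillingAtlas`, that is, with coordinates off the
three cores in the plane minus `±3` times `S¹`, and coordinates near the cores in solid tori. The
presentation is not proved as an isomorphism; only its two consequences are needed.
* If the space is simply connected, then elements of a group that satisfy the relations are trivial
  (`FillingAtlas.eq_one_of_simplyConnectedSpace`). They define a local system, by frames over a
  cover with locally constant transition functions, and a local system on a simply connected space
  has a flat section (`exists_flat_section`).
* If the relations have only the trivial solution in all groups, then the space is simply connected
  (`FillingAtlas.simplyConnectedSpace_of_forall_eq_one`). The loops satisfy the relations in the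
  fundamental group, hence are trivial, and loops that are cut into pieces lying in the sets of a
  cover are then trivial as well (`trans_map_eq_of_cover`, `simplyConnectedSpace_of_star`).

The atlas of the open book is `ThreeHoledSphere.fillingAtlas`.
-/

universe u

noncomputable section

/-! ### Path classes and flat sections over open covers -/

/-- A criterion for the path classes `p y` to be compatible with all paths in `Y`: it is enough that
they are compatible with the paths that stay in one set of an open cover of `Y`. With `Y = X` and
`p` unchanged on loops this is the half of the Seifert-van Kampen theorem saying that `π₁` is
generated by the pieces. -/
theorem trans_map_eq_of_cover {X Y ι : Type*} [TopologicalSpace X] [TopologicalSpace Y]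
    (f : C(Y, X)) {U : ι → Set Y} (hU : ∀ i, IsOpen (U i)) (hcov : ∀ y, ∃ i, y ∈ U i) {x₀ : X}
    (p : ∀ y, Path.Homotopic.Quotient x₀ (f y))
    (H : ∀ i {y y' : Y} (γ : Path y y'), (∀ s, γ s ∈ U i) →
      (p y).trans (.mk (γ.map f.continuous)) = p y')
    {y y' : Y} (γ : Path y y') : (p y).trans (.mk (γ.map f.continuous)) = p y' := by
  obtain ⟨t, t0, tmono, ⟨n, hn⟩, ht⟩ :=
    exists_monotone_Icc_subset_open_cover_unitInterval (c := fun i => γ ⁻¹' U i)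
      (fun i => (hU i).preimage γ.continuous)
      (fun s _ => by simpa using hcov (γ s))
  have key : ∀ m, (p (γ 0)).trans (.mk ((γ.subpath 0 (t m)).map f.continuous)) = p (γ (t m)) := by
    intro m
    induction m with
    | zero =>
      have : ∀ s, s = 0 →
          (p (γ 0)).trans (.mk ((γ.subpath 0 s).map f.continuous)) = p (γ s) := by
        rintro s rfl
        rw [Path.subpath_self]
        exact Path.Homotopic.Quotient.trans_refl _
      exact this _ t0
    | succ m ih =>
      obtain ⟨i, hi⟩ := ht m
      have h1 := H i (γ.subpath (t m) (t (m + 1))) (fun s => by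
        have : γ.subpath (t m) (t (m + 1)) s ∈ Set.range (γ.subpath (t m) (t (m + 1))) := ⟨s, rfl⟩
        rw [Path.range_subpath_of_le _ _ _ (tmono m.le_succ)] at this
        obtain ⟨r, hr, hr'⟩ := this
        exact hr' ▸ hi hr)
      have h2 : Path.Homotopic.Quotient.mk ((γ.subpath 0 (t (m + 1))).map f.continuous) =
          (Path.Homotopic.Quotient.mk ((γ.subpath 0 (t m)).map f.continuous)).trans
            (.mk ((γ.subpath (t m) (t (m + 1))).map f.continuous)) := by
        rw [← Path.Homotopic.Quotient.mk_trans, ← Path.map_trans]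
        exact (Path.Homotopic.Quotient.eq.2
          (Path.Homotopic.map ⟨Path.Homotopy.subpathTransSubpath γ 0 (t m) (t (m + 1))⟩ f)).symm
      rw [h2, ← Path.Homotopic.Quotient.trans_assoc, ih, h1]
  have h1 := key n
  have : ∀ s, s = 1 → (p (γ 0)).trans (.mk ((γ.subpath 0 s).map f.continuous)) = p (γ s) →
      (p y).trans (.mk (γ.map f.continuous)) = p y' := by
    rintro s rfl h
    rw [Path.subpath_zero_one] at h
    obtain ⟨γ, rfl, rfl⟩ := γ
    exact h
  exact this _ (hn n le_rfl) h1

/-- A family of `G`-valued functions `s i` on an open cover, whose ratios `(s j)⁻¹ * s i` are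
locally constant, has a common flat section `u` when the base is simply connected: `(s i)⁻¹ * u` is
constant along paths in `U i`. The ratios are the transition functions of a covering space with
fiber `G` (with its discrete topology), and `u` comes from its monodromy, which does not depend on
the path. The `s i` themselves need not be continuous. -/
theorem exists_flat_section {X ι G : Type*} [TopologicalSpace X] [SimplyConnectedSpace X] [Group G]
    {U : ι → Set X} (hU : ∀ i, IsOpen (U i)) (hcov : ∀ x, ∃ i, x ∈ U i) (s : ι → X → G)
    (hs : ∀ i j, ∀ x ∈ U i ∩ U j,
      ∀ᶠ y in nhds x, (s j y)⁻¹ * s i y = (s j x)⁻¹ * s i x) :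
    ∃ u : X → G, ∀ i {x y : X} (γ : Path x y), (∀ t, γ t ∈ U i) →
      (s i x)⁻¹ * u x = (s i y)⁻¹ * u y := by
  classical
  let _ : TopologicalSpace G := ⊥
  have : DiscreteTopology G := ⟨rfl⟩
  choose idx hidx using hcov
  let Z : FiberBundleCore ι X G :=
    { baseSet := U
      isOpen_baseSet := hU
      indexAt := idx
      mem_baseSet_at := hidx
      coordChange := fun i j x v => (s j x)⁻¹ * s i x * v
      coordChange_self := fun i x _ v => by simp
      continuousOn_coordChange := fun i j => by
        rintro ⟨x, v⟩ ⟨hx, -⟩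
        refine ContinuousAt.continuousWithinAt ?_
        have h1 : ∀ᶠ q : X × G in nhds (x, v), (s j q.1)⁻¹ * s i q.1 = (s j x)⁻¹ * s i x :=
          (continuous_fst.tendsto (x, v)).eventually (hs i j x hx)
        have h2 : ContinuousAt (fun q : X × G => (s j x)⁻¹ * s i x * q.2) (x, v) :=
          ((continuous_of_discreteTopology (f := fun g : G => (s j x)⁻¹ * s i x * g)).comp
            continuous_snd).continuousAt
        exact h2.congr (h1.mono fun q hq => by simp [hq])
      coordChange_comp := fun i j k x _ v => by group }
  have cov : IsCoveringMap Z.proj := FiberBundle.isCoveringMap (F := G) (E := Z.Fiber)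
  obtain ⟨x₀⟩ : Nonempty X := inferInstance
  let e₀ : Z.proj ⁻¹' {x₀} := ⟨⟨x₀, (1 : G)⟩, rfl⟩
  let e : ∀ x, Z.proj ⁻¹' {x} := fun x => cov.monodromy (.mk (PathConnectedSpace.somePath x₀ x)) e₀
  have he : ∀ {x y : X} (γ : Path x y), cov.monodromy (.mk γ) (e x) = e y := by
    intro x y γ
    rw [← cov.monodromy_trans_apply]
    exact congrArg (fun q => cov.monodromy q e₀) (Subsingleton.elim _ _)
  have hval : ∀ i x (hx : x ∈ U i) (a : Z.proj ⁻¹' {x}),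
      (Z.localTriv i a.1).2 = (s i x)⁻¹ * (s (idx x) x * (show G from a.1.2)) := by
    rintro i x hx ⟨⟨x', v⟩, rfl : x' = x⟩
    simp only [Z, FiberBundleCore.localTriv_apply]
    exact mul_assoc _ _ _
  refine ⟨fun x => s (idx x) x * (show G from (e x).1.2), fun i x y γ hγ => ?_⟩
  have hx : x ∈ U i := by simpa using hγ 0
  have hy : y ∈ U i := by simpa using hγ 1
  change (s i x)⁻¹ * (s (idx x) x * (show G from (e x).1.2)) =
    (s i y)⁻¹ * (s (idx y) y * (show G from (e y).1.2))
  rw [← hval i x hx, ← hval i y hy, ← he γ]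
  have hγ0 : γ 0 = Z.proj (e x).1 := by rw [γ.source]; exact (e x).2.symm
  change (Z.localTriv i (e x).1).2 = (Z.localTriv i (cov.liftPath γ (e x).1 hγ0 1)).2
  have hc : Continuous (fun t : I => (Z.localTriv i (cov.liftPath γ (e x).1 hγ0 t)).2) := by
    refine continuous_snd.comp ?_
    refine (Z.localTriv i).continuousOn.comp_continuous (cov.liftPath γ (e x).1 hγ0).continuous ?_
    intro t
    rw [(Z.localTriv i).mem_source]
    have := congrFun (cov.liftPath_lifts γ (e x).1 hγ0) t
    change Z.proj (cov.liftPath γ (e x).1 hγ0 t) ∈ U i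
    rw [show Z.proj (cov.liftPath γ (e x).1 hγ0 t) = γ t from this]
    exact hγ t
  have h01 := PreconnectedSpace.constant (inferInstance : PreconnectedSpace I) hc (x := 0) (y := 1)
  simpa [cov.liftPath_zero] using h01

/-! ### The group given by the filling relations -/

/-- The list of triples `(a, b, c)` for which the open book is simply connected. -/
def sphereTriples : Set (ℤ × ℤ × ℤ) :=
  {(0, -1, -1), (0, -1, 1), (0, 1, -1), (0, 1, 1)} ∪
    {x | ∃ n : ℤ, x = (-1, 1, n) ∨ x = (1, -1, n)} ∪
    {(-1, -1, 1), (1, 1, -1)} ∪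
    {(-1, 2, 3), (1, -2, -3)}

/-- The relations of the fundamental group of the open book: `x₁`, `x₂`, `x₃` are loops around the
three boundary circles of the page, and `τ` is the circle direction of the mapping torus. The last
three relations come from the solid tori; they force `τ` to commute with `x₂` and `x₃`, so the
centrality of `τ` is not listed. -/
structure FillingRelations {G : Type*} [Group G] (a b c : ℤ) (x₁ x₂ x₃ τ : G) : Prop where
  prod : x₁ = x₃ * x₂
  rel₁ : x₁ ^ (-a) * τ = 1
  rel₂ : x₂ ^ b * τ = 1
  rel₃ : x₃ ^ c * τ = 1

theorem FillingRelations.eq_one {G : Type*} [Group G] {a b c : ℤ} {x₁ x₂ x₃ τ : G}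
    (h : FillingRelations a b c x₁ x₂ x₃ τ) (habc : (a, b, c) ∈ sphereTriples) :
    x₁ = 1 ∧ x₂ = 1 ∧ x₃ = 1 ∧ τ = 1 := by
  obtain ⟨rfl, h1, h2, h3⟩ := h
  simp only [sphereTriples, Set.mem_union, Set.mem_insert_iff, Set.mem_singleton_iff,
    Prod.mk.injEq, Set.mem_ofPred_eq] at habc
  have key : x₂ = 1 ∧ x₃ = 1 := by
    rcases habc with ((h | h) | h) | h
    · have ha : a = 0 := by tauto
      subst ha
      simp only [neg_zero, zpow_zero, one_mul] at h1
      subst h1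
      rcases h with ⟨-, rfl, rfl⟩ | ⟨-, rfl, rfl⟩ | ⟨-, rfl, rfl⟩ | ⟨-, rfl, rfl⟩ <;>
        simpa using And.intro h2 h3
    · rcases h with ⟨n, ⟨rfl, rfl, rfl⟩ | ⟨rfl, rfl, rfl⟩⟩
      · have h1' : x₃ * x₂ * τ = 1 := by simpa using h1
        have h2' : x₂ * τ = 1 := by simpa using h2
        have h5 : x₃ = 1 := by rwa [mul_assoc, h2', mul_one] at h1'
        subst h5
        have : τ = 1 := by simpa using h3
        subst this
        simpa using h2'
      · have h1' : (x₃ * x₂)⁻¹ * τ = 1 := by simpa using h1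
        have h2' : x₂⁻¹ * τ = 1 := by simpa using h2
        have e1 := inv_mul_eq_one.1 h1'
        have e2 := inv_mul_eq_one.1 h2'
        subst e2
        have h5 : x₃ = 1 := by simpa using e1
        subst h5
        have : x₂ = 1 := by simpa using h3
        simp [this]
    · rcases h with ⟨rfl, rfl, rfl⟩ | ⟨rfl, rfl, rfl⟩
      · have h1' : x₃ * x₂ * τ = 1 := by simpa using h1
        have e2 : x₂ = τ := by simpa using inv_mul_eq_one.1 (by simpa using h2)
        have h3' : x₃ * τ = 1 := by simpa using h3
        subst e2
        rw [h3', one_mul] at h1'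
        subst h1'
        simpa using h3'
      · have e1 : x₃ * x₂ = τ := inv_mul_eq_one.1 (by simpa using h1)
        have h2' : x₂ * τ = 1 := by simpa using h2
        have e3 : x₃ = τ := inv_mul_eq_one.1 (by simpa using h3)
        subst e3
        have : x₂ = 1 := by simpa using e1
        subst this
        simpa using h2'
    · rcases h with ⟨rfl, rfl, rfl⟩ | ⟨rfl, rfl, rfl⟩
      · have h1' : x₃ * x₂ * τ = 1 := by simpa using h1
        have e : x₂ ^ (2 : ℤ) * τ = x₃ * x₂ * τ := by rw [h2, h1']
        have e' : x₂ = x₃ := by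
          have := mul_right_cancel e
          rw [zpow_ofNat, pow_two] at this
          exact mul_right_cancel this
        subst e'
        have e4 : x₂ ^ (3 : ℤ) * τ = x₂ ^ (2 : ℤ) * τ := by rw [h2, h3]
        have e5 := mul_right_cancel e4
        have : x₂ = 1 := by
          rw [show (3 : ℤ) = 2 + 1 from rfl, zpow_add_one] at e5
          simpa using e5
        exact ⟨this, this⟩
      · have e1 : x₃ * x₂ = τ := inv_mul_eq_one.1 (by simpa using h1)
        have e2 : x₂ ^ 2 = τ := inv_mul_eq_one.1 (by
          rw [← h2, zpow_neg, zpow_ofNat])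
        have e3 : x₃ ^ 3 = τ := inv_mul_eq_one.1 (by
          rw [← h3, zpow_neg, zpow_ofNat])
        have e' : x₂ = x₃ := by
          rw [← e1, pow_two] at e2
          exact mul_right_cancel e2
        subst e'
        have : x₂ = 1 := by
          rw [← e2, pow_succ] at e3
          simpa using e3
        exact ⟨this, this⟩
  obtain ⟨rfl, rfl⟩ := key
  simpa using h1

theorem fillingRelations_ofAdd (a b c : ℤ) (A : Type) [AddCommGroup A] (x₂ x₃ τ : A)
    (h1 : (-a) • (x₃ + x₂) + τ = 0) (h2 : b • x₂ + τ = 0) (h3 : c • x₃ + τ = 0) :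
    FillingRelations a b c (Multiplicative.ofAdd (x₃ + x₂)) (.ofAdd x₂) (.ofAdd x₃)
      (Multiplicative.ofAdd τ) :=
  ⟨rfl, h1, h2, h3⟩

/-- The abelianization of the group with the filling relations has order `|ab + bc + ca|` (infinite
if this is zero), so it is nontrivial unless this number is `1`. A quotient `ℤ/d` is exhibited,
where `d = ab + bc + ca`. -/
theorem exists_fillingRelations_of_det_ne {a b c : ℤ} (h : |a * b + b * c + c * a| ≠ 1) :
    ∃ (G : Type) (_ : Group G) (x₁ x₂ x₃ τ : G),
      FillingRelations a b c x₁ x₂ x₃ τ ∧ ¬ (x₁ = 1 ∧ x₃ = 1 ∧ τ = 1) := by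
  set d := a * b + b * c + c * a with hd
  have hn : d.natAbs ≠ 1 := by
    intro h'
    apply h
    rw [Int.abs_eq_natAbs, h']; rfl
  have hz : ∀ m : ℤ, (m : ZMod d.natAbs) = 0 ↔ d ∣ m := fun m => by
    rw [ZMod.intCast_zmod_eq_zero_iff_dvd, Int.natAbs_dvd]
  have h0 : ((d : ℤ) : ZMod d.natAbs) = 0 := (hz d).2 dvd_rfl
  by_cases hbc : d ∣ b ∧ d ∣ c
  · refine ⟨Multiplicative (ZMod d.natAbs), inferInstance, _, _, _, _,
      fillingRelations_ofAdd a b c (ZMod d.natAbs) 1 (-1) 0 ?_ ?_ ?_, ?_⟩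
    · simp
    · simpa using (hz b).2 hbc.1
    · simpa using (hz c).2 hbc.2
    · rintro ⟨-, h3, -⟩
      have h3' : (-1 : ZMod d.natAbs) = 0 := h3
      have : ((1 : ℤ) : ZMod d.natAbs) = 0 := by
        rw [neg_eq_zero] at h3'; simpa using h3'
      rw [hz, ← Int.natAbs_dvd_natAbs] at this
      exact hn (Nat.dvd_one.1 this)
  · refine ⟨Multiplicative (ZMod d.natAbs), inferInstance, _, _, _, _,
      fillingRelations_ofAdd a b c (ZMod d.natAbs) (c : ℤ) (b : ℤ) (-(b * c) : ℤ) ?_ ?_ ?_, ?_⟩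
    · have : (-a) • (((b : ℤ) : ZMod d.natAbs) + ((c : ℤ) : ZMod d.natAbs)) +
        ((-(b * c) : ℤ) : ZMod d.natAbs) = -((d : ℤ) : ZMod d.natAbs) := by
        rw [hd, zsmul_eq_mul]; push_cast; ring
      rw [this, h0, neg_zero]
    · rw [zsmul_eq_mul]; push_cast; ring
    · rw [zsmul_eq_mul]; push_cast; ring
    · rintro ⟨h1, h3, -⟩
      have h3' : ((b : ℤ) : ZMod d.natAbs) = 0 := h3
      have h1' : ((b : ℤ) : ZMod d.natAbs) + ((c : ℤ) : ZMod d.natAbs) = 0 := h1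
      rw [h3', zero_add] at h1'
      exact hbc ⟨(hz b).1 h3', (hz c).1 h1'⟩

/-- If `A` in `SL₂(ℂ)` has the distinct eigenvalues `w` and `w⁻¹` and `w ^ n = -1`, then
`A ^ n = -1`. By the Cayley-Hamilton theorem the powers of `A` are linear in `A`. -/
theorem pow_eq_neg_one_of_trace {A : Matrix (Fin 2) (Fin 2) ℂ} (hdet : A.det = 1) {w : ℂ}
    (hw0 : w ≠ 0) (hw : w ≠ w⁻¹) (htr : A.trace = w + w⁻¹) {n : ℕ} (hn : w ^ n = -1) :
    A ^ n = -1 := by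
  have hCH : A * A = (w + w⁻¹) • A - 1 := by
    rw [Matrix.det_fin_two] at hdet
    rw [Matrix.trace_fin_two] at htr
    rw [← htr]
    ext i j
    fin_cases i <;> fin_cases j <;>
      simp [Matrix.mul_apply, Fin.sum_univ_two] <;>
      first | ring1 | linear_combination -hdet
  have hne : w - w⁻¹ ≠ 0 := sub_ne_zero.2 hw
  have key : ∀ m : ℕ, (w - w⁻¹) • A ^ (m + 1) =
      (w ^ (m + 1) - w⁻¹ ^ (m + 1)) • A - (w ^ m - w⁻¹ ^ m) • 1 := by
    intro m
    induction m with
    | zero => simp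
    | succ m ih =>
      rw [pow_succ, ← smul_mul_assoc, ih, sub_mul, smul_mul_assoc, hCH, smul_mul_assoc, one_mul,
        smul_sub, smul_smul]
      have : w * w⁻¹ = 1 := mul_inv_cancel₀ hw0
      have e : (w ^ (m + 1) - w⁻¹ ^ (m + 1)) * (w + w⁻¹) =
          (w ^ (m + 1 + 1) - w⁻¹ ^ (m + 1 + 1)) + (w ^ m - w⁻¹ ^ m) := by
        rw [pow_succ, pow_succ w⁻¹, pow_succ _ (m+1), pow_succ _ (m+1), pow_succ, pow_succ]
        linear_combination (w ^ m - w⁻¹ ^ m) * this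
      rw [e, add_smul]
      abel
  obtain _ | m := n
  · norm_num at hn
  have hi : w⁻¹ ^ (m + 1) = -1 := by rw [inv_pow, hn]; norm_num
  have h1 : w ^ m = -w⁻¹ := by
    rw [pow_succ] at hn
    field_simp
    exact hn
  have h2 : w⁻¹ ^ m = -w := by
    rw [pow_succ] at hi
    field_simp at hi
    simpa using hi
  have h3 := key m
  rw [hn, hi, h1, h2] at h3
  have h4 : (w - w⁻¹) • A ^ (m + 1) = (w - w⁻¹) • (-1 : Matrix (Fin 2) (Fin 2) ℂ) := by
    rw [h3, sub_self, zero_smul, zero_sub, smul_neg]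
    congr 2
    ring
  exact smul_right_injective _ hne h4

theorem SL2_zpow_mul_neg_one {A : Matrix.SpecialLinearGroup (Fin 2) ℂ} {w : ℂ}
    (hw0 : w ≠ 0) (hw : w ≠ w⁻¹) (htr : (A : Matrix (Fin 2) (Fin 2) ℂ).trace = w + w⁻¹) {n : ℤ}
    (hn : w ^ n.natAbs = -1) : A ^ n * (-1) = 1 := by
  have h : A ^ n.natAbs = -1 := by
    apply Subtype.ext
    simpa using pow_eq_neg_one_of_trace A.det_coe hw0 hw htr hn
  have h' : A ^ n = -1 := by
    rcases Int.natAbs_eq n with e | e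
    · rw [e, zpow_natCast, h]
    · rw [e, zpow_neg, zpow_natCast, h]
      exact inv_eq_of_mul_eq_one_left (by simp)
  rw [h']; simp

theorem exists_root_neg_one {n : ℤ} (hn : 2 ≤ |n|) :
    ∃ w : ℂ, w ≠ 0 ∧ w ≠ w⁻¹ ∧ w ^ n.natAbs = -1 := by
  have hn' : 2 ≤ n.natAbs := by zify; exact hn
  have hpos : (n.natAbs : ℂ) ≠ 0 := by
    have : n.natAbs ≠ 0 := by omega
    exact_mod_cast this
  refine ⟨Complex.exp (Real.pi * Complex.I / n.natAbs), Complex.exp_ne_zero _, ?_, ?_⟩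
  · rw [← Complex.exp_neg, Ne, Complex.exp_eq_exp_iff_exists_int]
    rintro ⟨k, hk⟩
    have hpi : (Real.pi : ℂ) ≠ 0 := by exact_mod_cast Real.pi_ne_zero
    field_simp at hk
    have h2 : (1 : ℂ) = k * n.natAbs := by
      have hI := Complex.I_ne_zero
      linear_combination (1 / 2) * hk
    have h3 : (1 : ℤ) = k * (n.natAbs : ℤ) :=
      Int.cast_injective (α := ℂ) (by
        rw [Int.cast_mul, Int.cast_natCast, Int.cast_one]; exact h2)
    have h4 : (n.natAbs : ℤ) ∣ 1 := ⟨k, by rw [h3]; ring⟩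
    have := Int.le_of_dvd one_pos h4
    omega
  · rw [← Complex.exp_nat_mul, mul_div_cancel₀ _ hpos, Complex.exp_pi_mul_I]

/-- If `|a|, |b|, |c| ≥ 2`, the group with the filling relations maps nontrivially to `SL₂(ℂ)`: there
are `X`, `Y` with `X ^ b = Y ^ c = (Y * X) ^ (-a) = -1`, and `τ = -1`. -/
theorem exists_fillingRelations_of_two_le {a b c : ℤ} (ha : 2 ≤ |a|) (hb : 2 ≤ |b|)
    (hc : 2 ≤ |c|) : ∃ (G : Type) (_ : Group G) (x₁ x₂ x₃ τ : G),
      FillingRelations a b c x₁ x₂ x₃ τ ∧ ¬ (x₁ = 1 ∧ x₃ = 1 ∧ τ = 1) := by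
  obtain ⟨r, hr0, hr, hra⟩ := exists_root_neg_one ha
  obtain ⟨u, hu0, hu, hub⟩ := exists_root_neg_one hb
  obtain ⟨v, hv0, hv, hvc⟩ := exists_root_neg_one hc
  -- The lower left entry of `X` is chosen to make `r + r⁻¹` the trace of `Y * X`.
  let X : Matrix.SpecialLinearGroup (Fin 2) ℂ :=
    ⟨!![u, 0; r + r⁻¹ - v * u - v⁻¹ * u⁻¹, u⁻¹], by simp [Matrix.det_fin_two_of, hu0]⟩
  let Y : Matrix.SpecialLinearGroup (Fin 2) ℂ :=
    ⟨!![v, 1; 0, v⁻¹], by simp [Matrix.det_fin_two_of, hv0]⟩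
  refine ⟨Matrix.SpecialLinearGroup (Fin 2) ℂ, inferInstance, Y * X, X, Y, -1,
    ⟨rfl, ?_, ?_, ?_⟩, ?_⟩
  · refine SL2_zpow_mul_neg_one hr0 hr ?_ (by rwa [Int.natAbs_neg])
    rw [Matrix.SpecialLinearGroup.coe_mul]
    simp only [X, Y, Matrix.trace_fin_two, Matrix.mul_apply, Fin.sum_univ_two]
    simp
    ring
  · exact SL2_zpow_mul_neg_one hu0 hu (by simp [X, Matrix.trace_fin_two]) hub
  · exact SL2_zpow_mul_neg_one hv0 hv (by simp [Y, Matrix.trace_fin_two]) hvc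
  · rintro ⟨-, -, h⟩
    have := congrArg (fun A : Matrix.SpecialLinearGroup (Fin 2) ℂ => A.1 0 0) h
    simp at this
    exact absurd this (by norm_num [Complex.ext_iff])

/-- If `|ab + bc + ca| = 1` and `|a| ≤ 1`, then `(a, b, c)` is in the list: for `a = ±1` the
condition says that `(b ± 1)(c ± 1)` is `0` or `2`. -/
theorem mem_sphereTriples_of_det {a b c : ℤ} (hab : |a| ≤ |b|) (hbc : |b| ≤ |c|)
    (hd : |a * b + b * c + c * a| = 1) (ha : |a| < 2) : (a, b, c) ∈ sphereTriples := by
  simp only [sphereTriples, Set.mem_union, Set.mem_insert_iff, Set.mem_singleton_iff,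
    Prod.mk.injEq, Set.mem_ofPred_eq]
  obtain ⟨h1, h2⟩ := abs_lt.1 ha
  have hd' : a * b + b * c + c * a = 1 ∨ a * b + b * c + c * a = -1 := by
    rcases abs_eq (zero_le_one) |>.1 hd with h | h <;> simp [h]
  have hcases : a = 0 ∨ a = 1 ∨ a = -1 := by omega
  rcases hcases with rfl | rfl | rfl
  · have h3 : b * c = 1 ∨ b * c = -1 := by simpa using hd'
    rcases h3 with h3 | h3
    · rcases Int.mul_eq_one_iff_eq_one_or_neg_one.1 h3 with ⟨rfl, rfl⟩ | ⟨rfl, rfl⟩ <;> simp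
    · rcases Int.mul_eq_neg_one_iff_eq_one_or_neg_one.1 h3 with ⟨rfl, rfl⟩ | ⟨rfl, rfl⟩ <;> simp
  · have h3 : (b + 1) * (c + 1) = 2 ∨ (b + 1) * (c + 1) = 0 := by
      rcases hd' with h | h
      · left; linarith
      · right; linarith
    rcases h3 with h3 | h3
    · have hdvd : b + 1 ∣ 2 := ⟨_, h3.symm⟩
      have hb1 := Int.le_of_dvd two_pos hdvd
      have hb2 := Int.le_of_dvd two_pos ((neg_dvd).2 hdvd)
      have : b = 1 ∨ b = 0 ∨ b = -1 ∨ b = -2 ∨ b = -3 := by omega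
      rcases this with rfl | rfl | rfl | rfl | rfl
      · have : c = 0 := by omega
        subst this; norm_num at hbc
      · norm_num at hab
      · omega
      · have : c = -3 := by omega
        subst this; simp
      · have : c = -2 := by omega
        subst this; norm_num at hbc
    · rcases mul_eq_zero.1 h3 with h | h
      · have : b = -1 := by omega
        subst this; simp
      · have : c = -1 := by omega
        subst this
        have : b = 1 ∨ b = -1 := by
          have h5 : |b| = 1 := le_antisymm (by simpa using hbc) (by simpa using hab)
          exact (abs_eq zero_le_one).1 h5
        rcases this with rfl | rfl <;> simp
  · have h3 : (b - 1) * (c - 1) = 2 ∨ (b - 1) * (c - 1) = 0 := by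
      rcases hd' with h | h
      · left; linarith
      · right; linarith
    rcases h3 with h3 | h3
    · have hdvd : b - 1 ∣ 2 := ⟨_, h3.symm⟩
      have hb1 := Int.le_of_dvd two_pos hdvd
      have hb2 := Int.le_of_dvd two_pos ((neg_dvd).2 hdvd)
      have : b = -1 ∨ b = 0 ∨ b = 1 ∨ b = 2 ∨ b = 3 := by omega
      rcases this with rfl | rfl | rfl | rfl | rfl
      · have : c = 0 := by omega
        subst this; norm_num at hbc
      · norm_num at hab
      · omega
      · have : c = 3 := by omega
        subst this; simp
      · have : c = 2 := by omega
        subst this; norm_num at hbc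
    · rcases mul_eq_zero.1 h3 with h | h
      · have : b = 1 := by omega
        subst this; simp
      · have : c = 1 := by omega
        subst this
        have : b = 1 ∨ b = -1 := by
          have h5 : |b| = 1 := le_antisymm (by simpa using hbc) (by simpa using hab)
          exact (abs_eq zero_le_one).1 h5
        rcases this with rfl | rfl <;> simp

theorem exists_fillingRelations_of_notMem {a b c : ℤ} (hab : |a| ≤ |b|) (hbc : |b| ≤ |c|)
    (h : (a, b, c) ∉ sphereTriples) : ∃ (G : Type) (_ : Group G) (x₁ x₂ x₃ τ : G),
      FillingRelations a b c x₁ x₂ x₃ τ ∧ ¬ (x₁ = 1 ∧ x₃ = 1 ∧ τ = 1) := by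
  by_cases hd : |a * b + b * c + c * a| = 1
  · have ha : 2 ≤ |a| := by
      by_contra! hlt
      exact h (mem_sphereTriples_of_det hab hbc hd hlt)
    exact exists_fillingRelations_of_two_le ha (ha.trans hab) (ha.trans (hab.trans hbc))
  · exact exists_fillingRelations_of_det_ne hd

/-! ### Branches of the angle and winding numbers -/

/-- The branch of the angle of `z` in `(-π/2, 3π/2]` (for `ε = true`) or in `(-3π/2, π/2]` (for
`ε = false`), with its cut along the lower or upper half of the imaginary axis. The two branches
agree in the right half plane and differ by `2π` in the left half plane. -/
def branchAngle (ε : Bool) (z : ℂ) : ℝ :=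
  if ε then Complex.arg (-Complex.I * z) + Real.pi / 2
  else Complex.arg (Complex.I * z) - Real.pi / 2

/-- The complement of the cut of `branchAngle ε`. -/
def branchDomain (ε : Bool) : Set ℂ :=
  if ε then {z | 0 < z.im ∨ z.re ≠ 0} else {z | z.im < 0 ∨ z.re ≠ 0}

theorem isOpen_branchDomain (ε : Bool) : IsOpen (branchDomain ε) := by
  cases ε
  · exact (isOpen_lt Complex.continuous_im continuous_const).union
      (isOpen_ne_fun Complex.continuous_re continuous_const)
  · exact (isOpen_lt continuous_const Complex.continuous_im).union
      (isOpen_ne_fun Complex.continuous_re continuous_const)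

theorem exists_mem_branchDomain {z : ℂ} (hz : z ≠ 0) : ∃ ε, z ∈ branchDomain ε := by
  rcases lt_trichotomy z.im 0 with h | h | h
  · exact ⟨false, Or.inl h⟩
  · refine ⟨true, Or.inr fun h' => hz (Complex.ext h' h)⟩
  · exact ⟨true, Or.inl h⟩

theorem continuousAt_branchAngle {ε : Bool} {z : ℂ} (hz : z ∈ branchDomain ε) :
    ContinuousAt (branchAngle ε) z := by
  cases ε
  · have h : Complex.I * z ∈ Complex.slitPlane := by
      rcases hz with h | h
      · left; simpa using h
      · right; simpa using h
    have h2 : ContinuousAt (fun z => Complex.arg (Complex.I * z)) z :=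
      (Complex.continuousAt_arg h).comp (f := fun z => Complex.I * z) (by fun_prop)
    exact h2.sub (g := fun _ => Real.pi / 2) continuousAt_const
  · have h : -Complex.I * z ∈ Complex.slitPlane := by
      rcases hz with h | h
      · left; simpa using h
      · right; simpa using h
    have h2 : ContinuousAt (fun z => Complex.arg (-Complex.I * z)) z :=
      (Complex.continuousAt_arg h).comp (f := fun z => -Complex.I * z) (by fun_prop)
    exact h2.add (g := fun _ => Real.pi / 2) continuousAt_const

theorem exp_branchAngle (ε : Bool) {z : ℂ} (hz : ‖z‖ = 1) :
    Complex.exp (branchAngle ε z * Complex.I) = z := by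
  cases ε
  · have h := Complex.norm_mul_exp_arg_mul_I (Complex.I * z)
    simp only [norm_mul, Complex.norm_I, hz, one_mul, Complex.ofReal_one] at h
    simp only [branchAngle, Bool.false_eq_true, if_false, Complex.ofReal_sub, sub_mul,
      Complex.exp_sub, h]
    push_cast
    rw [Complex.exp_pi_div_two_mul_I]
    field_simp
  · have h := Complex.norm_mul_exp_arg_mul_I (-Complex.I * z)
    simp only [norm_mul, norm_neg, Complex.norm_I, hz, one_mul, Complex.ofReal_one] at h
    simp only [branchAngle, if_true, Complex.ofReal_add, add_mul, Complex.exp_add, h]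
    push_cast
    rw [Complex.exp_pi_div_two_mul_I]
    linear_combination (-z) * Complex.I_mul_I

theorem arg_I_mul_of_re_pos {z : ℂ} (hz : 0 < z.re) :
    Complex.arg (Complex.I * z) = Complex.arg z + Real.pi / 2 ∧
      Complex.arg (-Complex.I * z) = Complex.arg z - Real.pi / 2 := by
  have h0 : z ≠ 0 := by rintro rfl; simp at hz
  have h1 := abs_lt.1 (Complex.abs_arg_lt_pi_div_two_iff.2 (Or.inl hz))
  have hpi := Real.pi_pos
  constructor
  · rw [Complex.arg_mul Complex.I_ne_zero h0, Complex.arg_I]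
    · ring
    · rw [Complex.arg_I]; constructor <;> linarith [h1.1, h1.2]
  · rw [Complex.arg_mul (neg_ne_zero.2 Complex.I_ne_zero) h0, Complex.arg_neg_I]
    · ring
    · rw [Complex.arg_neg_I]; constructor <;> linarith [h1.1, h1.2]

theorem branchAngle_false_of_re_pos {z : ℂ} (hz : 0 < z.re) :
    branchAngle false z = branchAngle true z := by
  simp only [branchAngle, Bool.false_eq_true, if_false, if_true, arg_I_mul_of_re_pos hz]
  ring

theorem branchAngle_false_of_re_neg {z : ℂ} (hz : z.re < 0) :
    branchAngle false z = branchAngle true z - 2 * Real.pi := by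
  have h := arg_I_mul_of_re_pos (z := -z) (by simpa using hz)
  rw [mul_neg, neg_mul_neg, ← neg_mul] at h
  simp only [branchAngle, Bool.false_eq_true, if_false, if_true, h]
  ring

theorem branchAngle_false_of_re_nonpos {z : ℂ} (hz : z ∈ branchDomain false) (h : z.re ≤ 0) :
    branchAngle false z = branchAngle true z - 2 * Real.pi := by
  rcases h.lt_or_eq with h | h
  · exact branchAngle_false_of_re_neg h
  · have him : z.im < 0 := by
      rcases hz with h' | h'
      · exact h'
      · exact absurd h h'
    have hz' : z = ((-z.im : ℝ) : ℂ) * (-Complex.I) := by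
      apply Complex.ext <;> simp [h]
    have e1 : Complex.I * z = ((-z.im : ℝ) : ℂ) := by
      rw [hz']; push_cast; simp; ring_nf; simp
    have e2 : -Complex.I * z = ((z.im : ℝ) : ℂ) := by
      rw [neg_mul, e1]; push_cast; ring
    simp only [branchAngle, Bool.false_eq_true, if_false, if_true, e1, e2]
    rw [Complex.arg_ofReal_of_nonneg (by linarith), Complex.arg_ofReal_of_neg him]
    ring

/-- The integer nearest to `r / 2π`. -/
def turns (r : ℝ) : ℤ := round (r / (2 * Real.pi))

theorem turns_two_pi_mul (n : ℤ) : turns (2 * Real.pi * n) = n := by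
  have := Real.pi_ne_zero
  rw [turns, mul_div_cancel_left₀ _ (by positivity), round_intCast]

theorem turns_add_two_pi_mul (r : ℝ) (n : ℤ) : turns (r + 2 * Real.pi * n) = turns r + n := by
  have := Real.pi_ne_zero
  rw [turns, add_div, mul_div_cancel_left₀ _ (by positivity), round_add_intCast, turns]

theorem exists_eq_two_pi_mul_of_exp_eq_one {r : ℝ} (h : Complex.exp (r * Complex.I) = 1) :
    ∃ n : ℤ, r = 2 * Real.pi * n := by
  obtain ⟨n, hn⟩ := Complex.exp_eq_one_iff.1 h
  refine ⟨n, ?_⟩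
  have hI := Complex.I_ne_zero
  have : (r : ℂ) = 2 * Real.pi * n := by
    apply mul_right_cancel₀ hI
    linear_combination hn
  exact_mod_cast this

/-- The winding number of a continuous function with values in `2πℤ` is locally constant. -/
theorem eventually_turns_eq {X : Type*} [TopologicalSpace X] {f : X → ℝ} {x : X}
    (hf : ContinuousAt f x) (hint : ∀ᶠ y in nhds x, ∃ n : ℤ, f y = 2 * Real.pi * n) :
    ∀ᶠ y in nhds x, turns (f y) = turns (f x) := by
  have hpi := Real.pi_pos
  have h1 : ∀ᶠ y in nhds x, |f y - f x| < 2 * Real.pi :=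
    (Metric.tendsto_nhds.1 hf.tendsto) (2 * Real.pi) (by positivity)
  obtain ⟨n, hn⟩ := hint.self_of_nhds
  filter_upwards [h1, hint] with y hy ⟨m, hm⟩
  rw [hm, hn, turns_two_pi_mul, turns_two_pi_mul]
  rw [hm, hn, ← mul_sub, abs_mul, abs_of_pos (by positivity : 0 < 2 * Real.pi)] at hy
  have h2 : |(m : ℝ) - n| < 1 := by
    by_contra! h
    nlinarith
  have h3 : |m - n| < 1 := by exact_mod_cast h2
  have := Int.abs_lt_one_iff.1 h3
  omega

/-! ### The twice punctured plane as a union of two bent half planes -/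

/-- The height above the real axis of the zigzag that bounds the bent half planes; it vanishes only
at real part `±3`. -/
def wallHeight (z : ℂ) : ℝ := |(|z.re| - 3)|

theorem continuous_wallHeight : Continuous wallHeight := by
  unfold wallHeight; fun_prop

/-- The part of the plane above the lower zigzag (for `ε = true`) or below the upper one (for
`ε = false`). The two cover the plane minus `±3`, each is simply connected, and their intersection
has three components. -/
def bentHalfPlane (ε : Bool) : Set ℂ :=
  if ε then {z | -wallHeight z < z.im} else {z | z.im < wallHeight z}

theorem isOpen_bentHalfPlane (ε : Bool) : IsOpen (bentHalfPlane ε) := by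
  cases ε
  · exact isOpen_lt Complex.continuous_im continuous_wallHeight
  · exact isOpen_lt continuous_wallHeight.neg Complex.continuous_im

theorem exists_mem_bentHalfPlane {z : ℂ} (h3 : z ≠ 3) (h3' : z ≠ -3) :
    ∃ ε, z ∈ bentHalfPlane ε := by
  by_contra! h
  have h1 : ¬ (-wallHeight z < z.im) := h true
  have h2 : ¬ (z.im < wallHeight z) := h false
  have h4 : 0 ≤ wallHeight z := abs_nonneg _
  have h5 : wallHeight z = 0 := by linarith
  have h6 : z.im = 0 := by linarith
  have h7 : |z.re| = 3 := by
    have := abs_eq_zero.1 h5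
    linarith
  rcases (abs_eq (by norm_num)).1 h7 with h8 | h8
  · exact h3 (Complex.ext h8 h6)
  · exact h3' (Complex.ext (by simpa using h8) (by simpa using h6))

theorem ne_of_mem_bentHalfPlane {ε : Bool} {z : ℂ} (h : z ∈ bentHalfPlane ε) : z ≠ 3 ∧ z ≠ -3 := by
  constructor <;> rintro rfl <;> cases ε <;> simp [bentHalfPlane, wallHeight] at h

/-- A vertical shear, which straightens the boundary of a bent half plane for `c = ±1`. -/
def wallShear (c : ℝ) : ℂ ≃ₜ ℂ where
  toFun z := z + (c * wallHeight z : ℝ) * Complex.I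
  invFun z := z - (c * wallHeight z : ℝ) * Complex.I
  left_inv z := by simp [wallHeight]
  right_inv z := by simp [wallHeight]
  continuous_toFun := by have := continuous_wallHeight; fun_prop
  continuous_invFun := by have := continuous_wallHeight; fun_prop

theorem simplyConnectedSpace_bentHalfPlane (ε : Bool) :
    SimplyConnectedSpace (bentHalfPlane ε) := by
  cases ε
  · have h : IsSimplyConnected (wallShear (-1) '' (bentHalfPlane false)) := by
      have e : wallShear (-1) '' (bentHalfPlane false) = {z : ℂ | z.im < 0} := by
        rw [← (wallShear (-1)).coe_toEquiv, Equiv.image_eq_preimage_symm]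
        ext z
        change z.im + -_ < |(|z.re + -_| - 3)| ↔ z.im < 0
        simp [wallHeight]
      rw [e]
      have := (convex_halfSpace_im_lt 0).contractibleSpace ⟨-Complex.I, by simp⟩
      exact SimplyConnectedSpace.ofContractible _
    exact ((wallShear (-1)).isSimplyConnected_image.1 h)
  · have h : IsSimplyConnected (wallShear 1 '' (bentHalfPlane true)) := by
      have e : wallShear 1 '' (bentHalfPlane true) = {z : ℂ | 0 < z.im} := by
        rw [← (wallShear 1).coe_toEquiv, Equiv.image_eq_preimage_symm]
        ext z
        change -|(|z.re + -_| - 3)| < z.im + -_ ↔ 0 < z.im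
        simp [wallHeight]
      rw [e]
      have := (convex_halfSpace_im_gt 0).contractibleSpace ⟨Complex.I, by simp⟩
      exact SimplyConnectedSpace.ofContractible _
    exact ((wallShear 1).isSimplyConnected_image.1 h)

/-! ### The ends of the twice punctured plane -/

/-- Polar coordinates near the three ends of the plane minus `±3`: `i = 0` is the end at infinity,
`i = 1` the end at `-3` and `i = 2` the end at `3`; the end is approached as `ρ → 0`. For `ρ = 1`
these are the boundary circles of the three-holed sphere, so that the ends are collars attached to
the three-holed sphere along them. -/
def endMap (i : Fin 3) (q : ℂ) (ρ : ℝ) : ℂ :=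
  match i with
  | 0 => 7 * q / ρ
  | 1 => -3 + ρ * q
  | 2 => 3 + ρ * q

/-- Near an end, a bent half plane avoids the cut of the corresponding branch of the angle. -/
theorem mem_branchDomain_of_endMap {i : Fin 3} {q : ℂ} {ρ : ℝ} (hq : ‖q‖ = 1) (h0 : 0 < ρ)
    (h1 : ρ < 1) {ε : Bool} (h : endMap i q ρ ∈ bentHalfPlane ε) : q ∈ branchDomain ε := by
  suffices H : q.re = 0 → (ε = true → 0 < q.im) ∧ (ε = false → q.im < 0) by
    by_cases hre : q.re = 0
    · cases ε
      · exact Or.inl ((H hre).2 rfl)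
      · exact Or.inl ((H hre).1 rfl)
    · cases ε
      · exact Or.inr hre
      · exact Or.inr hre
  intro hre
  match i with
  | 0 =>
    have e1 : (endMap 0 q ρ).re = 0 := by
      simp [endMap, Complex.div_ofReal_re, hre]
    have e2 : (endMap 0 q ρ).im = 7 / ρ * q.im := by
      simp [endMap, Complex.div_ofReal_im]; ring
    have e3 : wallHeight (endMap 0 q ρ) = 3 := by simp [wallHeight, e1]
    have e4 : |q.im| = 1 := by
      rw [← hq, Complex.norm_def, Complex.normSq_apply, hre]
      simp [Real.sqrt_mul_self_eq_abs]
    have e5 : 3 < 7 / ρ := by rw [lt_div_iff₀ h0]; nlinarith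
    constructor
    · rintro rfl
      have h' : -3 < 7 / ρ * q.im := by
        have : -wallHeight (endMap 0 q ρ) < (endMap 0 q ρ).im := h
        rwa [e2, e3] at this
      rcases (abs_eq zero_le_one).1 e4 with e | e <;> rw [e] at h' ⊢ <;> linarith
    · rintro rfl
      have h' : 7 / ρ * q.im < 3 := by
        have : (endMap 0 q ρ).im < wallHeight (endMap 0 q ρ) := h
        rwa [e2, e3] at this
      rcases (abs_eq zero_le_one).1 e4 with e | e <;> rw [e] at h' ⊢ <;> linarith
  | 1 =>
    have e1 : (endMap 1 q ρ).re = -3 := by simp [endMap, hre]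
    have e2 : (endMap 1 q ρ).im = ρ * q.im := by simp [endMap]
    have e3 : wallHeight (endMap 1 q ρ) = 0 := by simp [wallHeight, e1]
    constructor
    · rintro rfl
      have : -wallHeight (endMap 1 q ρ) < (endMap 1 q ρ).im := h
      rw [e2, e3, neg_zero] at this
      exact pos_of_mul_pos_right this h0.le
    · rintro rfl
      have : (endMap 1 q ρ).im < wallHeight (endMap 1 q ρ) := h
      rw [e2, e3] at this
      by_contra! hh
      exact absurd this (not_lt.2 (mul_nonneg h0.le hh))
  | 2 =>
    have e1 : (endMap 2 q ρ).re = 3 := by simp [endMap, hre]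
    have e2 : (endMap 2 q ρ).im = ρ * q.im := by simp [endMap]
    have e3 : wallHeight (endMap 2 q ρ) = 0 := by simp [wallHeight, e1]
    constructor
    · rintro rfl
      have : -wallHeight (endMap 2 q ρ) < (endMap 2 q ρ).im := h
      rw [e2, e3, neg_zero] at this
      exact pos_of_mul_pos_right this h0.le
    · rintro rfl
      have : (endMap 2 q ρ).im < wallHeight (endMap 2 q ρ) := h
      rw [e2, e3] at this
      by_contra! hh
      exact absurd this (not_lt.2 (mul_nonneg h0.le hh))

/-- The three components of the intersection of the two bent half planes. -/
theorem re_lt_of_mem_inter {z : ℂ} (h : z ∈ bentHalfPlane true ∩ bentHalfPlane false) :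
    z.re < -3 ∨ (-3 < z.re ∧ z.re < 3 ∧ ‖z‖ < 7) ∨ 3 < z.re := by
  have h1 : -wallHeight z < z.im := h.1
  have h2 : z.im < wallHeight z := h.2
  have hw : 0 < wallHeight z := by linarith
  have him : |z.im| < wallHeight z := abs_lt.2 ⟨h1, h2⟩
  by_cases h3 : |z.re| < 3
  · right; left
    refine ⟨(abs_lt.1 h3).1, (abs_lt.1 h3).2, ?_⟩
    have e : wallHeight z = 3 - |z.re| := by
      rw [wallHeight, abs_of_neg (by linarith)]; ring
    have := Complex.norm_le_abs_re_add_abs_im z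
    linarith
  · have h4 : |z.re| ≠ 3 := by
      intro h5
      rw [wallHeight, h5] at hw
      simp at hw
    have h6 : 3 < |z.re| := lt_of_le_of_ne (not_lt.1 h3) (Ne.symm h4)
    rcases lt_abs.1 h6 with h | h
    · right; right; exact h
    · left; linarith

/-! ### Fillings of the product of the twice punctured plane and the circle -/

/-- The plane minus the points `±3`, which is the interior of the three-holed sphere with its ends
drawn out. -/
abbrev TwicePuncturedPlane : Type := {z : ℂ // z ≠ 3 ∧ z ≠ -3}

/-- Coordinates exhibiting `M` as a filling of `(ℂ ∖ {±3}) × S¹` by three open solid tori. The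
`i`-th solid torus `V i` has coordinates `p` in `S¹` and `W` in the open unit disk, and on its
overlap with the product, which is the complement of the core `W = 0`, the product coordinates are
`y = endMap i (p * t ^ k i) ‖W‖` and `t = W / ‖W‖`. The functions `y` and `p` are total, but
meaningful only where `W ≠ 0` and on the solid tori. -/
structure FillingAtlas (k : Fin 3 → ℤ) (M : Type*) [TopologicalSpace M] where
  /-- The disk coordinate. It is defined on all of `M` and vanishes on the cores. -/
  W : M → ℂ
  continuous_W : Continuous W
  /-- The page coordinate, off the cores. -/
  y : M → ℂ
  continuousAt_y : ∀ m, W m ≠ 0 → ContinuousAt y m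
  y_ne : ∀ m, W m ≠ 0 → y m ≠ 3 ∧ y m ≠ -3
  /-- The open solid tori. -/
  V : Fin 3 → Set M
  isOpen_V : ∀ i, IsOpen (V i)
  disjoint_V : ∀ i j m, m ∈ V i → m ∈ V j → i = j
  cover : ∀ m, W m = 0 → ∃ i, m ∈ V i
  /-- The coordinate along the core, in the solid tori. -/
  p : M → ℂ
  continuousAt_p : ∀ i, ∀ m ∈ V i, ContinuousAt p m
  norm_p : ∀ i, ∀ m ∈ V i, ‖p m‖ = 1
  norm_W_lt : ∀ i, ∀ m ∈ V i, ‖W m‖ < 1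
  y_eq : ∀ i, ∀ m ∈ V i, W m ≠ 0 → y m = endMap i (p m * (W m / ‖W m‖) ^ k i) ‖W m‖
  /-- The inverse of the product coordinates. -/
  eN : C(TwicePuncturedPlane × Circle, M)
  W_eN : ∀ q, W (eN q) ≠ 0
  y_eN : ∀ q, y (eN q) = q.1
  t_eN : ∀ q, W (eN q) / ‖W (eN q)‖ = q.2
  eN_eq : ∀ m q, W m ≠ 0 → y m = q.1 → W m / ‖W m‖ = q.2 → eN q = m
  /-- The inverse of the solid torus coordinates. -/
  eV : Fin 3 → C(Circle × Metric.ball (0 : ℂ) 1, M)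
  eV_mem : ∀ i q, eV i q ∈ V i
  p_eV : ∀ i q, p (eV i q) = q.1
  W_eV : ∀ i q, W (eV i q) = q.2
  eV_eq : ∀ i q m, m ∈ V i → p m = q.1 → W m = q.2 → eV i q = m

namespace FillingAtlas

variable {k : Fin 3 → ℤ} {M : Type*} [TopologicalSpace M] (A : FillingAtlas k M)

/-- The `S¹` coordinate away from the cores. -/
def t (m : M) : ℂ := A.W m / ‖A.W m‖

theorem norm_t {m : M} (h : A.W m ≠ 0) : ‖A.t m‖ = 1 := by
  rw [t, norm_div, Complex.norm_real, norm_norm, div_self (norm_ne_zero_iff.2 h)]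

theorem continuousAt_t {m : M} (h : A.W m ≠ 0) : ContinuousAt A.t m := by
  refine A.continuous_W.continuousAt.div ?_ (by simpa using h)
  exact (Complex.continuous_ofReal.comp A.continuous_W.norm).continuousAt

theorem norm_fiber {i : Fin 3} {m : M} (hm : m ∈ A.V i) (h : A.W m ≠ 0) :
    ‖A.p m * A.t m ^ k i‖ = 1 := by
  rw [norm_mul, norm_zpow, A.norm_p i m hm, A.norm_t h]; simp

/-- The indices of the charts: pairs of a bent half plane and a branch of the angle of `t` off the
cores, and pairs of a solid torus and a branch of the angle of `p`. -/
abbrev ChartIndex : Type := (Bool × Bool) ⊕ (Fin 3 × Bool)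

/-- An open cover of `M`: on each set the coordinates and branches of their angles are defined. -/
def chart : ChartIndex → Set M
  | .inl (ε, δ) => {m | A.W m ≠ 0 ∧ A.y m ∈ bentHalfPlane ε ∧ A.t m ∈ branchDomain δ}
  | .inr (i, ε) => {m | m ∈ A.V i ∧ A.p m ∈ branchDomain ε}

theorem isOpen_chart (α : ChartIndex) : IsOpen (A.chart α) := by
  rw [isOpen_iff_mem_nhds]
  intro m hm
  match α with
  | .inl (ε, δ) =>
    obtain ⟨h1, h2, h3⟩ := hm
    filter_upwards [A.continuous_W.continuousAt.eventually_ne h1,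
      (A.continuousAt_y m h1).preimage_mem_nhds ((isOpen_bentHalfPlane ε).mem_nhds h2),
      (A.continuousAt_t h1).preimage_mem_nhds ((isOpen_branchDomain δ).mem_nhds h3)]
      with m' a b c
    exact ⟨a, b, c⟩
  | .inr (i, ε) =>
    obtain ⟨h1, h2⟩ := hm
    filter_upwards [(A.isOpen_V i).mem_nhds h1,
      (A.continuousAt_p i m h1).preimage_mem_nhds ((isOpen_branchDomain ε).mem_nhds h2)] with m' a b
    exact ⟨a, b⟩

theorem exists_mem_chart (m : M) : ∃ α, m ∈ A.chart α := by
  by_cases h : A.W m = 0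
  · obtain ⟨i, hi⟩ := A.cover m h
    obtain ⟨ε, hε⟩ := exists_mem_branchDomain (z := A.p m) (by
      rw [← norm_ne_zero_iff, A.norm_p i m hi]; exact one_ne_zero)
    exact ⟨.inr (i, ε), hi, hε⟩
  · obtain ⟨ε, hε⟩ := exists_mem_bentHalfPlane (A.y_ne m h).1 (A.y_ne m h).2
    obtain ⟨δ, hδ⟩ := exists_mem_branchDomain (z := A.t m) (by
      rw [← norm_ne_zero_iff, A.norm_t h]; exact one_ne_zero)
    exact ⟨.inl (ε, δ), h, hε, hδ⟩

theorem mem_branchDomain_fiber {i : Fin 3} {m : M} (hm : m ∈ A.V i) (h : A.W m ≠ 0) {ε : Bool}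
    (hε : A.y m ∈ bentHalfPlane ε) : A.p m * A.t m ^ k i ∈ branchDomain ε := by
  rw [A.y_eq i m hm h] at hε
  exact mem_branchDomain_of_endMap (A.norm_fiber hm h) (norm_pos_iff.2 h) (A.norm_W_lt i m hm) hε

end FillingAtlas

section

variable {G : Type*} [Group G]

open Classical in
/-- The frames over the two bent half planes of the local system on the page with holonomy `x i`
around the `i`-th end. On each of the three components of the intersection, the frame over the lower
half plane differs from the one over the upper half plane by a constant. It is chosen, outside the
intersection, so as to have the form `pageFrame_endMap` near the ends. -/
def pageFrame (x : Fin 3 → G) (ε : Bool) (y : ℂ) : G :=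
  if ε then 1
  else if 7 < ‖y‖ then (if y.re ≤ 0 then (x 0)⁻¹ else 1)
  else if y.re ≤ -3 then (x 0)⁻¹ else if y.re ≤ 3 then (x 2)⁻¹ else 1

/-- The constant by which `pageFrame` near the `i`-th end differs from a frame that depends on the
angle only. -/
def endFrame (x : Fin 3 → G) (i : Fin 3) (ε : Bool) : G :=
  if ε = false ∧ i = 1 then (x 2)⁻¹ else 1

theorem turns_branchAngle_sub {ε : Bool} {q : ℂ} (hq : q ∈ branchDomain ε) :
    turns (branchAngle ε q - branchAngle true q) = if ε = false ∧ q.re ≤ 0 then -1 else 0 := by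
  have h0 : turns 0 = 0 := by simpa using turns_two_pi_mul 0
  cases ε
  · by_cases h : q.re ≤ 0
    · rw [branchAngle_false_of_re_nonpos hq h, if_pos ⟨rfl, h⟩]
      convert turns_two_pi_mul (-1) using 2
      push_cast; ring
    · rw [branchAngle_false_of_re_pos (not_le.1 h), sub_self, h0, if_neg (by tauto)]
  · simp [h0]

/-- Near the `i`-th end, `pageFrame` is the standard frame of holonomy `x i` in the angle, up to a
constant factor. -/
theorem pageFrame_endMap {x : Fin 3 → G} (hx : x 0 = x 2 * x 1) {i : Fin 3} {q : ℂ} {ρ : ℝ}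
    (hq : ‖q‖ = 1) (h0 : 0 < ρ) (h1 : ρ < 1) {ε : Bool} (hε : q ∈ branchDomain ε) :
    pageFrame x ε (endMap i q ρ) =
      x i ^ turns (branchAngle ε q - branchAngle true q) * endFrame x i ε := by
  rw [turns_branchAngle_sub hε]
  cases ε
  · have hre := abs_le.1 ((Complex.abs_re_le_norm q).trans hq.le)
    match i with
    | 0 =>
      have e1 : 7 < ‖endMap 0 q ρ‖ := by
        simp only [endMap, norm_div, norm_mul, hq, Complex.norm_real, Real.norm_eq_abs,
          abs_of_pos h0, mul_one]
        rw [lt_div_iff₀ h0]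
        norm_num; linarith
      have e2 : (endMap 0 q ρ).re ≤ 0 ↔ q.re ≤ 0 := by
        have : (endMap 0 q ρ).re = 7 / ρ * q.re := by
          simp [endMap, Complex.div_ofReal_re]; ring
        rw [this]
        have h7 : 0 < 7 / ρ := by positivity
        constructor
        · intro h; by_contra! hh; exact absurd h (not_le.2 (mul_pos h7 hh))
        · intro h; exact mul_nonpos_of_nonneg_of_nonpos h7.le h
      simp only [pageFrame, Bool.false_eq_true, if_false, if_pos e1, e2, endFrame]
      by_cases h : q.re ≤ 0 <;> simp [h]
    | 1 =>
      have e1 : ¬ 7 < ‖endMap 1 q ρ‖ := by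
        have : ‖endMap 1 q ρ‖ ≤ 3 + ρ * 1 := by
          refine (norm_add_le _ _).trans ?_
          rw [norm_mul, hq, Complex.norm_real, Real.norm_eq_abs, abs_of_pos h0]
          simp
        linarith
      have hr : (endMap 1 q ρ).re = -3 + ρ * q.re := by simp [endMap]
      have e2 : (endMap 1 q ρ).re ≤ -3 ↔ q.re ≤ 0 := by
        rw [hr]
        constructor
        · intro h; by_contra! hh; have := mul_pos h0 hh; linarith
        · intro h; have := mul_nonpos_of_nonneg_of_nonpos h0.le h; linarith
      have e3 : (endMap 1 q ρ).re ≤ 3 := by rw [hr]; nlinarith [hre.2]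
      simp only [pageFrame, Bool.false_eq_true, if_false, if_neg e1, e2, endFrame, if_pos e3]
      by_cases h : q.re ≤ 0 <;> simp [h, hx]
    | 2 =>
      have e1 : ¬ 7 < ‖endMap 2 q ρ‖ := by
        have : ‖endMap 2 q ρ‖ ≤ 3 + ρ * 1 := by
          refine (norm_add_le _ _).trans ?_
          rw [norm_mul, hq, Complex.norm_real, Real.norm_eq_abs, abs_of_pos h0]
          simp
        linarith
      have hr : (endMap 2 q ρ).re = 3 + ρ * q.re := by simp [endMap]
      have e2 : (endMap 2 q ρ).re ≤ 3 ↔ q.re ≤ 0 := by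
        rw [hr]
        constructor
        · intro h; by_contra! hh; have := mul_pos h0 hh; linarith
        · intro h; have := mul_nonpos_of_nonneg_of_nonpos h0.le h; linarith
      have e3 : ¬ (endMap 2 q ρ).re ≤ -3 := by rw [hr]; nlinarith [hre.1]
      simp only [pageFrame, Bool.false_eq_true, if_false, if_neg e1, e2, endFrame, if_neg e3]
      by_cases h : q.re ≤ 0 <;> simp [h]
  · simp [pageFrame, endFrame]

theorem pageFrame_strip (x : Fin 3 → G) {z : ℂ}
    (h : z ∈ bentHalfPlane true ∩ bentHalfPlane false) :
    pageFrame x false z = if z.re < -3 then (x 0)⁻¹ else if z.re < 3 then (x 2)⁻¹ else 1 := by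
  simp only [pageFrame, Bool.false_eq_true, if_false]
  rcases re_lt_of_mem_inter h with h | ⟨h1, h2, h3⟩ | h
  · rw [if_pos (by linarith : z.re ≤ 0), if_pos h.le, if_pos h, ite_self]
  · rw [if_neg (by linarith), if_neg (by linarith), if_pos h2.le, if_neg (by linarith), if_pos h2]
  · have h1 : ¬ z.re ≤ 0 := by linarith
    have h2 : ¬ z.re ≤ -3 := by linarith
    have h4 : ¬ z.re < -3 := by linarith
    simp [h1, h2, h4, not_le.2 h, not_lt.2 h.le]

theorem eventually_pageFrame (x : Fin 3 → G) {z : ℂ} {ε ε' : Bool}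
    (h : z ∈ bentHalfPlane ε ∩ bentHalfPlane ε') :
    ∀ᶠ z' in nhds z, (pageFrame x ε z')⁻¹ * pageFrame x ε' z' =
      (pageFrame x ε z)⁻¹ * pageFrame x ε' z := by
  have key : ∀ z ∈ bentHalfPlane true ∩ bentHalfPlane false,
      ∀ᶠ z' in nhds z, pageFrame x false z' = pageFrame x false z := by
    intro z h
    have hopen := ((isOpen_bentHalfPlane true).inter (isOpen_bentHalfPlane false)).mem_nhds h
    have hc := Complex.continuous_re.continuousAt (x := z)
    rcases re_lt_of_mem_inter h with h1 | ⟨h1, h2, -⟩ | h1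
    · filter_upwards [hopen, hc.eventually_lt_const h1] with z' hz' h'
      rw [pageFrame_strip x h, pageFrame_strip x hz', if_pos h1, if_pos h']
    · filter_upwards [hopen, hc.eventually_const_lt h1, hc.eventually_lt_const h2] with
        z' hz' h' h''
      rw [pageFrame_strip x h, pageFrame_strip x hz', if_neg h1.not_gt, if_pos h2,
        if_neg h'.not_gt, if_pos h'']
    · filter_upwards [hopen, hc.eventually_const_lt h1] with z' hz' h'
      rw [pageFrame_strip x h, pageFrame_strip x hz', if_neg (by linarith), if_neg (by linarith),
        if_neg (by linarith), if_neg (by linarith)]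
  have htrue : ∀ z, pageFrame x true z = 1 := fun z => by simp [pageFrame]
  cases ε <;> cases ε'
  · simp
  · filter_upwards [key z h.symm] with z' hz'
    rw [htrue, htrue, hz']
  · filter_upwards [key z h] with z' hz'
    rw [htrue, htrue, hz']
  · simp

end

/-! ### The local system with given holonomy -/

namespace FillingAtlas

variable {k : Fin 3 → ℤ} {M : Type*} [TopologicalSpace M] (A : FillingAtlas k M)
  {G : Type*} [Group G]

/-- Frames, over the charts, of the local system on `M` with holonomy `x i` around the ends of the
page and `τ` along the circle factor. -/
def frame (x : Fin 3 → G) (τ : G) : ChartIndex → M → G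
  | .inl (ε, δ), m => pageFrame x ε (A.y m) *
      τ ^ turns (branchAngle δ (A.t m) - branchAngle true (A.t m))
  | .inr (i, ε), m => x i ^ turns (branchAngle ε (A.p m) + k i * branchAngle true (A.t m) -
      branchAngle true (A.p m * A.t m ^ k i))

theorem exists_branchAngle_sub (ε ε' : Bool) {z : ℂ} (hz : ‖z‖ = 1) :
    ∃ n : ℤ, branchAngle ε z - branchAngle ε' z = 2 * Real.pi * n := by
  refine exists_eq_two_pi_mul_of_exp_eq_one ?_
  rw [Complex.ofReal_sub, sub_mul, Complex.exp_sub, exp_branchAngle ε hz, exp_branchAngle ε' hz,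
    div_self]
  rw [← norm_ne_zero_iff, hz]; exact one_ne_zero

theorem exists_branchAngle_add (ε δ ε' : Bool) {z w : ℂ} (hz : ‖z‖ = 1) (hw : ‖w‖ = 1) (n : ℤ) :
    ∃ m : ℤ, branchAngle ε z + n * branchAngle δ w - branchAngle ε' (z * w ^ n) =
      2 * Real.pi * m := by
  have hzw : ‖z * w ^ n‖ = 1 := by rw [norm_mul, norm_zpow, hz, hw]; simp
  refine exists_eq_two_pi_mul_of_exp_eq_one ?_
  have e : ((n * branchAngle δ w : ℝ) : ℂ) * Complex.I = n * (branchAngle δ w * Complex.I) := by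
    push_cast; ring
  rw [Complex.ofReal_sub, Complex.ofReal_add, sub_mul, add_mul, e, Complex.exp_sub,
    Complex.exp_add, Complex.exp_int_mul, exp_branchAngle ε hz, exp_branchAngle δ hw,
    exp_branchAngle ε' hzw, div_self]
  rw [← norm_ne_zero_iff, hzw]; exact one_ne_zero

theorem _root_.commute_of_zpow_mul_eq_one {x τ : G} {n : ℤ} (h : x ^ n * τ = 1) : Commute τ x := by
  rw [eq_inv_of_mul_eq_one_right h]
  exact ((Commute.refl x).zpow_left _).inv_left

/-- The transition function between a product chart and a solid torus chart is a power of `x i`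
whose exponent is a winding number, because `τ = (x i) ^ (-k i)`. The branches `true` that normalize
the frames cancel. -/
theorem frame_inl_inv_mul_frame_inr {x : Fin 3 → G} {τ : G} (hx : x 0 = x 2 * x 1)
    (hτ : ∀ i, x i ^ k i * τ = 1) {ε δ ε' : Bool} {i : Fin 3} {m : M}
    (h : m ∈ A.chart (.inl (ε, δ)) ∩ A.chart (.inr (i, ε'))) :
    (A.frame x τ (.inl (ε, δ)) m)⁻¹ * A.frame x τ (.inr (i, ε')) m =
      (endFrame x i ε)⁻¹ * x i ^ turns (branchAngle ε' (A.p m) + k i * branchAngle δ (A.t m) -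
        branchAngle ε (A.p m * A.t m ^ k i)) := by
  obtain ⟨⟨hW, hy, ht⟩, hV, hp⟩ := h
  have hq := A.norm_fiber hV hW
  have hfr : pageFrame x ε (A.y m) =
      x i ^ turns (branchAngle ε (A.p m * A.t m ^ k i) - branchAngle true (A.p m * A.t m ^ k i)) *
        endFrame x i ε := by
    rw [A.y_eq i m hV hW]
    exact pageFrame_endMap hx hq (norm_pos_iff.2 hW) (A.norm_W_lt i m hV)
      (A.mem_branchDomain_fiber hV hW hy)
  change (pageFrame x ε (A.y m) * _)⁻¹ * x i ^ _ = _
  rw [hfr]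
  set q := A.p m * A.t m ^ k i
  have hτ' : τ = x i ^ (-k i) := by
    rw [zpow_neg]; exact (inv_eq_of_mul_eq_one_right (hτ i)).symm
  change (x i ^ turns (branchAngle ε q - branchAngle true q) * _ * _)⁻¹ * _ = _
  obtain ⟨n₁, h₁⟩ := exists_branchAngle_sub ε true hq
  obtain ⟨n₂, h₂⟩ := exists_branchAngle_sub δ true (A.norm_t hW)
  obtain ⟨n₃, h₃⟩ := exists_branchAngle_add ε' true true (A.norm_p i m hV) (A.norm_t hW) (k i)
  have h₄ : branchAngle ε' (A.p m) + k i * branchAngle δ (A.t m) - branchAngle ε q =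
      2 * Real.pi * ((n₃ + k i * n₂ - n₁ : ℤ) : ℝ) := by
    push_cast
    linear_combination h₃ + k i * h₂ - h₁
  rw [h₁, h₂, h₃, h₄, turns_two_pi_mul, turns_two_pi_mul, turns_two_pi_mul, turns_two_pi_mul]
  have hcomm : Commute τ (endFrame x i ε) := by
    rw [endFrame]
    split_ifs
    · exact (commute_of_zpow_mul_eq_one (hτ 2)).inv_right
    · exact Commute.one_right _
  rw [mul_assoc, ← (hcomm.zpow_left n₂).eq, ← mul_assoc, mul_inv_rev, mul_assoc]
  congr 1
  rw [hτ', ← zpow_mul, ← zpow_add, ← zpow_neg, ← zpow_add]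
  congr 1
  ring

/-- The transition functions of the frames are locally constant. -/
theorem eventually_frame {x : Fin 3 → G} {τ : G} (hx : x 0 = x 2 * x 1)
    (hτ : ∀ i, x i ^ k i * τ = 1) (α β : ChartIndex) {m : M} (h : m ∈ A.chart α ∩ A.chart β) :
    ∀ᶠ m' in nhds m, (A.frame x τ β m')⁻¹ * A.frame x τ α m' =
      (A.frame x τ β m)⁻¹ * A.frame x τ α m := by
  have hopen := ((A.isOpen_chart α).inter (A.isOpen_chart β)).mem_nhds h
  have hNV : ∀ (ε δ ε' : Bool) (i : Fin 3) (m : M),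
      m ∈ A.chart (.inl (ε, δ)) ∩ A.chart (.inr (i, ε')) → ∀ᶠ m' in nhds m,
      (A.frame x τ (.inl (ε, δ)) m')⁻¹ * A.frame x τ (.inr (i, ε')) m' =
      (A.frame x τ (.inl (ε, δ)) m)⁻¹ * A.frame x τ (.inr (i, ε')) m := by
    intro ε δ ε' i m h
    have hopen := ((A.isOpen_chart (.inl (ε, δ))).inter (A.isOpen_chart (.inr (i, ε')))).mem_nhds h
    have hc : ContinuousAt (fun m => branchAngle ε' (A.p m) + k i * branchAngle δ (A.t m) -
        branchAngle ε (A.p m * A.t m ^ k i)) m := by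
      obtain ⟨⟨hW, hy, ht⟩, hV, hp⟩ := h
      have hcp := A.continuousAt_p i m hV
      have hct := A.continuousAt_t hW
      have hq := A.mem_branchDomain_fiber hV hW hy
      have ht0 : A.t m ≠ 0 := by rw [← norm_ne_zero_iff, A.norm_t hW]; exact one_ne_zero
      refine ContinuousAt.sub (ContinuousAt.add ?_ (ContinuousAt.mul continuousAt_const ?_)) ?_
      · exact ContinuousAt.comp (f := A.p) (continuousAt_branchAngle hp) hcp
      · exact ContinuousAt.comp (f := A.t) (continuousAt_branchAngle ht) hct
      · exact ContinuousAt.comp (f := fun m => A.p m * A.t m ^ k i) (continuousAt_branchAngle hq)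
          (hcp.mul (hct.zpow₀ _ (Or.inl ht0)))
    have := eventually_turns_eq hc (Filter.mem_of_superset hopen fun m' h' =>
      exists_branchAngle_add ε' δ ε (A.norm_p i m' h'.2.1) (A.norm_t h'.1.1) (k i))
    filter_upwards [hopen, this] with m' h' ht
    rw [A.frame_inl_inv_mul_frame_inr hx hτ h, A.frame_inl_inv_mul_frame_inr hx hτ h', ht]
  match α, β with
  | .inl (ε, δ), .inl (ε', δ') =>
    have hW := h.1.1
    have hct := A.continuousAt_t hW
    have h1 := (A.continuousAt_y m hW).eventually (eventually_pageFrame x ⟨h.2.2.1, h.1.2.1⟩)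
    have hc : ContinuousAt (fun m => branchAngle δ (A.t m) - branchAngle δ' (A.t m)) m :=
      (ContinuousAt.comp (f := A.t) (continuousAt_branchAngle h.1.2.2) hct).sub
        (ContinuousAt.comp (f := A.t) (continuousAt_branchAngle h.2.2.2) hct)
    have h2 := eventually_turns_eq hc (Filter.mem_of_superset hopen fun m' h' =>
      exists_branchAngle_sub δ δ' (A.norm_t h'.1.1))
    have hcT : ∀ ε z, Commute τ (pageFrame x ε z) := by
      intro ε z
      rw [pageFrame]
      split_ifs <;>
        first
        | exact Commute.one_right _
        | exact (commute_of_zpow_mul_eq_one (hτ _)).inv_right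
    have key : ∀ m, A.W m ≠ 0 → (A.frame x τ (.inl (ε', δ')) m)⁻¹ * A.frame x τ (.inl (ε, δ)) m =
        (pageFrame x ε' (A.y m))⁻¹ * pageFrame x ε (A.y m) *
          τ ^ turns (branchAngle δ (A.t m) - branchAngle δ' (A.t m)) := by
      intro m hW
      obtain ⟨n₁, h₁⟩ := exists_branchAngle_sub δ true (A.norm_t hW)
      obtain ⟨n₂, h₂⟩ := exists_branchAngle_sub δ' true (A.norm_t hW)
      have h₃ : branchAngle δ (A.t m) - branchAngle δ' (A.t m) =
          2 * Real.pi * ((n₁ - n₂ : ℤ) : ℝ) := by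
        push_cast; linear_combination h₁ - h₂
      simp only [frame, h₁, h₂, h₃, turns_two_pi_mul]
      rw [mul_inv_rev, ((hcT ε' (A.y m)).zpow_left n₂).inv_inv.eq, mul_assoc, mul_assoc,
        ← ((hcT ε (A.y m)).zpow_left n₁).eq, ← mul_assoc (τ ^ n₂)⁻¹, ← zpow_neg, ← zpow_add,
        ((hcT ε (A.y m)).zpow_left _).eq, neg_add_eq_sub]
    filter_upwards [h1, h2, hopen] with m' h1 h2 h'
    rw [key m hW, key m' h'.1.1, h1, h2]
  | .inl (ε, δ), .inr (i, ε') =>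
    filter_upwards [hNV ε δ ε' i m h] with m' h'
    rw [← inv_inj, mul_inv_rev, mul_inv_rev, inv_inv, inv_inv]
    exact h'
  | .inr (i, ε'), .inl (ε, δ) =>
    exact hNV ε δ ε' i m h.symm
  | .inr (i, ε), .inr (j, ε') =>
    obtain rfl := A.disjoint_V i j m h.1.1 h.2.1
    have hcp := A.continuousAt_p i m h.1.1
    have hc : ContinuousAt (fun m => branchAngle ε (A.p m) - branchAngle ε' (A.p m)) m :=
      (ContinuousAt.comp (f := A.p) (continuousAt_branchAngle h.1.2) hcp).sub
        (ContinuousAt.comp (f := A.p) (continuousAt_branchAngle h.2.2) hcp)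
    have h2 := eventually_turns_eq hc (Filter.mem_of_superset hopen fun m' h' =>
      exists_branchAngle_sub ε ε' (A.norm_p i m' h'.1.1))
    have key : ∀ m ∈ A.V i, (A.frame x τ (.inr (i, ε')) m)⁻¹ * A.frame x τ (.inr (i, ε)) m =
        x i ^ turns (branchAngle ε (A.p m) - branchAngle ε' (A.p m)) := by
      intro m hm
      obtain ⟨n, hn⟩ := exists_branchAngle_sub ε ε' (A.norm_p i m hm)
      rw [hn, turns_two_pi_mul]
      have e : branchAngle ε (A.p m) = branchAngle ε' (A.p m) + 2 * Real.pi * n := by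
        linarith
      have e' : branchAngle ε (A.p m) + k i * branchAngle true (A.t m) -
          branchAngle true (A.p m * A.t m ^ k i) = branchAngle ε' (A.p m) +
          k i * branchAngle true (A.t m) - branchAngle true (A.p m * A.t m ^ k i) +
          2 * Real.pi * n := by rw [e]; ring
      simp only [frame]
      rw [e', turns_add_two_pi_mul, zpow_add, inv_mul_cancel_left]
    filter_upwards [h2, hopen] with m' h2 h'
    rw [key m h.1.1, key m' h'.1.1, h2]

/-- A group generated by elements satisfying the filling relations is trivial if `M` is simply
connected: a flat section of the local system is compared along the two halves of a loop around each
end of the page, and along the two halves of the circle factor. -/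
theorem eq_one_of_simplyConnectedSpace (A : FillingAtlas k M) [SimplyConnectedSpace M]
    {x : Fin 3 → G} {τ : G} (hx : x 0 = x 2 * x 1) (hτ : ∀ i, x i ^ k i * τ = 1) :
    x 0 = 1 ∧ x 2 = 1 ∧ τ = 1 := by
  obtain ⟨u, hu⟩ := exists_flat_section A.isOpen_chart A.exists_mem_chart (A.frame x τ)
    (fun α β m h => A.eventually_frame hx hτ α β h)
  have t_eN : ∀ q, A.t (A.eN q) = q.2 := A.t_eN
  have h1D : ∀ δ, (1 : ℂ) ∈ branchDomain δ := fun δ => by cases δ <;> right <;> simp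
  -- The frames along a path in one bent half plane.
  have hpage : ∀ (ε : Bool) (z z' : TwicePuncturedPlane), z.1 ∈ bentHalfPlane ε →
      z'.1 ∈ bentHalfPlane ε →
      (pageFrame x ε z)⁻¹ * u (A.eN (z, 1)) = (pageFrame x ε z')⁻¹ * u (A.eN (z', 1)) := by
    intro ε z z' hz hz'
    have := simplyConnectedSpace_bentHalfPlane ε
    obtain ⟨γ⟩ := PathConnectedSpace.joined (⟨z.1, hz⟩ : bentHalfPlane ε) ⟨z'.1, hz'⟩
    let f : C(bentHalfPlane ε, M) :=
      ⟨fun w => A.eN (⟨w.1, ne_of_mem_bentHalfPlane w.2⟩, 1), by fun_prop⟩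
    have h := hu (.inl (ε, true)) (γ.map f.continuous) (fun s => by
      refine ⟨A.W_eN _, ?_, ?_⟩
      · change A.y (A.eN _) ∈ _
        rw [A.y_eN]; exact (γ s).2
      · change A.t (A.eN _) ∈ _
        rw [t_eN]; simpa using h1D true)
    have hf : ∀ w : bentHalfPlane ε, A.frame x τ (.inl (ε, true)) (f w) = pageFrame x ε w := by
      intro w
      simp only [frame, f, ContinuousMap.coe_mk, A.y_eN, sub_self]
      rw [show turns 0 = 0 by simpa using turns_two_pi_mul 0, zpow_zero, mul_one]
    rwa [hf, hf] at h
  have hzero : turns 0 = 0 := by simpa using turns_two_pi_mul 0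
  have memR : ∀ ε, ((10 : ℝ) : ℂ) ∈ bentHalfPlane ε := fun ε => by
    cases ε <;> simp [bentHalfPlane, wallHeight, -Complex.ofReal_ofNat] <;> norm_num
  have memM : ∀ ε, ((0 : ℝ) : ℂ) ∈ bentHalfPlane ε := fun ε => by
    cases ε <;> simp [bentHalfPlane, wallHeight]
  have memL : ∀ ε, ((-10 : ℝ) : ℂ) ∈ bentHalfPlane ε := fun ε => by
    cases ε <;> simp [bentHalfPlane, wallHeight, -Complex.ofReal_ofNat, -Complex.ofReal_neg] <;>
      norm_num
  let zR : TwicePuncturedPlane := ⟨_, ne_of_mem_bentHalfPlane (memR true)⟩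
  let zM : TwicePuncturedPlane := ⟨_, ne_of_mem_bentHalfPlane (memM true)⟩
  let zL : TwicePuncturedPlane := ⟨_, ne_of_mem_bentHalfPlane (memL true)⟩
  have ptrue : ∀ z, pageFrame x true z = 1 := fun z => by simp [pageFrame]
  have pR : pageFrame x false zR = 1 := by
    rw [pageFrame_strip x ⟨memR true, memR false⟩, if_neg, if_neg] <;>
      rw [Complex.ofReal_re] <;> norm_num
  have pM : pageFrame x false zM = (x 2)⁻¹ := by
    rw [pageFrame_strip x ⟨memM true, memM false⟩, if_neg, if_pos] <;>
      rw [Complex.ofReal_re] <;> norm_num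
  have pL : pageFrame x false zL = (x 0)⁻¹ := by
    rw [pageFrame_strip x ⟨memL true, memL false⟩, if_pos]
    rw [Complex.ofReal_re]; norm_num
  have hM1 := hpage true zR zM (memR _) (memM _)
  have hM2 := hpage false zR zM (memR _) (memM _)
  have hL1 := hpage true zR zL (memR _) (memL _)
  have hL2 := hpage false zR zL (memR _) (memL _)
  rw [ptrue, ptrue, inv_one, one_mul, one_mul] at hM1 hL1
  rw [pR, pM, inv_one, inv_inv, one_mul, hM1] at hM2
  rw [pR, pL, inv_one, inv_inv, one_mul, hL1] at hL2
  refine ⟨by simpa using hL2.symm, by simpa using hM2.symm, ?_⟩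
  -- The frames along the two halves of the fiber over a point of the page.
  have hfib : ∀ (δ : Bool) (r : ℝ), (∀ s ∈ Set.Icc (0 : ℝ) 1,
      Complex.exp ((s * r : ℝ) * Complex.I) ∈ branchDomain δ) →
      u (A.eN (zR, 1)) = (τ ^ turns (branchAngle δ (Circle.exp r) -
        branchAngle true (Circle.exp r)))⁻¹ * u (A.eN (zR, Circle.exp r)) := by
    intro δ r hr
    let γ : Path (A.eN (zR, 1)) (A.eN (zR, Circle.exp r)) :=
      { toFun := fun s => A.eN (zR, Circle.exp (s * r))
        continuous_toFun := by fun_prop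
        source' := by simp
        target' := by simp }
    have h := hu (.inl (true, δ)) γ (fun s => by
      refine ⟨A.W_eN _, ?_, ?_⟩
      · change A.y (A.eN _) ∈ _
        rw [A.y_eN]; exact memR true
      · change A.t (A.eN _) ∈ _
        rw [t_eN, Circle.coe_exp]; exact hr s s.2)
    have hf : ∀ w : Circle, A.frame x τ (.inl (true, δ)) (A.eN (zR, w)) =
        τ ^ turns (branchAngle δ w - branchAngle true w) := by
      intro w
      simp only [frame, A.y_eN, ptrue, one_mul, t_eN]
    rw [hf, hf] at h
    have h1 : turns (branchAngle δ (1 : Circle) - branchAngle true (1 : Circle)) = 0 := by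
      rw [turns_branchAngle_sub (by simpa using h1D δ), if_neg]
      simp
    rwa [h1, zpow_zero, inv_one, one_mul] at h
  have hT := hfib true Real.pi (fun s hs => by
    rcases eq_or_lt_of_le hs.1 with h0 | h0
    · rw [← h0]; simpa using h1D true
    rcases eq_or_lt_of_le hs.2 with h1 | h1
    · right
      rw [h1, one_mul, Complex.exp_pi_mul_I]; simp
    · left
      rw [Complex.exp_ofReal_mul_I_im]
      exact Real.sin_pos_of_pos_of_lt_pi (by positivity) (by nlinarith [Real.pi_pos]))
  have hF := hfib false (-Real.pi) (fun s hs => by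
    rcases eq_or_lt_of_le hs.1 with h0 | h0
    · rw [← h0]; simpa using h1D false
    rcases eq_or_lt_of_le hs.2 with h1 | h1
    · right
      rw [h1, one_mul, Complex.exp_ofReal_mul_I_re]; simp
    · left
      rw [Complex.exp_ofReal_mul_I_im, mul_neg, Real.sin_neg]
      have := Real.sin_pos_of_pos_of_lt_pi (x := s * Real.pi) (by positivity)
        (by nlinarith [Real.pi_pos])
      linarith)
  have hpi : Circle.exp (-Real.pi) = Circle.exp Real.pi := by
    apply Circle.ext
    rw [Circle.coe_exp, Circle.coe_exp, Complex.exp_pi_mul_I, Complex.ofReal_neg, neg_mul,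
      Complex.exp_neg, Complex.exp_pi_mul_I]
    norm_num
  have hval : (Circle.exp Real.pi : ℂ) = -1 := by rw [Circle.coe_exp, Complex.exp_pi_mul_I]
  rw [sub_self, hzero, zpow_zero, inv_one, one_mul] at hT
  rw [hpi, hval, turns_branchAngle_sub (Or.inr (by simp)), if_pos (by simp), zpow_neg_one, inv_inv,
    hT] at hF
  simpa using hF.symm

end FillingAtlas

section Groupoid

open CategoryTheory

/-! ### Paths in the fundamental groupoid -/

section General

variable {X Y E : Type*} [TopologicalSpace X] [TopologicalSpace Y] [TopologicalSpace E]

/-- The class of a path, as a morphism of the fundamental groupoid. -/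
abbrev pathArrow {x y : X} (γ : Path x y) : FundamentalGroupoid.mk x ⟶ FundamentalGroupoid.mk y :=
  Path.Homotopic.Quotient.mk γ

theorem pathArrow_trans {x y z : X} (γ : Path x y) (γ' : Path y z) :
    pathArrow (γ.trans γ') = pathArrow γ ≫ pathArrow γ' := rfl

/-- The class of a loop in the fundamental group. -/
def loopClass {x : X} (γ : Path x x) : FundamentalGroup X x := pathArrow γ

/-- Two paths that lift to paths with the same endpoints in a simply connected space `E` over `X`
(not necessarily a covering) are homotopic. -/
theorem pathArrow_eq_of_lifts [SimplyConnectedSpace E] (h : C(E, X)) {x y : X} {γ γ' : Path x y}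
    (Γ Γ' : C(I, E)) (h0 : Γ 0 = Γ' 0) (h1 : Γ 1 = Γ' 1) (hΓ : ∀ s, h (Γ s) = γ s)
    (hΓ' : ∀ s, h (Γ' s) = γ' s) : pathArrow γ = pathArrow γ' := by
  let p : Path (Γ 0) (Γ 1) := ⟨Γ, rfl, rfl⟩
  let p' : Path (Γ 0) (Γ 1) := ⟨Γ', h0.symm, h1.symm⟩
  have hp : (p.map h.continuous).Homotopic (p'.map h.continuous) :=
    (SimplyConnectedSpace.paths_homotopic p p').map h
  have e0 : x = h (Γ 0) := by rw [hΓ, γ.source]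
  have e1 : y = h (Γ 1) := by rw [hΓ, γ.target]
  have hp' := hp.pathCast e0 e1
  have e : (p.map h.continuous).cast e0 e1 = γ := by
    ext s; exact hΓ s
  have e' : (p'.map h.continuous).cast e0 e1 = γ' := by
    ext s; exact hΓ' s
  rw [e, e'] at hp'
  exact Path.Homotopic.Quotient.eq.2 hp'

instance : SimplyConnectedSpace ℝ := SimplyConnectedSpace.ofContractible ℝ

/-- The loop that runs `n` times through the period of a `2π`-periodic function. -/
def periodicLoop (h : C(ℝ, X)) (hper : ∀ r, h (r + 2 * Real.pi) = h r) (n : ℤ) :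
    Path (h 0) (h 0) where
  toFun s := h (s * (2 * Real.pi * n))
  continuous_toFun := by fun_prop
  source' := by simp
  target' := by
    have hp : Function.Periodic h (2 * Real.pi) := hper
    simpa [mul_comm] using (hp.int_mul n) 0

theorem loopClass_periodicLoop (h : C(ℝ, X)) (hper : ∀ r, h (r + 2 * Real.pi) = h r) (n : ℤ) :
    loopClass (periodicLoop h hper n) = loopClass (periodicLoop h hper 1) ^ n := by
  have hadd : ∀ m n : ℤ, pathArrow (periodicLoop h hper (m + n)) =
      pathArrow (periodicLoop h hper m) ≫ pathArrow (periodicLoop h hper n) := by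
    intro m n
    rw [← pathArrow_trans]
    let q₁ : Path (0 : ℝ) (2 * Real.pi * m) :=
      { toFun := fun s => s * (2 * Real.pi * m)
        continuous_toFun := by fun_prop
        source' := by simp
        target' := by simp }
    let q₂ : Path (2 * Real.pi * m) (2 * Real.pi * (m + n)) :=
      { toFun := fun s => s * (2 * Real.pi * n) + m * (2 * Real.pi)
        continuous_toFun := by fun_prop
        source' := by simp; ring
        target' := by simp; ring }
    have hp : Function.Periodic h (2 * Real.pi) := hper
    refine pathArrow_eq_of_lifts h
      ⟨fun s : I => (s : ℝ) * (2 * Real.pi * ((m + n : ℤ) : ℝ)), by fun_prop⟩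
      (q₁.trans q₂ : C(I, ℝ)) ?_ ?_ (fun s => rfl) ?_
    · simp
    · simp
    · intro s
      simp only [ContinuousMap.coe_coe, Path.trans_apply]
      split_ifs with hs
      · rfl
      · exact (hp.int_mul m) _
  let φ : Multiplicative ℤ →* FundamentalGroup X (h 0) :=
    MonoidHom.mk' (fun n => loopClass (periodicLoop h hper n.toAdd)) (fun a b => by
      -- The product of `FundamentalGroup` is concatenation in the reverse order.
      have := hadd b.toAdd a.toAdd
      rw [add_comm] at this
      exact this)
  have := map_zpow φ (Multiplicative.ofAdd 1) n
  rw [← ofAdd_zsmul, smul_eq_mul, mul_one] at this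
  exact this

/-- Paths with the same endpoints in `Y` become homotopic under `f`; for a path-connected space `Y`
this says that `f` is trivial on the fundamental group. -/
def PathTrivial (f : C(Y, X)) : Prop :=
  ∀ ⦃y y' : Y⦄ (γ γ' : Path y y'),
    pathArrow (γ.map f.continuous) = pathArrow (γ'.map f.continuous)

theorem pathArrow_map_trans (f : C(Y, X)) {x y z : Y} (γ : Path x y) (γ' : Path y z) :
    pathArrow ((γ.trans γ').map f.continuous) =
      pathArrow (γ.map f.continuous) ≫ pathArrow (γ'.map f.continuous) := by
  rw [Path.map_trans]; rfl

theorem pathTrivial_of_loops [PathConnectedSpace Y] (f : C(Y, X)) (y₀ : Y)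
    (h : ∀ γ : Path y₀ y₀, pathArrow (γ.map f.continuous) = 𝟙 _) : PathTrivial f := by
  intro y y' γ γ'
  let δ := PathConnectedSpace.somePath y₀ y
  let δ' := PathConnectedSpace.somePath y' y₀
  have h1 := h ((δ.trans γ).trans δ')
  have h2 := h ((δ.trans γ').trans δ')
  rw [pathArrow_map_trans, pathArrow_map_trans] at h1 h2
  have h3 := h1.trans h2.symm
  rwa [cancel_mono, cancel_epi] at h3

/-- A map is trivial on paths if there are reference paths `p y` from a base point to each `f y`
that are compatible with short paths. -/
theorem pathTrivial_of_cover {ι : Type*} (f : C(Y, X)) {U : ι → Set Y} (hU : ∀ i, IsOpen (U i))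
    (hcov : ∀ y, ∃ i, y ∈ U i) {x₀ : X}
    (p : ∀ y, FundamentalGroupoid.mk x₀ ⟶ FundamentalGroupoid.mk (f y))
    (H : ∀ i {y y' : Y} (γ : Path y y'), (∀ s, γ s ∈ U i) →
      p y ≫ pathArrow (γ.map f.continuous) = p y') : PathTrivial f := by
  intro y y' γ γ'
  have h1 : p y ≫ pathArrow (γ.map f.continuous) = p y' := trans_map_eq_of_cover f hU hcov p H γ
  have h2 : p y ≫ pathArrow (γ'.map f.continuous) = p y' := trans_map_eq_of_cover f hU hcov p H γ'
  rw [← cancel_epi (p y), h1, h2]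

end General

section Star
variable {X ι : Type*} [TopologicalSpace X]

/-- A form of the Seifert-van Kampen theorem: a space is simply connected if it is covered by an
open set `N` and disjoint open sets `V i` such that paths within one of these sets with the same
endpoints are homotopic in the whole space, and `N` as well as each `V i` and `V i ∩ N` is
path-connected. -/
theorem simplyConnectedSpace_of_star [Nonempty X] {N : Set X} {V : ι → Set X} (hN : IsOpen N)
    (hV : ∀ i, IsOpen (V i)) (hcov : ∀ x, x ∈ N ∨ ∃ i, x ∈ V i)
    (hdisj : ∀ i j x, x ∈ V i → x ∈ V j → i = j)
    (hNc : IsPathConnected N) (hVN : ∀ i, ∃ b ∈ V i ∩ N, ∀ x ∈ V i, JoinedIn (V i) b x ∧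
      (x ∈ N → JoinedIn (V i ∩ N) b x))
    (hNt : ∀ ⦃x y : X⦄ (γ γ' : Path x y), (∀ s, γ s ∈ N) → (∀ s, γ' s ∈ N) →
      pathArrow γ = pathArrow γ')
    (hVt : ∀ i ⦃x y : X⦄ (γ γ' : Path x y), (∀ s, γ s ∈ V i) → (∀ s, γ' s ∈ V i) →
      pathArrow γ = pathArrow γ') : SimplyConnectedSpace X := by
  obtain ⟨x₀, hx₀, hN'⟩ := hNc
  choose b hb hbj using hVN
  let c : ∀ i, Path x₀ (b i) := fun i => (hN' (hb i).2).somePath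
  have hc : ∀ i s, c i s ∈ N := fun i => (hN' (hb i).2).somePath_mem
  have hp : ∀ x, ∃ q : FundamentalGroupoid.mk x₀ ⟶ FundamentalGroupoid.mk x,
      (∀ γ : Path x₀ x, (∀ s, γ s ∈ N) → q = pathArrow γ) ∧
      ∀ i, ∀ γ : Path (b i) x, (∀ s, γ s ∈ V i) → q = pathArrow (c i) ≫ pathArrow γ := by
    intro x
    by_cases hx : x ∈ N
    · refine ⟨pathArrow (hN' hx).somePath,
        fun γ hγ => hNt _ _ (hN' hx).somePath_mem hγ, fun i γ hγ => ?_⟩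
      have hxi : x ∈ V i := by simpa using hγ 1
      have hj := (hbj i x hxi).2 hx
      rw [hVt i γ hj.somePath hγ (fun s => (hj.somePath_mem s).1), ← pathArrow_trans]
      refine hNt _ _ (hN' hx).somePath_mem (fun s => ?_)
      rw [Path.trans_apply]
      split_ifs
      · exact hc i _
      · exact (hj.somePath_mem _).2
    · obtain ⟨i, hi⟩ := (hcov x).resolve_left hx
      refine ⟨pathArrow (c i) ≫ pathArrow (hbj i x hi).1.somePath,
        fun γ hγ => absurd (by simpa using hγ 1) hx, fun j γ hγ => ?_⟩
      obtain rfl := hdisj i j x hi (by simpa using hγ 1)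
      rw [hVt i _ γ (hbj i x hi).1.somePath_mem hγ]
  choose p hpN hpV using hp
  have hconn : PathConnectedSpace X := by
    have hj : ∀ x, Joined x₀ x := fun x => by
      rcases hcov x with hx | ⟨i, hi⟩
      · exact (hN' hx).joined
      · exact (hN' (hb i).2).joined.trans (hbj i x hi).1.joined
    exact ⟨⟨x₀⟩, fun x y => (hj x).symm.trans (hj y)⟩
  have htriv : PathTrivial (ContinuousMap.id X) := by
    refine pathTrivial_of_cover (ContinuousMap.id X) (U := fun i : Option ι => i.elim N V)
      (by rintro (_ | i); exacts [hN, hV i]) (fun x => ?_) p ?_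
    · rcases hcov x with hx | ⟨i, hi⟩
      · exact ⟨none, hx⟩
      · exact ⟨some i, hi⟩
    · rintro (_ | i) x y γ hγ
      · have hx : x ∈ N := by simpa using hγ 0
        have e1 := hpN x _ (hN' hx).somePath_mem
        have e2 := hpN y ((hN' hx).somePath.trans γ) (fun s => by
          rw [Path.trans_apply]
          split_ifs
          · exact (hN' hx).somePath_mem _
          · exact hγ _)
        rw [e1, e2]; rfl
      · have hx : x ∈ V i := by simpa using hγ 0
        have hj := (hbj i x hx).1
        have e1 := hpV x i hj.somePath hj.somePath_mem
        have e2 := hpV y i (hj.somePath.trans γ) (fun s => by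
          rw [Path.trans_apply]
          split_ifs
          · exact hj.somePath_mem _
          · exact hγ _)
        rw [e1, e2, pathArrow_trans]
        exact Category.assoc _ _ _
  refine simply_connected_iff_paths_homotopic'.2 ⟨hconn, fun {x y} γ γ' => ?_⟩
  exact Path.Homotopic.Quotient.eq.1 (htriv γ γ')

end Star

/-! ### The fundamental groupoid of the page -/

theorem convex_leftStrip : Convex ℝ {z : ℂ | z.re + z.im < -3 ∧ z.re - z.im < -3} := by
  refine Convex.inter (convex_halfSpace_lt (f := fun z : ℂ => z.re + z.im) ⟨?_, ?_⟩ _)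
    (convex_halfSpace_lt (f := fun z : ℂ => z.re - z.im) ⟨?_, ?_⟩ _)
  · intro x y; simp; ring
  · intro c x; simp; ring
  · intro x y; simp; ring
  · intro c x; simp; ring

theorem convex_rightStrip : Convex ℝ {z : ℂ | 3 < z.re + z.im ∧ 3 < z.re - z.im} := by
  refine Convex.inter (convex_halfSpace_gt (f := fun z : ℂ => z.re + z.im) ⟨?_, ?_⟩ _)
    (convex_halfSpace_gt (f := fun z : ℂ => z.re - z.im) ⟨?_, ?_⟩ _)
  · intro x y; simp; ring
  · intro c x; simp; ring
  · intro x y; simp; ring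
  · intro c x; simp; ring

theorem convex_middleStrip : Convex ℝ {z : ℂ | (-3 < z.re + z.im ∧ -3 < z.re - z.im) ∧
    (z.re + z.im < 3 ∧ z.re - z.im < 3)} := by
  refine Convex.inter (Convex.inter
    (convex_halfSpace_gt (f := fun z : ℂ => z.re + z.im) ⟨?_, ?_⟩ _)
    (convex_halfSpace_gt (f := fun z : ℂ => z.re - z.im) ⟨?_, ?_⟩ _))
    (Convex.inter (convex_halfSpace_lt (f := fun z : ℂ => z.re + z.im) ⟨?_, ?_⟩ _)
    (convex_halfSpace_lt (f := fun z : ℂ => z.re - z.im) ⟨?_, ?_⟩ _))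
  all_goals (intro x y; simp; ring)

/-- The intersection of the two bent half planes. -/
abbrev pageOverlap : Set ℂ := bentHalfPlane true ∩ bentHalfPlane false

theorem mem_pageOverlap {z : ℂ} :
    z ∈ pageOverlap ↔ -wallHeight z < z.im ∧ z.im < wallHeight z := Iff.rfl

/-- The three components of the intersection of the bent half planes, from left to right. -/
def pageStrip : Fin 3 → Set ℂ
  | 0 => {z : ℂ | z.re + z.im < -3 ∧ z.re - z.im < -3}
  | 1 => {z : ℂ | (-3 < z.re + z.im ∧ -3 < z.re - z.im) ∧ (z.re + z.im < 3 ∧ z.re - z.im < 3)}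
  | 2 => {z : ℂ | 3 < z.re + z.im ∧ 3 < z.re - z.im}

theorem pageStrip_subset (j : Fin 3) : pageStrip j ⊆ pageOverlap := by
  intro z hz
  rw [mem_pageOverlap, wallHeight]
  match j with
  | 0 =>
    obtain ⟨h1, h2⟩ := hz
    rw [abs_of_neg (by linarith : z.re < 0), abs_of_pos (by linarith)]
    constructor <;> linarith
  | 1 =>
    obtain ⟨⟨h1, h2⟩, h3, h4⟩ := hz
    have : |z.re| < 3 := abs_lt.2 ⟨by linarith, by linarith⟩
    rw [abs_of_neg (by linarith)]
    rcases abs_cases z.re with ⟨e, -⟩ | ⟨e, -⟩ <;> rw [e] <;> constructor <;> linarith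
  | 2 =>
    obtain ⟨h1, h2⟩ := hz
    rw [abs_of_pos (by linarith : 0 < z.re), abs_of_pos (by linarith)]
    constructor <;> linarith

theorem exists_mem_pageStrip {z : ℂ} (hz : z ∈ pageOverlap) : ∃ j, z ∈ pageStrip j := by
  have h := re_lt_of_mem_inter hz
  rw [mem_pageOverlap, wallHeight] at hz
  obtain ⟨h1, h2⟩ := hz
  rcases h with h | ⟨h, h', -⟩ | h
  · rw [abs_of_neg (by linarith : z.re < 0), abs_of_pos (by linarith)] at h1 h2
    exact ⟨0, by linarith, by linarith⟩
  · have : |z.re| < 3 := abs_lt.2 ⟨h, h'⟩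
    rw [abs_of_neg (by linarith : |z.re| - 3 < 0)] at h1 h2
    have h3 := le_abs_self z.re
    have h4 := neg_abs_le z.re
    exact ⟨1, ⟨by linarith, by linarith⟩, by linarith, by linarith⟩
  · rw [abs_of_pos (by linarith : 0 < z.re), abs_of_pos (by linarith)] at h1 h2
    exact ⟨2, by linarith, by linarith⟩

theorem convex_pageStrip (j : Fin 3) : Convex ℝ (pageStrip j) :=
  match j with
  | 0 => convex_leftStrip
  | 1 => convex_middleStrip
  | 2 => convex_rightStrip

theorem ofReal_mem_pageStrip (r : ℝ) : ((r : ℂ) ∈ pageStrip 0 ↔ r < -3) ∧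
    ((r : ℂ) ∈ pageStrip 1 ↔ -3 < r ∧ r < 3) ∧ ((r : ℂ) ∈ pageStrip 2 ↔ 3 < r) := by
  simp only [pageStrip, Set.mem_ofPred_eq, Complex.ofReal_re, Complex.ofReal_im, add_zero,
    sub_zero, and_self]

/-- The inclusion of a bent half plane in the twice punctured plane. -/
def bentHalfPlaneInclusion (ε : Bool) : C(bentHalfPlane ε, TwicePuncturedPlane) :=
  ⟨fun z => ⟨z.1, ne_of_mem_bentHalfPlane z.2⟩, by fun_prop⟩

/-- Some path from `z` to `z'` within a bent half plane; it is unique up to homotopy. -/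
def halfPath {ε : Bool} {z z' : TwicePuncturedPlane} (h : z.1 ∈ bentHalfPlane ε)
    (h' : z'.1 ∈ bentHalfPlane ε) : Path z z' :=
  have := simplyConnectedSpace_bentHalfPlane ε
  (PathConnectedSpace.somePath (⟨z.1, h⟩ : bentHalfPlane ε) ⟨z'.1, h'⟩).map
    (bentHalfPlaneInclusion ε).continuous

theorem halfPath_mem {ε : Bool} {z z' : TwicePuncturedPlane} (h : z.1 ∈ bentHalfPlane ε)
    (h' : z'.1 ∈ bentHalfPlane ε) (s : I) : (halfPath h h' s).1 ∈ bentHalfPlane ε :=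
  have := simplyConnectedSpace_bentHalfPlane ε
  ((PathConnectedSpace.somePath (⟨z.1, h⟩ : bentHalfPlane ε) ⟨z'.1, h'⟩) s).2

section Page

variable {X : Type*} [TopologicalSpace X] (f : C(TwicePuncturedPlane, X))

/-- The image under `f` of the homotopy class of paths from `z` to `z'` in a bent half plane. -/
def halfArrow (ε : Bool) {z z' : TwicePuncturedPlane} (h : z.1 ∈ bentHalfPlane ε)
    (h' : z'.1 ∈ bentHalfPlane ε) :
    FundamentalGroupoid.mk (f z) ⟶ FundamentalGroupoid.mk (f z') :=
  pathArrow ((halfPath h h').map f.continuous)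

theorem pathArrow_eq_halfArrow {ε : Bool} {z z' : TwicePuncturedPlane} (h : z.1 ∈ bentHalfPlane ε)
    (h' : z'.1 ∈ bentHalfPlane ε) (γ : Path z z') (hγ : ∀ s, (γ s).1 ∈ bentHalfPlane ε) :
    pathArrow (γ.map f.continuous) = halfArrow f ε h h' := by
  have := simplyConnectedSpace_bentHalfPlane ε
  refine pathArrow_eq_of_lifts (f.comp (bentHalfPlaneInclusion ε))
    ⟨fun s => ⟨(γ s).1, hγ s⟩, by fun_prop⟩
    ⟨fun s => ⟨(halfPath h h' s).1, halfPath_mem h h' s⟩, by fun_prop⟩ ?_ ?_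
    (fun s => rfl) (fun s => rfl)
  · simp
  · simp

theorem halfArrow_trans {ε : Bool} {z z' z'' : TwicePuncturedPlane} (h : z.1 ∈ bentHalfPlane ε)
    (h' : z'.1 ∈ bentHalfPlane ε) (h'' : z''.1 ∈ bentHalfPlane ε) :
    halfArrow f ε h h' ≫ halfArrow f ε h' h'' = halfArrow f ε h h'' := by
  rw [← pathArrow_eq_halfArrow f h h'' ((halfPath h h').trans (halfPath h' h'')),
    pathArrow_map_trans]
  · rfl
  · intro s
    rw [Path.trans_apply]
    split_ifs <;> apply halfPath_mem

theorem halfArrow_self {ε : Bool} {z : TwicePuncturedPlane} (h : z.1 ∈ bentHalfPlane ε) :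
    halfArrow f ε h h = 𝟙 _ := by
  rw [← pathArrow_eq_halfArrow f h h (Path.refl z) (fun s => h)]; rfl

theorem inv_halfArrow {ε : Bool} {z z' : TwicePuncturedPlane} (h : z.1 ∈ bentHalfPlane ε)
    (h' : z'.1 ∈ bentHalfPlane ε) : inv (halfArrow f ε h h') = halfArrow f ε h' h :=
  IsIso.inv_eq_of_hom_inv_id (by rw [halfArrow_trans, halfArrow_self])

theorem halfArrow_true_eq_false {j : Fin 3} {z z' : TwicePuncturedPlane} (h : z.1 ∈ pageStrip j)
    (h' : z'.1 ∈ pageStrip j) :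
    halfArrow f true (pageStrip_subset j h).1 (pageStrip_subset j h').1 =
      halfArrow f false (pageStrip_subset j h).2 (pageStrip_subset j h').2 := by
  obtain ⟨γ, hγ⟩ := ((convex_pageStrip j).isPathConnected ⟨z.1, h⟩).joinedIn z.1 h z'.1 h'
  let γ' : Path z z' :=
    { toFun := fun s => ⟨γ s, ne_of_mem_bentHalfPlane (pageStrip_subset j (hγ s)).1⟩
      continuous_toFun := by fun_prop
      source' := by simp
      target' := by simp }
  rw [← pathArrow_eq_halfArrow f _ _ γ' (fun s => (pageStrip_subset j (hγ s)).1),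
    ← pathArrow_eq_halfArrow f _ _ γ' (fun s => (pageStrip_subset j (hγ s)).2)]

/-- The points of the twice punctured plane in the `j`-th component of the intersection. -/
abbrev StripPoint (j : Fin 3) : Type := {z : TwicePuncturedPlane // z.1 ∈ pageStrip j}

theorem StripPoint.mem {j : Fin 3} (z : StripPoint j) (ε : Bool) : z.1.1 ∈ bentHalfPlane ε :=
  match ε with
  | true => (pageStrip_subset j z.2).1
  | false => (pageStrip_subset j z.2).2

/-- `halfArrow` between points that lie in both bent half planes. -/
def stripArrow (ε : Bool) {j j' : Fin 3} (z : StripPoint j) (z' : StripPoint j') :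
    FundamentalGroupoid.mk (f z.1) ⟶ FundamentalGroupoid.mk (f z'.1) :=
  halfArrow f ε (z.mem ε) (z'.mem ε)

theorem stripArrow_trans (ε : Bool) {j j' j'' : Fin 3} (z : StripPoint j)
    (z' : StripPoint j') (z'' : StripPoint j'') :
    stripArrow f ε z z' ≫ stripArrow f ε z' z'' = stripArrow f ε z z'' :=
  halfArrow_trans f _ _ _

theorem stripArrow_trans_assoc (ε : Bool) {j j' j'' : Fin 3} (z : StripPoint j)
    (z' : StripPoint j') (z'' : StripPoint j'') {w : FundamentalGroupoid X}
    (g : FundamentalGroupoid.mk (f z''.1) ⟶ w) :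
    stripArrow f ε z z' ≫ stripArrow f ε z' z'' ≫ g = stripArrow f ε z z'' ≫ g := by
  rw [← Category.assoc, stripArrow_trans]

theorem stripArrow_congr (ε ε' : Bool) {j : Fin 3} (z z' : StripPoint j) :
    stripArrow f ε z z' = stripArrow f ε' z z' := by
  have h := halfArrow_true_eq_false f z.2 z'.2
  cases ε <;> cases ε'
  · rfl
  · exact h.symm
  · exact h
  · rfl

/-- A passage from one bent half plane to the other may take place at any point of a component of
their intersection. -/
theorem stripArrow_switch (ε ε' : Bool) {i j l : Fin 3} (a : StripPoint i) (z z' : StripPoint j)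
    (b : StripPoint l) : stripArrow f ε a z ≫ stripArrow f ε' z b =
      stripArrow f ε a z' ≫ stripArrow f ε' z' b := by
  rw [← stripArrow_trans f ε a z' z, Category.assoc, stripArrow_congr f ε ε' z' z,
    stripArrow_trans]

/-- If the passages from the right component to the other two through the upper and lower bent half
planes agree under `f`, then `f` is trivial on the fundamental group of the page. -/
theorem pathTrivial_page (zR : StripPoint 2) (zM : StripPoint 1) (zL : StripPoint 0)
    (hM : stripArrow f true zR zM = stripArrow f false zR zM)
    (hL : stripArrow f true zR zL = stripArrow f false zR zL) : PathTrivial f := by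
  have key : ∀ z : TwicePuncturedPlane, ∃ q : FundamentalGroupoid.mk (f zR.1) ⟶ .mk (f z),
      ∀ ε (h : z.1 ∈ bentHalfPlane ε), q = halfArrow f ε (zR.mem ε) h := by
    intro z
    by_cases ht : z.1 ∈ bentHalfPlane true
    · refine ⟨halfArrow f true (zR.mem true) ht, fun ε h => ?_⟩
      cases ε
      · obtain ⟨j, hj⟩ := exists_mem_pageStrip ⟨ht, h⟩
        have : ∀ w : StripPoint j, stripArrow f true zR w = stripArrow f false zR w →
            stripArrow f true zR (⟨z, hj⟩ : StripPoint j) = stripArrow f false zR ⟨z, hj⟩ := by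
          intro w hw
          rw [← stripArrow_trans f true zR w, hw, stripArrow_congr f true false w,
            stripArrow_trans]
        match j with
        | 0 => exact this zL hL
        | 1 => exact this zM hM
        | 2 => exact this zR (stripArrow_congr f _ _ _ _)
      · rfl
    · obtain ⟨ε, hε⟩ := exists_mem_bentHalfPlane z.2.1 z.2.2
      cases ε
      · refine ⟨halfArrow f false (zR.mem false) hε, fun ε h => ?_⟩
        cases ε
        · rfl
        · exact absurd h ht
      · exact absurd hε ht
  choose q hq using key
  refine pathTrivial_of_cover f (U := fun ε => Subtype.val ⁻¹' bentHalfPlane ε)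
    (fun ε => (isOpen_bentHalfPlane ε).preimage continuous_subtype_val)
    (fun z => exists_mem_bentHalfPlane z.2.1 z.2.2) q ?_
  intro ε z z' γ hγ
  have h0 : z.1 ∈ bentHalfPlane ε := by simpa using hγ 0
  have h1 : z'.1 ∈ bentHalfPlane ε := by simpa using hγ 1
  rw [hq z ε h0, hq z' ε h1, pathArrow_eq_halfArrow f h0 h1 γ hγ, halfArrow_trans]

end Page

/-! ### Loops around the ends of the page -/

theorem endMap_ne {i : Fin 3} {q : ℂ} (hq : ‖q‖ = 1) {ρ : ℝ} (h0 : 0 < ρ) (h1 : ρ ≤ 1) :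
    endMap i q ρ ≠ 3 ∧ endMap i q ρ ≠ -3 := by
  have hn : ‖(ρ : ℂ) * q‖ = ρ := by
    rw [norm_mul, hq, mul_one, Complex.norm_real, Real.norm_of_nonneg h0.le]
  have hq0 : (ρ : ℂ) * q ≠ 0 := by
    rw [← norm_ne_zero_iff, hn]; exact h0.ne'
  match i with
  | 0 =>
    have : 7 ≤ ‖endMap 0 q ρ‖ := by
      rw [endMap, norm_div, norm_mul, hq, Complex.norm_real, Real.norm_of_nonneg h0.le,
        le_div_iff₀ h0]
      norm_num; linarith
    constructor <;> intro h <;> rw [h] at this <;> norm_num at this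
  | 1 =>
    refine ⟨fun h => ?_, fun h => hq0 (by simp only [endMap] at h; linear_combination h)⟩
    have : (ρ : ℂ) * q = 6 := by simp only [endMap] at h; linear_combination h
    rw [this] at hn; norm_num at hn; linarith
  | 2 =>
    refine ⟨fun h => hq0 (by simp only [endMap] at h; linear_combination h), fun h => ?_⟩
    have : (ρ : ℂ) * q = -6 := by simp only [endMap] at h; linear_combination h
    rw [this] at hn; norm_num at hn; linarith

/-- A circle around the `i`-th end, parametrized by the angle; the radius `ρ = 1/2` is arbitrary. -/
def endCircle (i : Fin 3) : C(ℝ, TwicePuncturedPlane) where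
  toFun θ := ⟨endMap i (Circle.exp θ) (1 / 2), endMap_ne (by simp) (by norm_num) (by norm_num)⟩
  continuous_toFun := by
    refine Continuous.subtype_mk ?_ _
    match i with
    | 0 => simp only [endMap]; fun_prop
    | 1 => simp only [endMap]; fun_prop
    | 2 => simp only [endMap]; fun_prop

theorem endCircle_periodic (i : Fin 3) : Function.Periodic (endCircle i) (2 * Real.pi) := by
  intro θ
  simp only [endCircle, ContinuousMap.coe_mk, Circle.exp_add, Circle.exp_two_pi, mul_one]

theorem mem_bentHalfPlane_true_of_im_nonneg {z : TwicePuncturedPlane} (h : 0 ≤ z.1.im) :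
    z.1 ∈ bentHalfPlane true := by
  obtain ⟨ε, hε⟩ := exists_mem_bentHalfPlane z.2.1 z.2.2
  cases ε
  · have hw : z.1.im < wallHeight z.1 := hε
    change -wallHeight z.1 < z.1.im
    linarith
  · exact hε

theorem mem_bentHalfPlane_false_of_im_nonpos {z : TwicePuncturedPlane} (h : z.1.im ≤ 0) :
    z.1 ∈ bentHalfPlane false := by
  obtain ⟨ε, hε⟩ := exists_mem_bentHalfPlane z.2.1 z.2.2
  cases ε
  · exact hε
  · have hw : -wallHeight z.1 < z.1.im := hε
    change z.1.im < wallHeight z.1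
    linarith

theorem endCircle_im (i : Fin 3) (θ : ℝ) : ∃ c : ℝ, 0 < c ∧
    (endCircle i θ).1.im = c * Real.sin θ := by
  have h1 : (Circle.exp θ : ℂ).im = Real.sin θ := by
    rw [Circle.coe_exp, Complex.exp_ofReal_mul_I_im]
  have h0 : (endCircle i θ).1 = endMap i (Circle.exp θ) (1 / 2) := rfl
  rw [h0]
  match i with
  | 0 =>
    refine ⟨14, by norm_num, ?_⟩
    rw [endMap, Complex.div_ofReal_im, ← h1]; simp; ring
  | 1 =>
    refine ⟨1 / 2, by norm_num, ?_⟩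
    rw [endMap, ← h1]; simp
  | 2 =>
    refine ⟨1 / 2, by norm_num, ?_⟩
    rw [endMap, ← h1]; simp

/-- The component of `pageOverlap` in which `endCircle i` lies at angle `0`. -/
def rightStrip : Fin 3 → Fin 3
  | 0 => 2
  | 1 => 1
  | 2 => 2

/-- The component of `pageOverlap` in which `endCircle i` lies at angle `π`. -/
def leftStrip : Fin 3 → Fin 3
  | 0 => 0
  | 1 => 0
  | 2 => 1

theorem endCircle_zero_mem (i : Fin 3) : (endCircle i 0).1 ∈ pageStrip (rightStrip i) := by
  have h0 : (endCircle i 0).1 = endMap i 1 (1 / 2) := by simp [endCircle]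
  rw [h0]
  match i with
  | 0 =>
    have : endMap 0 1 (1 / 2) = ((14 : ℝ) : ℂ) := by simp [endMap]; norm_num
    rw [this]; exact (ofReal_mem_pageStrip _).2.2.2 (by norm_num)
  | 1 =>
    have : endMap 1 1 (1 / 2) = ((-5 / 2 : ℝ) : ℂ) := by simp [endMap]; norm_num
    rw [this]; exact (ofReal_mem_pageStrip _).2.1.2 (by norm_num)
  | 2 =>
    have : endMap 2 1 (1 / 2) = ((7 / 2 : ℝ) : ℂ) := by simp [endMap]; norm_num
    rw [this]; exact (ofReal_mem_pageStrip _).2.2.2 (by norm_num)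

theorem endCircle_pi_mem (i : Fin 3) : (endCircle i Real.pi).1 ∈ pageStrip (leftStrip i) := by
  have h0 : (endCircle i Real.pi).1 = endMap i (-1) (1 / 2) := by
    simp [endCircle]
  rw [h0]
  match i with
  | 0 =>
    have : endMap 0 (-1) (1 / 2) = ((-14 : ℝ) : ℂ) := by simp [endMap]; norm_num
    rw [this]; exact (ofReal_mem_pageStrip _).1.2 (by norm_num)
  | 1 =>
    have : endMap 1 (-1) (1 / 2) = ((-7 / 2 : ℝ) : ℂ) := by simp [endMap]; norm_num
    rw [this]; exact (ofReal_mem_pageStrip _).1.2 (by norm_num)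
  | 2 =>
    have : endMap 2 (-1) (1 / 2) = ((5 / 2 : ℝ) : ℂ) := by simp [endMap]; norm_num
    rw [this]; exact (ofReal_mem_pageStrip _).2.1.2 (by norm_num)

/-- The point of `endCircle i` at angle `0`. -/
abbrev rightPoint (i : Fin 3) : StripPoint (rightStrip i) := ⟨endCircle i 0, endCircle_zero_mem i⟩

/-- The point of `endCircle i` at angle `π`. -/
abbrev leftPoint (i : Fin 3) : StripPoint (leftStrip i) := ⟨endCircle i Real.pi, endCircle_pi_mem i⟩

section
variable {X : Type*} [TopologicalSpace X] (f : C(TwicePuncturedPlane, X))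

/-- The image under `f` of the class of the loop around the `i`-th end, based at angle `0`. -/
def endLoop (i : Fin 3) : FundamentalGroup X (f (endCircle i 0)) :=
  loopClass (periodicLoop (f.comp (endCircle i)) (fun θ => congrArg f (endCircle_periodic i θ)) 1)

/-- The loop around an end runs to the left point through the upper bent half plane and back through
the lower one. -/
theorem endLoop_eq (i : Fin 3) : endLoop f i =
    stripArrow f true (rightPoint i) (leftPoint i) ≫
      stripArrow f false (leftPoint i) (rightPoint i) := by
  let u₀ : Path (0 : ℝ) Real.pi :=
    { toFun := fun s => s * Real.pi
      continuous_toFun := by fun_prop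
      source' := by simp
      target' := by simp }
  let l₀ : Path Real.pi (2 * Real.pi) :=
    { toFun := fun s => s * Real.pi + Real.pi
      continuous_toFun := by fun_prop
      source' := by simp
      target' := by simp; ring }
  let u : Path (endCircle i 0) (endCircle i Real.pi) := u₀.map (endCircle i).continuous
  have e2 : endCircle i 0 = endCircle i (2 * Real.pi) := by
    simpa using ((endCircle_periodic i) 0).symm
  let l : Path (endCircle i Real.pi) (endCircle i 0) :=
    (l₀.map (endCircle i).continuous).cast rfl e2
  have hu : ∀ s, (u s).1 ∈ bentHalfPlane true := fun s => by
    refine mem_bentHalfPlane_true_of_im_nonneg ?_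
    obtain ⟨c, hc, h⟩ := endCircle_im i (s * Real.pi)
    change 0 ≤ (endCircle i (s * Real.pi)).1.im
    rw [h]
    refine mul_nonneg hc.le (Real.sin_nonneg_of_nonneg_of_le_pi ?_ ?_)
    · exact mul_nonneg s.2.1 Real.pi_pos.le
    · exact mul_le_of_le_one_left Real.pi_pos.le s.2.2
  have hl : ∀ s, (l s).1 ∈ bentHalfPlane false := fun s => by
    refine mem_bentHalfPlane_false_of_im_nonpos ?_
    obtain ⟨c, hc, h⟩ := endCircle_im i (s * Real.pi + Real.pi)
    change (endCircle i (s * Real.pi + Real.pi)).1.im ≤ 0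
    rw [h, Real.sin_add_pi]
    refine mul_nonpos_of_nonneg_of_nonpos hc.le (neg_nonpos.2 ?_)
    refine Real.sin_nonneg_of_nonneg_of_le_pi ?_ ?_
    · exact mul_nonneg s.2.1 Real.pi_pos.le
    · exact mul_le_of_le_one_left Real.pi_pos.le s.2.2
  have h1 : stripArrow f true (rightPoint i) (leftPoint i) = pathArrow (u.map f.continuous) :=
    (pathArrow_eq_halfArrow f _ _ u hu).symm
  have h2 : stripArrow f false (leftPoint i) (rightPoint i) = pathArrow (l.map f.continuous) :=
    (pathArrow_eq_halfArrow f _ _ l hl).symm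
  rw [h1, h2]
  refine Eq.trans ?_ (pathArrow_map_trans f u l)
  refine pathArrow_eq_of_lifts (f.comp (endCircle i))
    ⟨fun s : I => (s : ℝ) * (2 * Real.pi * ((1 : ℤ) : ℝ)), by fun_prop⟩ (u₀.trans l₀ : C(I, ℝ))
    (by simp) (by simp) (fun s => rfl) ?_
  intro s
  simp only [ContinuousMap.coe_coe, Path.trans_apply, Path.map_coe, Function.comp_apply]
  split_ifs <;> rfl

/-- Transport of fundamental groups along a path in the upper bent half plane, from the base point
`z` to the base point `zR` in the right component. -/
def stripConj {j : Fin 3} (zR : StripPoint 2) (z : StripPoint j) :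
    FundamentalGroup X (f z.1) ≃* FundamentalGroup X (f zR.1) :=
  (asIso (stripArrow f true zR z)).symm.conj

theorem stripConj_apply {j : Fin 3} (zR : StripPoint 2) (z : StripPoint j)
    (g : FundamentalGroup X (f z.1)) : stripConj f zR z g =
      stripArrow f true zR z ≫ g ≫ stripArrow f true z zR := by
  have e : inv (stripArrow f true zR z) = stripArrow f true z zR := inv_halfArrow f _ _
  rw [← e]
  rfl

theorem stripConj_endLoop (zR : StripPoint 2) (i : Fin 3) :
    stripConj f zR (rightPoint i) (endLoop f i) =
      stripArrow f true zR (leftPoint i) ≫ stripArrow f false (leftPoint i) (rightPoint i) ≫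
        stripArrow f true (rightPoint i) zR := by
  rw [stripConj_apply]
  have e := endLoop_eq f i
  calc stripArrow f true zR (rightPoint i) ≫ endLoop f i ≫ stripArrow f true (rightPoint i) zR
      = stripArrow f true zR (rightPoint i) ≫ (stripArrow f true (rightPoint i) (leftPoint i) ≫
      stripArrow f false (leftPoint i) (rightPoint i)) ≫ stripArrow f true (rightPoint i) zR := by
        exact congrArg (fun g : FundamentalGroupoid.mk (f (rightPoint i).1) ⟶ _ =>
          stripArrow f true zR (rightPoint i) ≫ g ≫ stripArrow f true (rightPoint i) zR) e
    _ = _ := by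
      rw [Category.assoc, stripArrow_trans_assoc]

variable (zR : StripPoint 2)

theorem stripConj_endLoop_zero (zL : StripPoint 0) : stripConj f zR (rightPoint 0) (endLoop f 0) =
    stripArrow f true zR zL ≫ stripArrow f false zL zR := by
  rw [stripConj_endLoop]
  have : stripArrow f true (rightPoint 0) zR = stripArrow f false (rightPoint 0) zR :=
    stripArrow_congr (j := 2) f true false (rightPoint 0) zR
  rw [this, stripArrow_trans]
  exact stripArrow_switch (j := 0) f true false zR (leftPoint 0) zL zR

theorem stripConj_endLoop_two (zM : StripPoint 1) : stripConj f zR (rightPoint 2) (endLoop f 2) =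
    stripArrow f true zR zM ≫ stripArrow f false zM zR := by
  rw [stripConj_endLoop]
  have : stripArrow f true (rightPoint 2) zR = stripArrow f false (rightPoint 2) zR :=
    stripArrow_congr (j := 2) f true false (rightPoint 2) zR
  rw [this, stripArrow_trans]
  exact stripArrow_switch (j := 1) f true false zR (leftPoint 2) zM zR

theorem stripConj_endLoop_one (zM : StripPoint 1) (zL : StripPoint 0) :
    stripConj f zR (rightPoint 1) (endLoop f 1) =
      stripArrow f true zR zL ≫ stripArrow f false zL zM ≫ stripArrow f true zM zR := by
  rw [stripConj_endLoop]
  have h1 := stripArrow_switch (j := 0) f true false zR (leftPoint 1) zL (rightPoint 1)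
  have h2 := stripArrow_switch (j := 1) f false true zL (rightPoint 1) zM zR
  rw [← Category.assoc]
  refine (congrArg (· ≫ stripArrow f true (rightPoint 1) zR) h1).trans ?_
  rw [Category.assoc]
  exact congrArg (stripArrow f true zR zL ≫ ·) h2

/-- The loop around infinity is the product of the loops around the two punctures. (In the product
of `FundamentalGroup`, the right factor comes first.) -/
theorem stripConj_endLoop_mul (zM : StripPoint 1) (zL : StripPoint 0) :
    stripConj f zR (rightPoint 0) (endLoop f 0) =
      stripConj f zR (rightPoint 2) (endLoop f 2) *
        stripConj f zR (rightPoint 1) (endLoop f 1) := by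
  rw [stripConj_endLoop_zero f zR zL, stripConj_endLoop_two f zR zM,
    stripConj_endLoop_one f zR zM zL, End.mul_def, Category.assoc, Category.assoc,
    stripArrow_trans_assoc]
  have : stripArrow f true zM zM = 𝟙 _ := halfArrow_self f _
  rw [this, Category.id_comp, stripArrow_trans]
end

/-! ### Products with the circle -/

instance : SimplyConnectedSpace (ℝ × ℝ) := SimplyConnectedSpace.ofContractible _

instance : PathConnectedSpace Circle :=
  Circle.exp_surjective.pathConnectedSpace Circle.exp.continuous

section Circle

variable {X Y : Type*} [TopologicalSpace X] [TopologicalSpace Y] (H : C(Y × Circle, X))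

/-- The restriction of `H` to the page over `1`, written as `Circle.exp 0` so that the loops below
have their base points on it by definition. -/
def pageMap : C(Y, X) := ⟨fun y => H (y, Circle.exp 0), by fun_prop⟩

/-- The image under `H` of the loop that runs `n` times around the circle factor over `y`. -/
def fiberLoop (y : Y) (n : ℤ) : Path (pageMap H y) (pageMap H y) where
  toFun s := H (y, Circle.exp (s * (2 * Real.pi * n)))
  continuous_toFun := by fun_prop
  source' := by simp [pageMap]
  target' := by
    have : Circle.exp (2 * Real.pi * n) = 1 := by
      rw [mul_comm]; exact Circle.exp_int_mul_two_pi n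
    simp [pageMap, this]

/-- The class of the image of the circle factor over `y`. -/
def fiberClass (y : Y) : FundamentalGroup X (pageMap H y) := loopClass (fiberLoop H y 1)

theorem loopClass_fiberLoop (y : Y) (n : ℤ) : loopClass (fiberLoop H y n) = fiberClass H y ^ n :=
  loopClass_periodicLoop ⟨fun r : ℝ => H (y, Circle.exp r), by fun_prop⟩
    (fun r => by simp [Circle.exp_add]) n

/-- The circle factor commutes with paths in the page. -/
theorem comp_fiberClass {y y' : Y} (γ : Path y y') :
    pathArrow (γ.map (pageMap H).continuous) ≫ fiberClass H y' =
      fiberClass H y ≫ pathArrow (γ.map (pageMap H).continuous) := by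
  let q₁ : ∀ b : ℝ, Path ((0 : ℝ), b) ((1 : ℝ), b) := fun b =>
    { toFun := fun s => ((s : ℝ), b)
      continuous_toFun := by fun_prop
      source' := by simp
      target' := by simp }
  let q₂ : ∀ a : ℝ, Path (a, (0 : ℝ)) (a, 2 * Real.pi * ((1 : ℤ) : ℝ)) := fun a =>
    { toFun := fun s => (a, (s : ℝ) * (2 * Real.pi * ((1 : ℤ) : ℝ)))
      continuous_toFun := by fun_prop
      source' := by simp
      target' := by simp }
  refine pathArrow_eq_of_lifts (γ := (γ.map (pageMap H).continuous).trans (fiberLoop H y' 1))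
    (γ' := (fiberLoop H y 1).trans (γ.map (pageMap H).continuous))
    (⟨fun p : ℝ × ℝ => H (γ.extend p.1, Circle.exp p.2), by fun_prop⟩ : C(ℝ × ℝ, X))
    ((q₁ 0).trans (q₂ 1) : C(I, ℝ × ℝ)) ((q₂ 0).trans (q₁ _) : C(I, ℝ × ℝ)) ?_ ?_ ?_ ?_
  · simp
  · simp
  · intro s
    simp only [ContinuousMap.coe_coe, Path.trans_apply]
    split_ifs
    · exact congrArg (fun z => H (z, Circle.exp 0)) (Path.extend_apply γ _)
    · simp [q₂, fiberLoop]
  · intro s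
    simp only [ContinuousMap.coe_coe, Path.trans_apply]
    split_ifs
    · simp [q₂, fiberLoop]
    · refine Eq.trans ?_ (congrArg (fun z => H (z, Circle.exp 0)) (Path.extend_apply γ _))
      simp [q₁]

/-- On the torus over a circle around the `i`-th end, the product of the `n`-th power of that circle
and of the circle factor is the class of the diagonal loop `γ`. -/
theorem endLoop_zpow_mul_fiberClass (H : C(TwicePuncturedPlane × Circle, X)) (i : Fin 3) (n : ℤ)
    (γ : Path (pageMap H (endCircle i 0)) (pageMap H (endCircle i 0)))
    (hγ : ∀ s : I, γ s = H (endCircle i (s * (2 * Real.pi * n)), Circle.exp (s * (2 * Real.pi)))) :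
    endLoop (pageMap H) i ^ n * fiberClass H (endCircle i 0) = loopClass γ := by
  have he := endCircle_periodic i
  refine Eq.trans (congrArg (· * fiberClass H (endCircle i 0))
    (loopClass_periodicLoop ((pageMap H).comp (endCircle i))
      (fun θ => congrArg (pageMap H) (he θ)) n).symm) ?_
  let q₁ : Path ((0 : ℝ), (0 : ℝ)) ((0 : ℝ), 2 * Real.pi) :=
    { toFun := fun s => (0, s * (2 * Real.pi))
      continuous_toFun := by fun_prop
      source' := by simp
      target' := by simp }
  let q₂ : Path ((0 : ℝ), 2 * Real.pi) (2 * Real.pi * n, 2 * Real.pi) :=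
    { toFun := fun s => (s * (2 * Real.pi * n), 2 * Real.pi)
      continuous_toFun := by fun_prop
      source' := by simp
      target' := by simp }
  refine pathArrow_eq_of_lifts (γ := (fiberLoop H (endCircle i 0) 1).trans
      (periodicLoop ((pageMap H).comp (endCircle i)) (fun θ => congrArg (pageMap H) (he θ)) n))
    (γ' := γ)
    (⟨fun p : ℝ × ℝ => H (endCircle i p.1, Circle.exp p.2), by fun_prop⟩ : C(ℝ × ℝ, X))
    (q₁.trans q₂ : C(I, ℝ × ℝ))
    ⟨fun s : I => ((s : ℝ) * (2 * Real.pi * n), (s : ℝ) * (2 * Real.pi)), by fun_prop⟩ ?_ ?_ ?_ ?_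
  · simp
  · simp
  · intro s
    simp only [ContinuousMap.coe_coe, Path.trans_apply]
    split_ifs
    · simp [q₁, fiberLoop]
    · simp only [q₂, periodicLoop, pageMap, Path.coe_mk', ContinuousMap.coe_mk, Circle.exp_two_pi,
        Circle.exp_zero]
      rfl
  · intro s
    simp [hγ]

theorem pathTrivial_of_pageMap [PathConnectedSpace Y] (hp : PathTrivial (pageMap H)) (y₀ : Y)
    (hτ : fiberClass H y₀ = 1) : PathTrivial H := by
  refine pathTrivial_of_loops H (y₀, Circle.exp 0) fun γ => ?_
  let γ₂ : C(I, Circle) := ⟨fun s => (γ s).2, by fun_prop⟩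
  have hγ0 : γ₂ 0 = Circle.exp 0 := by simp [γ₂]
  obtain ⟨Γ, hΓ, hΓ'⟩ := Circle.isCoveringMap_exp.exists_path_lifts γ₂ 0 hγ0
  have hΓs : ∀ s, Circle.exp (Γ s) = (γ s).2 := fun s => congrFun hΓ s
  obtain ⟨n, hn⟩ : ∃ n : ℤ, Γ 1 = n * (2 * Real.pi) := by
    rw [← Circle.exp_eq_one]
    rw [hΓs]; simp
  let γ₁ : Path y₀ y₀ :=
    { toFun := fun s => (γ s).1
      continuous_toFun := by fun_prop
      source' := by simp
      target' := by simp }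
  have hg : ∀ s : I, γ₁.extend (s : ℝ) = γ₁ s := fun s => Path.extend_apply γ₁ s.2
  let q₁ : Path ((0 : ℝ), (0 : ℝ)) (1, 0) :=
    { toFun := fun s => (s, 0)
      continuous_toFun := by fun_prop
      source' := by simp
      target' := by simp }
  let q₂ : Path ((1 : ℝ), (0 : ℝ)) (1, 2 * Real.pi * n) :=
    { toFun := fun s => (1, s * (2 * Real.pi * n))
      continuous_toFun := by fun_prop
      source' := by simp
      target' := by simp }
  let γ' : Path (pageMap H y₀) (pageMap H y₀) := γ.map H.continuous
  have key : pathArrow γ' =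
      pathArrow ((γ₁.map (pageMap H).continuous).trans (fiberLoop H y₀ n)) := by
    refine pathArrow_eq_of_lifts
      (⟨fun p : ℝ × ℝ => H (γ₁.extend p.1, Circle.exp p.2), by fun_prop⟩ : C(ℝ × ℝ, X))
      ⟨fun s : I => ((s : ℝ), Γ s), by fun_prop⟩ (q₁.trans q₂ : C(I, ℝ × ℝ)) ?_ ?_ ?_ ?_
    · simp [hΓ']
    · simp [hn]; ring
    · intro s
      simp [hg, hΓs, γ₁]
      rfl
    · intro s
      simp only [ContinuousMap.coe_coe, Path.trans_apply]
      split_ifs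
      · exact congrArg (fun z => H (z, Circle.exp 0)) (Path.extend_apply γ₁ _)
      · simp [q₂, fiberLoop]
  change pathArrow γ' = 𝟙 _
  rw [key, pathArrow_trans, hp γ₁ (Path.refl y₀)]
  have := loopClass_fiberLoop H y₀ n
  rw [hτ, one_zpow] at this
  exact (congrArg (pathArrow ((Path.refl y₀).map (pageMap H).continuous) ≫ ·) this).trans
    (Category.comp_id _)

end Circle

/-! ### Simple connectedness of fillings -/

theorem ofReal_ne_of_mem_pageStrip {j : Fin 3} {r : ℝ} (h : (r : ℂ) ∈ pageStrip j) :
    (r : ℂ) ≠ 3 ∧ (r : ℂ) ≠ -3 := ne_of_mem_bentHalfPlane (pageStrip_subset j h).1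

instance : PathConnectedSpace TwicePuncturedPlane := by
  have h : IsPathConnected ({3, -3}ᶜ : Set ℂ) :=
    (Set.toFinite _).countable.isPathConnected_compl_of_one_lt_rank (by
      rw [Complex.rank_real_complex]; norm_num)
  have e : ({3, -3}ᶜ : Set ℂ) = {z : ℂ | z ≠ 3 ∧ z ≠ -3} := by ext; simp
  rw [e] at h
  exact isPathConnected_iff_pathConnectedSpace.1 h

namespace FillingAtlas

variable {k : Fin 3 → ℤ} {M : Type u} [TopologicalSpace M]

/-- The circle of radius `1/2` in the unit disk, parametrized by the angle. -/
def halfCircle : C(ℝ, Metric.ball (0 : ℂ) 1) where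
  toFun r := ⟨((1 / 2 : ℝ) : ℂ) * Circle.exp r, by
    rw [mem_ball_zero_iff, norm_mul, Circle.norm_coe, Complex.norm_real]; norm_num⟩
  continuous_toFun := by fun_prop

theorem norm_halfCircle (r : ℝ) : ‖(halfCircle r : ℂ)‖ = 1 / 2 := by
  simp only [halfCircle, ContinuousMap.coe_mk]
  rw [norm_mul, Circle.norm_coe, Complex.norm_real]; norm_num

/-- The boundary of a meridian disk of the `i`-th solid torus in the product coordinates. -/
theorem eN_endCircle (A : FillingAtlas k M) (i : Fin 3) (r : ℝ) :
    A.eN (endCircle i (r * (2 * Real.pi * k i)), Circle.exp (r * (2 * Real.pi))) =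
      A.eV i (1, halfCircle (r * (2 * Real.pi))) := by
  have hW := A.W_eV i (1, halfCircle (r * (2 * Real.pi)))
  dsimp only at hW
  have hn := norm_halfCircle (r * (2 * Real.pi))
  have h0 : A.W (A.eV i (1, halfCircle (r * (2 * Real.pi)))) ≠ 0 := by
    rw [hW, ← norm_ne_zero_iff, hn]; norm_num
  have ht : A.W (A.eV i (1, halfCircle (r * (2 * Real.pi)))) /
      ‖A.W (A.eV i (1, halfCircle (r * (2 * Real.pi))))‖ = Circle.exp (r * (2 * Real.pi)) := by
    rw [hW, hn]
    simp only [halfCircle, ContinuousMap.coe_mk]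
    rw [mul_div_cancel_left₀]
    norm_num
  refine A.eN_eq _ _ h0 ?_ ht
  rw [A.y_eq i _ (A.eV_mem i _) h0, ht, A.p_eV, hW, hn]
  have e : (Circle.exp (r * (2 * Real.pi * k i)) : ℂ) = Circle.exp (r * (2 * Real.pi)) ^ k i := by
    rw [← Circle.coe_zpow, ← Circle.exp_zsmul, zsmul_eq_mul]
    congr 2; ring
  simp only [endCircle, ContinuousMap.coe_mk, e, Circle.coe_one, one_mul]

instance : SimplyConnectedSpace (Metric.ball (0 : ℂ) 1) :=
  have := (convex_ball (0 : ℂ) 1).contractibleSpace ⟨0, by simp⟩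
  SimplyConnectedSpace.ofContractible _

/-- The relation from a meridian disk of the `i`-th solid torus. -/
theorem endLoop_zpow_mul_fiberClass_eq_one (A : FillingAtlas k M) (i : Fin 3) :
    endLoop (pageMap A.eN) i ^ k i * fiberClass A.eN (endCircle i 0) = 1 := by
  let γ : Path (pageMap A.eN (endCircle i 0)) (pageMap A.eN (endCircle i 0)) :=
    { toFun := fun s => A.eN (endCircle i (s * (2 * Real.pi * k i)),
        Circle.exp (s * (2 * Real.pi)))
      continuous_toFun := by fun_prop
      source' := by simp [pageMap]
      target' := by
        have := (endCircle_periodic i).int_mul (k i) 0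
        rw [zero_add, mul_comm] at this
        simp [pageMap, this] }
  rw [endLoop_zpow_mul_fiberClass A.eN i (k i) γ (fun s => rfl)]
  refine pathArrow_eq_of_lifts (γ' := Path.refl _)
    (⟨fun w => A.eV i (1, w), by fun_prop⟩ : C(Metric.ball (0 : ℂ) 1, M))
    ⟨fun s : I => halfCircle (s * (2 * Real.pi)), by fun_prop⟩
    ⟨fun s : I => halfCircle 0, by fun_prop⟩ ?_ ?_ ?_ ?_
  · simp
  · simp [halfCircle]
  · intro s
    exact (A.eN_endCircle i s).symm
  · intro s
    have := A.eN_endCircle i 0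
    rw [zero_mul, zero_mul] at this
    exact this.symm

/-- If the filling relations force their generators to be trivial, every loop off the cores is
contractible in `M`. -/
theorem pathTrivial_eN (A : FillingAtlas k M)
    (hG : ∀ {G : Type u} [Group G] (x : Fin 3 → G) (τ : G), x 0 = x 2 * x 1 →
      (∀ i, x i ^ k i * τ = 1) → (∀ i, x i = 1) ∧ τ = 1) : PathTrivial A.eN := by
  let zR : StripPoint 2 := ⟨⟨((10 : ℝ) : ℂ), ofReal_ne_of_mem_pageStrip (j := 2) (by
    rw [(ofReal_mem_pageStrip 10).2.2]; norm_num)⟩, (ofReal_mem_pageStrip 10).2.2.2 (by norm_num)⟩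
  let zM : StripPoint 1 := ⟨⟨((0 : ℝ) : ℂ), ofReal_ne_of_mem_pageStrip (j := 1) (by
    rw [(ofReal_mem_pageStrip 0).2.1]; norm_num)⟩, (ofReal_mem_pageStrip 0).2.1.2 (by norm_num)⟩
  let zL : StripPoint 0 := ⟨⟨((-10 : ℝ) : ℂ), ofReal_ne_of_mem_pageStrip (j := 0) (by
    rw [(ofReal_mem_pageStrip (-10)).1]; norm_num)⟩, (ofReal_mem_pageStrip (-10)).1.2 (by norm_num)⟩
  set f := pageMap A.eN with hf
  let x : Fin 3 → FundamentalGroup M (f zR.1) := fun i =>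
    stripConj f zR (rightPoint i) (endLoop f i)
  have hT : ∀ i, stripConj f zR (rightPoint i) (fiberClass A.eN (endCircle i 0)) =
      fiberClass A.eN zR.1 := by
    intro i
    refine (stripConj_apply f zR (rightPoint i) (fiberClass A.eN (endCircle i 0))).trans ?_
    have h := comp_fiberClass A.eN (halfPath (zR.mem true) ((rightPoint i).mem true))
    have h2 : stripArrow f true zR (rightPoint i) ≫ stripArrow f true (rightPoint i) zR = 𝟙 _ :=
      (stripArrow_trans f true zR (rightPoint i) zR).trans (halfArrow_self f _)
    have h3 : stripArrow f true zR (rightPoint i) ≫ fiberClass A.eN (rightPoint i).1 =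
      fiberClass A.eN zR.1 ≫ stripArrow f true zR (rightPoint i) := h
    rw [← Category.assoc]
    refine (congrArg (· ≫ stripArrow f true (rightPoint i) zR) h3).trans ?_
    dsimp only
    rw [Category.assoc, h2]
    exact Category.comp_id _
  obtain ⟨hx, hτ⟩ := hG x (fiberClass A.eN zR.1) (stripConj_endLoop_mul f zR zM zL) (fun i => by
    have h := congrArg (stripConj f zR (rightPoint i)) (A.endLoop_zpow_mul_fiberClass_eq_one i)
    rw [map_one] at h
    let T : FundamentalGroup M (f (rightPoint i).1) := fiberClass A.eN (endCircle i 0)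
    let e : FundamentalGroup M (f (rightPoint i).1) := endLoop f i
    have h1 := (map_mul (stripConj f zR (rightPoint i)) (e ^ k i) T).symm.trans h
    rw [map_zpow] at h1
    rw [← hT i]
    exact h1)
  have key : ∀ {j : Fin 3} (z : StripPoint j),
      stripArrow f true zR z ≫ stripArrow f false z zR = 𝟙 _ →
      stripArrow f true zR z = stripArrow f false zR z := by
    intro j z h
    have h2 : stripArrow f false zR z ≫ stripArrow f false z zR = 𝟙 _ :=
      (stripArrow_trans f false zR z zR).trans (halfArrow_self f _)
    have : IsIso (stripArrow f false z zR) := inferInstance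
    exact (cancel_mono (stripArrow f false z zR)).1 (h.trans h2.symm)
  refine pathTrivial_of_pageMap A.eN (pathTrivial_page f zR zM zL (key zM ?_) (key zL ?_)) zR.1 hτ
  · exact (stripConj_endLoop_two f zR zM).symm.trans (hx 2)
  · exact (stripConj_endLoop_zero f zR zL).symm.trans (hx 0)

/-- If `f` is trivial on paths and has a section `g` that is continuous on `S`, then paths in `S`
with the same endpoints are homotopic. -/
theorem _root_.PathTrivial.pathArrow_eq {X Y : Type*} [TopologicalSpace X] [TopologicalSpace Y]
    {f : C(Y, X)} (hf : PathTrivial f) {S : Set X} {g : X → Y}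
    (hg : ∀ x ∈ S, ContinuousAt g x) (hfg : ∀ x ∈ S, f (g x) = x) {x y : X} (γ γ' : Path x y)
    (hγ : ∀ s, γ s ∈ S) (hγ' : ∀ s, γ' s ∈ S) : pathArrow γ = pathArrow γ' := by
  have hc : ∀ {γ : Path x y}, (∀ s, γ s ∈ S) → Continuous (g ∘ γ) := fun {γ} h =>
    continuous_iff_continuousAt.2 fun s => (hg _ (h s)).comp γ.continuous.continuousAt
  let Γ : Path (g x) (g y) := ⟨⟨g ∘ γ, hc hγ⟩, by simp, by simp⟩
  let Γ' : Path (g x) (g y) := ⟨⟨g ∘ γ', hc hγ'⟩, by simp, by simp⟩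
  have e0 : x = f (g x) := (hfg x (by simpa using hγ 0)).symm
  have e1 : y = f (g y) := (hfg y (by simpa using hγ 1)).symm
  have h := (Path.Homotopic.Quotient.eq.1 (hf Γ Γ')).pathCast e0 e1
  have e : (Γ.map f.continuous).cast e0 e1 = γ := by
    ext s; exact hfg _ (hγ s)
  have e' : (Γ'.map f.continuous).cast e0 e1 = γ' := by
    ext s; exact hfg _ (hγ' s)
  rw [e, e'] at h
  exact Path.Homotopic.Quotient.eq.2 h

theorem exists_eV_eq (A : FillingAtlas k M) (i : Fin 3) {m : M} (hm : m ∈ A.V i) :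
    ∃ q, A.eV i q = m :=
  ⟨(⟨A.p m, mem_sphere_zero_iff_norm.2 (A.norm_p i m hm)⟩,
    ⟨A.W m, mem_ball_zero_iff.2 (A.norm_W_lt i m hm)⟩), A.eV_eq i _ m hm rfl rfl⟩

/-- If the filling relations force their generators to be trivial, `M` is simply connected. The star
of the cover consists of the complement of the cores and the three solid tori; the core of a solid
torus is homotopic to a loop off the cores. -/
theorem simplyConnectedSpace_of_forall_eq_one (A : FillingAtlas k M)
    (hG : ∀ {G : Type u} [Group G] (x : Fin 3 → G) (τ : G), x 0 = x 2 * x 1 →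
      (∀ i, x i ^ k i * τ = 1) → (∀ i, x i = 1) ∧ τ = 1) : SimplyConnectedSpace M := by
  have hN := A.pathTrivial_eN hG
  have hN' : ∀ m, ∃ q, A.W m ≠ 0 → A.eN q = m := fun m => by
    by_cases h : A.W m = 0
    · exact ⟨(endCircle 0 0, 1), fun h' => absurd h h'⟩
    · exact ⟨(⟨A.y m, A.y_ne m h⟩, ⟨A.t m, mem_sphere_zero_iff_norm.2 (A.norm_t h)⟩),
        fun _ => A.eN_eq m _ h rfl rfl⟩
  choose gN hgN using hN'
  have hNt : ∀ ⦃x y : M⦄ (γ γ' : Path x y), (∀ s, γ s ∈ {m | A.W m ≠ 0}) →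
      (∀ s, γ' s ∈ {m | A.W m ≠ 0}) → pathArrow γ = pathArrow γ' := by
    intro x y γ γ'
    refine hN.pathArrow_eq (g := gN) (fun m hm => ?_) hgN γ γ'
    have h1 : ∀ᶠ m' in nhds m, A.W m' ≠ 0 := A.continuous_W.continuousAt.eventually_ne hm
    refine ContinuousAt.prodMk ?_ ?_
    · refine Topology.IsInducing.subtypeVal.continuousAt_iff.2 ?_
      refine (A.continuousAt_y m hm).congr ?_
      filter_upwards [h1] with m' h'
      have := A.y_eN (gN m')
      rwa [hgN m' h'] at this
    · refine Topology.IsInducing.subtypeVal.continuousAt_iff.2 ?_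
      refine (A.continuousAt_t hm).congr ?_
      filter_upwards [h1] with m' h'
      have := A.t_eN (gN m')
      rwa [hgN m' h'] at this
  let HV : Fin 3 → C(Metric.ball (0 : ℂ) 1 × Circle, M) := fun i =>
    ⟨fun q => A.eV i (q.2, q.1), by fun_prop⟩
  have hV : ∀ i, PathTrivial (HV i) := by
    intro i
    refine pathTrivial_of_pageMap (HV i) (fun y y' γ γ' => ?_) (halfCircle 0) ?_
    · exact pathArrow_eq_of_lifts (pageMap (HV i)) (γ : C(I, _)) (γ' : C(I, _)) (by simp) (by simp)
        (fun s => rfl) (fun s => rfl)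
    · refine hNt (fiberLoop (HV i) (halfCircle 0) 1) (Path.refl _) ?_ ?_
      all_goals
        intro s
        change A.W (A.eV i _) ≠ 0
        rw [A.W_eV, ← norm_ne_zero_iff]
        dsimp only
        rw [norm_halfCircle]
        norm_num
  have hV' : ∀ i m, ∃ q, m ∈ A.V i → HV i q = m := fun i m => by
    by_cases h : m ∈ A.V i
    · obtain ⟨q, hq⟩ := A.exists_eV_eq i h
      exact ⟨(q.2, q.1), fun _ => hq⟩
    · exact ⟨(halfCircle 0, 1), fun h' => absurd h' h⟩
  choose gV hgV using hV'
  have hVt : ∀ i ⦃x y : M⦄ (γ γ' : Path x y), (∀ s, γ s ∈ A.V i) → (∀ s, γ' s ∈ A.V i) →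
      pathArrow γ = pathArrow γ' := by
    intro i x y γ γ'
    refine (hV i).pathArrow_eq (g := gV i) (fun m hm => ?_) (hgV i) γ γ'
    have h1 : ∀ᶠ m' in nhds m, m' ∈ A.V i := (A.isOpen_V i).mem_nhds hm
    refine ContinuousAt.prodMk ?_ ?_
    · refine Topology.IsInducing.subtypeVal.continuousAt_iff.2 ?_
      refine A.continuous_W.continuousAt.congr ?_
      filter_upwards [h1] with m' h'
      have := A.W_eV i ((gV i m').2, (gV i m').1)
      rwa [show A.eV i ((gV i m').2, (gV i m').1) = m' from hgV i m' h'] at this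
    · refine Topology.IsInducing.subtypeVal.continuousAt_iff.2 ?_
      refine (A.continuousAt_p i m hm).congr ?_
      filter_upwards [h1] with m' h'
      have := A.p_eV i ((gV i m').2, (gV i m').1)
      rwa [show A.eV i ((gV i m').2, (gV i m').1) = m' from hgV i m' h'] at this
  have : Nonempty M := ⟨A.eN ((endCircle 0 0), 1)⟩
  have hNr : {m | A.W m ≠ 0} = Set.range A.eN := by
    ext m
    exact ⟨fun h => ⟨_, hgN m h⟩, by rintro ⟨q, rfl⟩; exact A.W_eN q⟩
  have hVr : ∀ i, A.V i = Set.range (HV i) := by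
    intro i; ext m
    exact ⟨fun h => ⟨_, hgV i m h⟩, by rintro ⟨q, rfl⟩; exact A.eV_mem i _⟩
  have hVp : ∀ i, IsPathConnected (A.V i) := fun i => by
    rw [hVr]; exact isPathConnected_range (HV i).continuous
  have hVNp : ∀ i, IsPathConnected (A.V i ∩ {m | A.W m ≠ 0}) := fun i => by
    let h : Set.Ioo (0 : ℝ) 1 × Circle × Circle → M := fun q => A.eV i (q.2.1,
      ⟨(q.1 : ℝ) * q.2.2, by
        rw [mem_ball_zero_iff, norm_mul, Circle.norm_coe, Complex.norm_real, Real.norm_eq_abs,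
          abs_of_pos q.1.2.1, mul_one]; exact q.1.2.2⟩)
    have hc : Continuous h := by fun_prop
    have : PathConnectedSpace (Set.Ioo (0 : ℝ) 1) := isPathConnected_iff_pathConnectedSpace.1
      ((convex_Ioo (0 : ℝ) 1).isPathConnected ⟨1 / 2, by norm_num, by norm_num⟩)
    convert isPathConnected_range hc
    ext m
    constructor
    · rintro ⟨hm, hW⟩
      refine ⟨(⟨‖A.W m‖, norm_pos_iff.2 hW, A.norm_W_lt i m hm⟩,
        ⟨A.p m, mem_sphere_zero_iff_norm.2 (A.norm_p i m hm)⟩,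
        ⟨A.t m, mem_sphere_zero_iff_norm.2 (A.norm_t hW)⟩), ?_⟩
      refine A.eV_eq i _ m hm rfl ?_
      change A.W m = ‖A.W m‖ * (A.W m / ‖A.W m‖)
      rw [mul_div_cancel₀]
      simpa using hW
    · rintro ⟨q, rfl⟩
      refine ⟨A.eV_mem i _, ?_⟩
      change A.W (A.eV i _) ≠ 0
      rw [A.W_eV]
      exact mul_ne_zero (by simpa using q.1.2.1.ne') (Circle.coe_ne_zero _)
  refine simplyConnectedSpace_of_star (N := {m | A.W m ≠ 0}) (V := A.V)
    (isOpen_ne_fun A.continuous_W continuous_const) A.isOpen_V (fun m => ?_) A.disjoint_V ?_ ?_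
    hNt hVt
  · by_cases h : A.W m = 0
    · exact Or.inr (A.cover m h)
    · exact Or.inl h
  · rw [hNr]; exact isPathConnected_range A.eN.continuous
  · intro i
    obtain ⟨b, hb⟩ := (hVNp i).nonempty
    exact ⟨b, hb, fun x hx => ⟨(hVp i).joinedIn b hb.1 x hx, fun hx' =>
      (hVNp i).joinedIn b hb x ⟨hx, hx'⟩⟩⟩

end FillingAtlas

end Groupoid

/-! ### Rotations of collars and the monodromy -/

/-- The map of the plane that rotates the circle of radius `ρ` about `p` by the angle `g ρ`. -/
def collarTwist (g : ℝ → ℝ) (p z : ℂ) : ℂ :=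
  p + (z - p) * Complex.exp ((g ‖z - p‖ : ℝ) * Complex.I)

theorem collarTwist_sub (g : ℝ → ℝ) (p z : ℂ) :
    collarTwist g p z - p = (z - p) * Complex.exp ((g ‖z - p‖ : ℝ) * Complex.I) :=
  add_sub_cancel_left _ _

theorem norm_collarTwist_sub (g : ℝ → ℝ) (p z : ℂ) : ‖collarTwist g p z - p‖ = ‖z - p‖ := by
  rw [collarTwist_sub, norm_mul, Complex.norm_exp_ofReal_mul_I, mul_one]

theorem collarTwist_collarTwist (g h : ℝ → ℝ) (p z : ℂ) :
    collarTwist g p (collarTwist h p z) = collarTwist (fun ρ => g ρ + h ρ) p z := by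
  rw [collarTwist, norm_collarTwist_sub, collarTwist_sub, collarTwist, mul_assoc,
    ← Complex.exp_add]
  push_cast
  ring_nf

theorem collarTwist_of_eq_zero {g : ℝ → ℝ} {p z : ℂ} (h : g ‖z - p‖ = 0) :
    collarTwist g p z = z := by
  simp [collarTwist, h]

theorem collarTwist_congr {g h : ℝ → ℝ} {p z : ℂ} (n : ℤ)
    (e : g ‖z - p‖ = h ‖z - p‖ + 2 * Real.pi * n) : collarTwist g p z = collarTwist h p z := by
  rw [collarTwist, collarTwist, e, Complex.ofReal_add, add_mul, Complex.exp_add]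
  have : Complex.exp (((2 * Real.pi * n : ℝ) : ℂ) * Complex.I) = 1 := by
    rw [Complex.exp_eq_one_iff]; exact ⟨n, by push_cast; ring⟩
  rw [this, mul_one]

namespace ThreeHoledSphere

theorem coe_zpow_eq_collarTwist {T : ThreeHoledSphere ≃ₜ ThreeHoledSphere} {g : ℝ → ℝ} {p : ℂ}
    (h : ∀ x, (T x).1 = collarTwist g p x.1) (n : ℤ) (x : ThreeHoledSphere) :
    ((T ^ n) x).1 = collarTwist (fun ρ => n * g ρ) p x.1 := by
  have hinv : ∀ x, (T⁻¹ x).1 = collarTwist (fun ρ => -g ρ) p x.1 := by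
    intro x
    have e : T (T⁻¹ x) = x := T.apply_symm_apply x
    have := h (T⁻¹ x)
    rw [e] at this
    rw [this, collarTwist_collarTwist, collarTwist_of_eq_zero (by simp)]
  induction n generalizing x with
  | zero => rw [collarTwist_of_eq_zero (by simp)]; rfl
  | succ n ih =>
    rw [zpow_add_one, Homeomorph.mul_apply, ih, h, collarTwist_collarTwist]
    congr 1; ext ρ; push_cast; ring
  | pred n ih =>
    rw [zpow_sub_one, Homeomorph.mul_apply, ih, hinv, collarTwist_collarTwist]
    congr 1; ext ρ; push_cast; ring

/-- The condition that cuts the three-holed sphere out of the plane. -/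
def PlaneMem (z : ℂ) : Prop := ‖z‖ ≤ 7 ∧ 1 ≤ ‖z - (-3)‖ ∧ 1 ≤ ‖z - 3‖

/-- The center of the `i`-th boundary circle. -/
def collarCenter : Fin 3 → ℂ := ![0, -3, 3]

/-- The angle `g` vanishes outside the collar of width `1` of the `i`-th boundary circle. -/
def CollarSupported (i : Fin 3) (g : ℝ → ℝ) : Prop :=
  if i = 0 then ∀ ρ ≤ 6, g ρ = 0 else ∀ ρ, 2 ≤ ρ → g ρ = 0

theorem planeMem_collarTwist {i : Fin 3} {g : ℝ → ℝ} (hg : CollarSupported i g) {z : ℂ}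
    (hz : PlaneMem z) : PlaneMem (collarTwist g (collarCenter i) z) := by
  have hn := norm_collarTwist_sub g (collarCenter i) z
  match i with
  | 0 =>
    change ‖collarTwist g 0 z - 0‖ = ‖z - 0‖ at hn
    change PlaneMem (collarTwist g 0 z)
    rcases le_total ‖z - 0‖ 6 with h | h
    · rwa [collarTwist_of_eq_zero (hg _ h)]
    · have h2 := norm_bounds_outer (hn ▸ h)
      rw [sub_zero, sub_zero] at hn
      exact ⟨hn ▸ hz.1, h2⟩
  | 1 =>
    change ‖collarTwist g (-3) z - (-3)‖ = ‖z - (-3)‖ at hn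
    change PlaneMem (collarTwist g (-3) z)
    rcases le_total 2 ‖z - (-3)‖ with h | h
    · rwa [collarTwist_of_eq_zero (hg _ h)]
    · have h2 := norm_bounds_left (hn ▸ h)
      exact ⟨h2.1, hn ▸ hz.2.1, h2.2⟩
  | 2 =>
    change ‖collarTwist g 3 z - 3‖ = ‖z - 3‖ at hn
    change PlaneMem (collarTwist g 3 z)
    rcases le_total 2 ‖z - 3‖ with h | h
    · rwa [collarTwist_of_eq_zero (hg _ h)]
    · have h2 := norm_bounds_right (hn ▸ h)
      exact ⟨h2.1, h2.2, hn ▸ hz.2.2⟩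

theorem CollarSupported.neg {i : Fin 3} {g : ℝ → ℝ} (hg : CollarSupported i g) :
    CollarSupported i (fun ρ => -g ρ) := by
  unfold CollarSupported at *
  split_ifs at * with h
  · exact fun ρ hρ => neg_eq_zero.2 (hg ρ hρ)
  · exact fun ρ hρ => neg_eq_zero.2 (hg ρ hρ)

/-- The bijection of the three-holed sphere that rotates its `i`-th collar by the angles `g`. -/
def collarEquiv {i : Fin 3} {g : ℝ → ℝ} (hg : CollarSupported i g) :
    ThreeHoledSphere ≃ ThreeHoledSphere where
  toFun x := ⟨collarTwist g (collarCenter i) x.1, planeMem_collarTwist hg x.2⟩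
  invFun x := ⟨collarTwist (fun ρ => -g ρ) (collarCenter i) x.1, planeMem_collarTwist hg.neg x.2⟩
  left_inv x := Subtype.ext (by
    dsimp only
    rw [collarTwist_collarTwist, collarTwist_of_eq_zero (by simp)])
  right_inv x := Subtype.ext (by
    dsimp only
    rw [collarTwist_collarTwist, collarTwist_of_eq_zero (by simp)])

/-- The angle of a rotation of the `i`-th collar by `2πkt` on the boundary circle, tapering off to
`0` at the other end of the collar. For `t = 1` this is a `k`-fold twist of the collar. The boundary
circle is the outer end of the collar for `i = 0` and the inner end for the others. -/
def collarAngle (i : Fin 3) (k : ℤ) (t ρ : ℝ) : ℝ :=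
  if i = 0 then k * t * (2 * Real.pi * max 0 (min 1 (ρ - 6)))
  else k * t * (2 * Real.pi * (1 - max 0 (min 1 (ρ - 1))))

theorem collarSupported_collarAngle (i : Fin 3) (k : ℤ) (t : ℝ) :
    CollarSupported i (collarAngle i k t) := by
  unfold CollarSupported collarAngle
  split_ifs
  · intro ρ hρ
    rw [max_eq_left ((min_le_right _ _).trans (by linarith))]; simp
  · intro ρ hρ
    rw [min_eq_left (by linarith)]; simp

theorem continuous_collarAngle (i : Fin 3) (k : ℤ) :
    Continuous fun q : ℝ × ℝ => collarAngle i k q.1 q.2 := by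
  unfold collarAngle
  split_ifs <;> fun_prop

theorem planeMem_endMap (i : Fin 3) (q : Circle) : PlaneMem (endMap i q 1) := by
  have hq := Circle.norm_coe q
  match i with
  | 0 =>
    have h : ‖endMap 0 q 1 - 0‖ = 7 := by simp [endMap]; exact hq
    have := norm_bounds_outer (z := endMap 0 q 1) (by rw [h]; norm_num)
    exact ⟨by simpa using h.le, this⟩
  | 1 =>
    have h : ‖endMap 1 q 1 - (-3)‖ = 1 := by simp [endMap]; exact hq
    have := norm_bounds_left (z := endMap 1 q 1) (by rw [h]; norm_num)
    exact ⟨this.1, h.ge, this.2⟩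
  | 2 =>
    have h : ‖endMap 2 q 1 - 3‖ = 1 := by simp [endMap]; exact hq
    have := norm_bounds_right (z := endMap 2 q 1) (by rw [h]; norm_num)
    exact ⟨this.1, this.2, h.ge⟩

/-- The circle `C i` lies off the collar of `C j` for `i ≠ j`. -/
theorem norm_endMap_sub (i j : Fin 3) (q : Circle) :
    (i = j → ‖endMap i q 1 - collarCenter j‖ = if j = 0 then 7 else 1) ∧
    (i ≠ j → if j = 0 then ‖endMap i q 1 - collarCenter j‖ ≤ 6
      else 2 ≤ ‖endMap i q 1 - collarCenter j‖) := by
  constructor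
  · rintro rfl
    fin_cases i <;> simp [endMap, collarCenter] <;> exact Circle.norm_coe q
  · intro h
    have h0 : (0 : ℝ) < 1 := one_pos
    have h1 : ‖(q : ℂ)‖ = 1 := Circle.norm_coe q
    fin_cases i <;> fin_cases j <;> simp [endMap, collarCenter] at h ⊢
    · have := norm_sub_le (7 * (q : ℂ) + 3) 3
      simp at this; linarith
    · have := norm_add_le (7 * (q : ℂ) - 3) 3
      simp at this; linarith
    · have := norm_add_le (-3 : ℂ) q
      simp at this; linarith
    · have := norm_sub_norm_le (-6 : ℂ) (-(q : ℂ))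
      have e : (-6 : ℂ) - -(q : ℂ) = -3 + q - 3 := by ring
      rw [e] at this
      simp at this; linarith
    · have := norm_add_le (3 : ℂ) q
      simp at this; linarith
    · have := norm_sub_norm_le (6 : ℂ) (-(q : ℂ))
      have e : (6 : ℂ) - -(q : ℂ) = 3 + q + 3 := by ring
      rw [e] at this
      simp at this; linarith

theorem mem_boundary_of_eq_endMap {i : Fin 3} {q : Circle} {x : ThreeHoledSphere}
    (hx : x.1 = endMap i q 1) : x ∈ boundary := by
  have := (norm_endMap_sub i i q).1 rfl
  change ‖x.1‖ = 7 ∨ ‖x.1 - (-3)‖ = 1 ∨ ‖x.1 - 3‖ = 1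
  rw [hx]
  match i with
  | 0 => left; simpa [collarCenter] using this
  | 1 => right; left; simpa [collarCenter] using this
  | 2 => right; right; simpa [collarCenter] using this

theorem collarTwist_endMap (j : Fin 3) (k : ℤ) (t : ℝ) (i : Fin 3) (q : Circle) :
    collarTwist (collarAngle j k t) (collarCenter j) (endMap i q 1) =
      endMap i (if i = j then q * Circle.exp (k * t * (2 * Real.pi)) else q : Circle) 1 := by
  split_ifs with h
  · subst h
    have e : collarAngle i k t ‖endMap i q 1 - collarCenter i‖ = k * t * (2 * Real.pi) := by
      rw [(norm_endMap_sub i i q).1 rfl, collarAngle]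
      split_ifs <;> norm_num
    rw [collarTwist, e, Circle.coe_mul, Circle.coe_exp]
    fin_cases i <;> simp [endMap, collarCenter] <;> ring
  · refine collarTwist_of_eq_zero ?_
    have := (norm_endMap_sub i j q).2 h
    have hs := collarSupported_collarAngle j k t
    unfold CollarSupported at hs
    split_ifs at this hs
    · exact hs _ this
    · exact hs _ this

end ThreeHoledSphere

open ThreeHoledSphere

/-- An isotopy of the three-holed sphere from the identity to `φ` that rotates the `i`-th boundary
circle by `2π k i t` at time `t`. It trivializes the mapping torus of `φ` as a product, by
`(x, t) ↦ (toFun t x, t)`, in which the circles `{p} × S¹` of the boundary wind `k i` times around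
the `i`-th boundary circle. -/
structure PageRotation (k : Fin 3 → ℤ) (φ : ThreeHoledSphere ≃ₜ ThreeHoledSphere) where
  toFun : I → ThreeHoledSphere ≃ ThreeHoledSphere
  continuous_toFun : Continuous fun q : I × ThreeHoledSphere => toFun q.1 q.2
  map_zero : ∀ x, toFun 0 x = x
  map_one : ∀ x, toFun 1 x = φ x
  map_boundary : ∀ t i (q : Circle) (x : ThreeHoledSphere), x.1 = endMap i q 1 →
    (toFun t x).1 = endMap i (q * Circle.exp (t * (2 * Real.pi)) ^ k i : Circle) 1

theorem continuous_collarEquiv (i : Fin 3) (k : ℤ) {Y : Type*} [TopologicalSpace Y] {t : Y → I}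
    {x : Y → ThreeHoledSphere} (ht : Continuous t) (hx : Continuous x) :
    Continuous fun y => collarEquiv (collarSupported_collarAngle i k (t y)) (x y) := by
  refine Continuous.subtype_mk ?_ _
  have hx' : Continuous fun y => (x y).1 := continuous_subtype_val.comp hx
  have : Continuous fun y => collarAngle i k (t y) ‖(x y).1 - collarCenter i‖ :=
    (continuous_collarAngle i k).comp (by fun_prop : Continuous fun y =>
      (((t y : I) : ℝ), ‖(x y).1 - collarCenter i‖))
  unfold collarTwist
  fun_prop

/-- The twists are undone by rotating their collars; the rotation of the collars is preceded by the
given isotopy, run backwards and composed with the inverse of its end. -/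
theorem PageRotation.nonempty_of_isotopicRel {a b c : ℤ} {φ : ThreeHoledSphere ≃ₜ ThreeHoledSphere}
    (hφ : IsotopicRel ThreeHoledSphere.boundary φ (T₁ ^ a * T₂ ^ b * T₃ ^ c)) :
    Nonempty (PageRotation ![-a, b, c] φ) := by
  obtain ⟨F, hF, hFB, hF0, hF1⟩ := hφ
  let k : Fin 3 → ℤ := ![-a, b, c]
  let C : Fin 3 → I → ThreeHoledSphere ≃ ThreeHoledSphere := fun i t =>
    collarEquiv (collarSupported_collarAngle i (k i) t)
  let ψ := T₁ ^ a * T₂ ^ b * T₃ ^ c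
  have hT1 : ∀ x, (T₁ ^ a) x = C 0 1 x := fun x => Subtype.ext <| by
    rw [coe_zpow_eq_collarTwist (T := T₁) (p := 0)
      (g := fun ρ => -1 * (2 * Real.pi * max 0 (min 1 (ρ - 6)))) (fun x => rfl)]
    refine collarTwist_congr 0 ?_
    simp [collarAngle, k]
  have hT2 : ∀ x, (T₂ ^ b) x = C 1 1 x := fun x => Subtype.ext <| by
    rw [coe_zpow_eq_collarTwist (T := T₂) (p := -3)
      (g := fun ρ => -1 * (2 * Real.pi * max 0 (min 1 (ρ - 1)))) (fun x => rfl)]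
    -- The two angles differ by the full turns `-2πb`.
    refine collarTwist_congr (-b) ?_
    simp [collarAngle, k]; ring
  have hT3 : ∀ x, (T₃ ^ c) x = C 2 1 x := fun x => Subtype.ext <| by
    rw [coe_zpow_eq_collarTwist (T := T₃) (p := 3)
      (g := fun ρ => -1 * (2 * Real.pi * max 0 (min 1 (ρ - 1)))) (fun x => rfl)]
    refine collarTwist_congr (-c) ?_
    simp [collarAngle, k]; ring
  have hC0 : ∀ i x, C i 0 x = x := fun i x => Subtype.ext <|
    collarTwist_of_eq_zero (by simp [collarAngle])
  have hψC : ∀ x, C 0 1 (C 1 1 (C 2 1 x)) = ψ x := fun x => by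
    rw [← hT1, ← hT2, ← hT3]; rfl
  refine ⟨{
    toFun := fun t => (((F (σ t)).toEquiv.trans ψ.toEquiv.symm).trans (C 2 t)).trans
      ((C 1 t).trans (C 0 t))
    continuous_toFun := ?_
    map_zero := fun x => ?_
    map_one := fun x => ?_
    map_boundary := fun t i q x hx => ?_ }⟩
  · have h1 : Continuous fun q : I × ThreeHoledSphere => F (σ q.1) q.2 :=
      hF.comp (by fun_prop : Continuous fun q : I × ThreeHoledSphere => (σ q.1, q.2))
    have h2 : Continuous fun q : I × ThreeHoledSphere => ψ.symm (F (σ q.1) q.2) :=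
      ψ.symm.continuous.comp h1
    exact continuous_collarEquiv 0 (k 0) continuous_fst (continuous_collarEquiv 1 (k 1)
      continuous_fst (continuous_collarEquiv 2 (k 2) continuous_fst h2))
  · change C 0 0 (C 1 0 (C 2 0 (ψ.symm (F (σ 0) x)))) = x
    rw [hC0, hC0, hC0, unitInterval.symm_zero, hF1]
    exact ψ.symm_apply_apply x
  · change C 0 1 (C 1 1 (C 2 1 (ψ.symm (F (σ 1) x)))) = φ x
    rw [hψC, unitInterval.symm_one, hF0, ψ.apply_symm_apply]
  · have hxB := mem_boundary_of_eq_endMap hx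
    have hψ : ψ.symm x = x := by
      rw [Homeomorph.symm_apply_eq]
      have := hFB 1 x hxB
      rw [hF1] at this
      exact this.symm
    change (C 0 t (C 1 t (C 2 t (ψ.symm (F (σ t) x))))).1 = _
    rw [hFB _ x hxB, hψ]
    change collarTwist (collarAngle 0 (k 0) t) (collarCenter 0)
      (collarTwist (collarAngle 1 (k 1) t) (collarCenter 1)
      (collarTwist (collarAngle 2 (k 2) t) (collarCenter 2) x.1)) = endMap i _ 1
    have he : ∀ n : ℤ, Circle.exp (n * t * (2 * Real.pi)) = Circle.exp (t * (2 * Real.pi)) ^ n :=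
      fun n => by rw [← Circle.exp_zsmul, zsmul_eq_mul, mul_assoc]
    rw [hx, collarTwist_endMap, collarTwist_endMap, collarTwist_endMap, he, he, he]
    generalize Circle.exp (t * (2 * Real.pi)) = u
    fin_cases i <;> simp [k]

/-! ### Functions on open books -/

namespace OpenBookManifold

variable {S : Type*} [TopologicalSpace S] {B : Set S} {φ : S ≃ₜ S} {Y : Type*}

variable (B φ) in
/-- The image of `(x, t)` in the open book. -/
def ofPage (q : S × I) : OpenBookManifold B φ := Quot.mk _ (Sum.inl (MappingTorus.mk φ q))

variable (φ) in
/-- The image of a point of the solid tori in the open book. -/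
def ofTorus (q : B × Metric.closedBall (0 : ℂ) 1) : OpenBookManifold B φ := Quot.mk _ (Sum.inr q)

theorem continuous_ofPage : Continuous (ofPage B φ) :=
  continuous_quot_mk.comp (continuous_inl.comp continuous_quot_mk)

theorem continuous_ofTorus : Continuous (ofTorus (B := B) φ) :=
  continuous_quot_mk.comp continuous_inr

theorem ofPage_one (x : S) : ofPage B φ (x, 1) = ofPage B φ (φ x, 0) :=
  congrArg (fun z => (Quot.mk _ (Sum.inl z) : OpenBookManifold B φ))
    (Quot.sound (MappingTorusRel.glue x))

theorem ofPage_eq_ofTorus (p : B) (t : I) (w : Metric.closedBall (0 : ℂ) 1)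
    (hw : (w : ℂ) = Circle.exp (t * (2 * Real.pi))) : ofPage B φ (p, t) = ofTorus φ (p, w) := by
  refine Quot.sound (OpenBookRel.glue p t w ?_)
  rw [hw, Circle.coe_exp]
  push_cast
  ring_nf

theorem exists_rep (m : OpenBookManifold B φ) :
    (∃ q, ofPage B φ q = m) ∨ ∃ q, ofTorus φ q = m := by
  obtain ⟨q | q, rfl⟩ := Quot.exists_rep m
  · obtain ⟨q, rfl⟩ := Quot.exists_rep q
    exact Or.inl ⟨q, rfl⟩
  · exact Or.inr ⟨q, rfl⟩

theorem isOpen_iff {A : Set (OpenBookManifold B φ)} :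
    IsOpen A ↔ IsOpen (ofPage B φ ⁻¹' A) ∧ IsOpen (ofTorus φ ⁻¹' A) := by
  refine Iff.trans isOpen_coinduced (isOpen_sum_iff.trans (and_congr ?_ Iff.rfl))
  exact isOpen_coinduced

/-- The function on the open book given by functions on `S × [0,1]` and on the solid tori that agree
under the gluing. -/
def lift (f : S × I → Y) (g : B × Metric.closedBall (0 : ℂ) 1 → Y)
    (hf : ∀ x, f (x, 1) = f (φ x, 0))
    (hfg : ∀ (p : B) (t : I) (w : Metric.closedBall (0 : ℂ) 1),
      (w : ℂ) = Circle.exp (t * (2 * Real.pi)) → f (p, t) = g (p, w)) :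
    OpenBookManifold B φ → Y :=
  Quot.lift (Sum.elim (Quot.lift f (by rintro _ _ ⟨x⟩; exact hf x)) g) (by
    rintro _ _ ⟨p, t, w, hw⟩
    refine hfg p t w ?_
    rw [hw, Circle.coe_exp]
    push_cast
    ring_nf)

theorem continuousAt_of_continuousOn [TopologicalSpace Y] {f : OpenBookManifold B φ → Y}
    {A : Set (OpenBookManifold B φ)} (hA : IsOpen A)
    (h₁ : ContinuousOn (f ∘ ofPage B φ) (ofPage B φ ⁻¹' A))
    (h₂ : ContinuousOn (f ∘ ofTorus φ) (ofTorus φ ⁻¹' A)) {m : OpenBookManifold B φ}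
    (hm : m ∈ A) : ContinuousAt f m := by
  have hA' := isOpen_iff.1 hA
  refine (continuousOn_iff'.2 fun t ht => ⟨A ∩ f ⁻¹' t, isOpen_iff.2 ⟨?_, ?_⟩, ?_⟩).continuousAt
    (hA.mem_nhds hm)
  · exact h₁.isOpen_inter_preimage hA'.1 ht
  · exact h₂.isOpen_inter_preimage hA'.2 ht
  · ext; simp; tauto

end OpenBookManifold

/-! ### Boundary circles and collars of the three-holed sphere -/

namespace ThreeHoledSphere

theorem endMap_injective {i j : Fin 3} {q q' : Circle} {ρ ρ' : ℝ} (h0 : 0 < ρ) (h1 : ρ ≤ 1)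
    (h0' : 0 < ρ') (h1' : ρ' ≤ 1) (h : endMap i q ρ = endMap j q' ρ') :
    i = j ∧ q = q' ∧ ρ = ρ' := by
  have hq := Circle.norm_coe q
  have hq' := Circle.norm_coe q'
  have key : ∀ z z' : ℂ, ‖z‖ = 1 → ‖z'‖ = 1 → ρ * z = ρ' * z' → z = z' ∧ ρ = ρ' := by
    intro z z' hz hz' e
    have e' : ρ = ρ' := by
      have := congrArg norm e
      rwa [norm_mul, norm_mul, hz, hz', Complex.norm_real, Complex.norm_real, mul_one, mul_one,
        Real.norm_of_nonneg h0.le, Real.norm_of_nonneg h0'.le] at this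
    subst e'
    exact ⟨mul_left_cancel₀ (by simpa using h0.ne') e, rfl⟩
  have n1 : ∀ (ρ : ℝ) (z : ℂ), 0 < ρ → ρ ≤ 1 → ‖z‖ = 1 → ‖(ρ : ℂ) * z‖ ≤ 1 := by
    intro ρ z h0 h1 hz
    rwa [norm_mul, hz, mul_one, Complex.norm_real, Real.norm_of_nonneg h0.le]
  have n7 : ∀ (ρ : ℝ) (z : ℂ), 0 < ρ → ρ ≤ 1 → ‖z‖ = 1 → 7 ≤ ‖7 * z / (ρ : ℂ)‖ := by
    intro ρ z h0 h1 hz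
    rw [norm_div, norm_mul, hz, Complex.norm_real, Real.norm_of_nonneg h0.le, le_div_iff₀ h0]
    norm_num; linarith
  have a1 := n1 ρ q h0 h1 hq
  have a2 := n1 ρ' q' h0' h1' hq'
  have a3 := n7 ρ q h0 h1 hq
  have a4 := n7 ρ' q' h0' h1' hq'
  have t : ∀ z : ℂ, ‖z‖ ≤ 1 → ‖-3 + z‖ ≤ 4 ∧ ‖3 + z‖ ≤ 4 := by
    intro z hz
    have h1 := norm_add_le (-3 : ℂ) z
    have h2 := norm_add_le (3 : ℂ) z
    simp at h1 h2
    constructor <;> linarith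
  have t1 := t _ a1
  have t2 := t _ a2
  have six : ∀ z z' : ℂ, ‖z‖ ≤ 1 → ‖z'‖ ≤ 1 → -3 + z ≠ 3 + z' := by
    intro z z' hz hz' e
    have e' : z - z' = 6 := by linear_combination e
    have := norm_sub_le z z'
    rw [e'] at this
    norm_num at this; linarith
  fin_cases i <;> fin_cases j <;> simp only [endMap] at h
  · have e : (ρ' : ℂ) * q = ρ * q' := by
      have r0 : (ρ : ℂ) ≠ 0 := by simpa using h0.ne'
      have r1 : (ρ' : ℂ) ≠ 0 := by simpa using h0'.ne'
      field_simp at h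
      linear_combination h
    have e' : ρ' = ρ := by
      have := congrArg norm e
      rwa [norm_mul, norm_mul, hq, hq', Complex.norm_real, Complex.norm_real, mul_one, mul_one,
        Real.norm_of_nonneg h0.le, Real.norm_of_nonneg h0'.le] at this
    subst e'
    exact ⟨rfl, Circle.ext (mul_left_cancel₀ (by simpa using h0.ne') e), rfl⟩
  · rw [h] at a3; linarith
  · rw [h] at a3; linarith
  · rw [← h] at a4; linarith
  · obtain ⟨e1, e2⟩ := key q q' hq hq' (by linear_combination h)
    exact ⟨rfl, Circle.ext e1, e2⟩
  · exact absurd h (six _ _ a1 a2)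
  · rw [← h] at a4; linarith
  · exact absurd h.symm (six _ _ a2 a1)
  · obtain ⟨e1, e2⟩ := key q q' hq hq' (by linear_combination h)
    exact ⟨rfl, Circle.ext e1, e2⟩

theorem one_le_of_planeMem_endMap {i : Fin 3} {q : ℂ} (hq : ‖q‖ = 1) {ρ : ℝ} (h0 : 0 < ρ)
    (h : PlaneMem (endMap i q ρ)) : 1 ≤ ρ := by
  obtain ⟨h1, h2, h3⟩ := h
  match i with
  | 0 =>
    simp only [endMap] at h1
    rw [norm_div, norm_mul, hq, Complex.norm_real, Real.norm_of_nonneg h0.le, div_le_iff₀ h0] at h1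
    norm_num at h1; linarith
  | 1 =>
    simp only [endMap] at h2
    rwa [show -3 + (ρ : ℂ) * q - -3 = ρ * q by ring, norm_mul, hq, mul_one, Complex.norm_real,
      Real.norm_of_nonneg h0.le] at h2
  | 2 =>
    simp only [endMap] at h3
    rwa [show 3 + (ρ : ℂ) * q - 3 = ρ * q by ring, norm_mul, hq, mul_one, Complex.norm_real,
      Real.norm_of_nonneg h0.le] at h3

theorem exists_eq_endMap {z : ThreeHoledSphere} (hz : z ∈ boundary) :
    ∃ (i : Fin 3) (q : Circle), endMap i q 1 = z.1 := by
  rcases hz with h | h | h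
  · refine ⟨0, ⟨z.1 / 7, mem_sphere_zero_iff_norm.2 ?_⟩, ?_⟩
    · rw [norm_div, h]; norm_num
    · change 7 * (z.1 / 7) / ((1 : ℝ) : ℂ) = z.1
      push_cast; ring
  · refine ⟨1, ⟨z.1 - (-3), mem_sphere_zero_iff_norm.2 h⟩, ?_⟩
    change -3 + ((1 : ℝ) : ℂ) * (z.1 - (-3)) = z.1
    push_cast; ring
  · refine ⟨2, ⟨z.1 - 3, mem_sphere_zero_iff_norm.2 h⟩, ?_⟩
    change 3 + ((1 : ℝ) : ℂ) * (z.1 - 3) = z.1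
    push_cast; ring

theorem coe_ne (x : ThreeHoledSphere) : x.1 ≠ 3 ∧ x.1 ≠ -3 := by
  obtain ⟨x, h1, h2, h3⟩ := x
  constructor
  · rintro rfl; norm_num at h3
  · rintro rfl; norm_num at h2

instance : T2Space ThreeHoledSphere :=
  inferInstanceAs (T2Space {z : ℂ // ‖z‖ ≤ 7 ∧ 1 ≤ ‖z - (-3)‖ ∧ 1 ≤ ‖z - 3‖})

theorem isClosed_planeMem : IsClosed {z : ℂ | PlaneMem z} := by
  have h1 : IsClosed {z : ℂ | ‖z‖ ≤ 7} := isClosed_le (by fun_prop) (by fun_prop)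
  have h2 : IsClosed {z : ℂ | 1 ≤ ‖z - (-3)‖} := isClosed_le (by fun_prop) (by fun_prop)
  have h3 : IsClosed {z : ℂ | 1 ≤ ‖z - 3‖} := isClosed_le (by fun_prop) (by fun_prop)
  exact h1.inter (h2.inter h3)

instance : CompactSpace ThreeHoledSphere := by
  have h : IsCompact {z : ℂ | PlaneMem z} :=
    Metric.isCompact_of_isClosed_isBounded isClosed_planeMem
      ((Metric.isBounded_closedBall (x := (0 : ℂ)) (r := 7)).subset
        fun z (hz : PlaneMem z) => mem_closedBall_zero_iff.2 hz.1)
  exact isCompact_iff_compactSpace.1 h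

/-- The boundary of the three-holed sphere is three circles. -/
def boundaryHomeomorph : Fin 3 × Circle ≃ₜ (boundary : Set ThreeHoledSphere) :=
  Continuous.homeoOfEquivCompactToT2 (f := Equiv.ofBijective
    (fun q : Fin 3 × Circle => (⟨⟨endMap q.1 q.2 1, planeMem_endMap _ _⟩,
      mem_boundary_of_eq_endMap rfl⟩ : (boundary : Set ThreeHoledSphere)))
    ⟨fun q q' h => by
      have h' : endMap q.1 q.2 1 = endMap q'.1 q'.2 1 := congrArg (fun z => z.1.1) h
      obtain ⟨h1, h2, -⟩ := endMap_injective one_pos le_rfl one_pos le_rfl h'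
      exact Prod.ext h1 h2,
    fun z => by
      obtain ⟨i, q, h⟩ := exists_eq_endMap z.2
      exact ⟨(i, q), Subtype.ext (Subtype.ext h)⟩⟩) (by
    refine continuous_prod_of_discrete_left.2 fun i => Continuous.subtype_mk
      (Continuous.subtype_mk ?_ _) _
    match i with
    | 0 => simp only [endMap]; fun_prop
    | 1 => simp only [endMap]; fun_prop
    | 2 => simp only [endMap]; fun_prop)

theorem coe_boundaryHomeomorph (q : Fin 3 × Circle) :
    (boundaryHomeomorph q).1.1 = endMap q.1 q.2 1 := rfl

/-- The collar, in the twice punctured plane, that is attached to the `i`-th boundary circle of the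
three-holed sphere. -/
def endRegion : Fin 3 → Set TwicePuncturedPlane
  | 0 => {z | 7 ≤ ‖z.1‖}
  | 1 => {z | ‖z.1 - (-3)‖ ≤ 1}
  | 2 => {z | ‖z.1 - 3‖ ≤ 1}

theorem isClosed_endRegion (i : Fin 3) : IsClosed (endRegion i) := by
  match i with
  | 0 => exact isClosed_le (by fun_prop) (by fun_prop)
  | 1 => exact isClosed_le (by fun_prop) (by fun_prop)
  | 2 => exact isClosed_le (by fun_prop) (by fun_prop)

theorem planeMem_or_mem_endRegion (z : TwicePuncturedPlane) :
    PlaneMem z.1 ∨ ∃ i, z ∈ endRegion i := by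
  by_contra! h
  have h0 : ¬ 7 ≤ ‖z.1‖ := h.2 0
  have h1 : ¬ ‖z.1 - (-3)‖ ≤ 1 := h.2 1
  have h2 : ¬ ‖z.1 - 3‖ ≤ 1 := h.2 2
  exact h.1 ⟨by linarith, by linarith, by linarith⟩

/-- The collars have continuous polar coordinates inverse to `endMap`. -/
theorem exists_endCoordinates (i : Fin 3) : ∃ (d : C(endRegion i, Circle)) (n : C(endRegion i, ℝ)),
    ∀ z, 0 < n z ∧ n z ≤ 1 ∧ endMap i (d z) (n z) = z.1.1 := by
  have hc : ∀ {U : Set TwicePuncturedPlane} (f : U → ℂ), Continuous f → (∀ z, f z ≠ 0) →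
      ∃ d : C(U, Circle), ∀ z, (‖f z‖ : ℂ) * d z = f z := by
    intro U f hf h
    refine ⟨⟨fun z => ⟨f z / ‖f z‖, mem_sphere_zero_iff_norm.2 (by
        rw [norm_div, Complex.norm_real, norm_norm, div_self (norm_ne_zero_iff.2 (h z))])⟩, ?_⟩,
      fun z => mul_div_cancel₀ _ (by simpa using h z)⟩
    exact Continuous.subtype_mk (hf.div (by fun_prop) (fun z => by simpa using h z)) _
  match i with
  | 0 =>
    have h : ∀ z : endRegion 0, z.1.1 ≠ 0 := by
      rintro ⟨z, hz⟩ h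
      change 7 ≤ ‖z.1‖ at hz
      dsimp only at h
      rw [h] at hz; norm_num at hz
    obtain ⟨d, hd⟩ := hc _ (by fun_prop) h
    refine ⟨d, ⟨fun z => 7 / ‖z.1.1‖, ?_⟩, fun z => ⟨?_, ?_, ?_⟩⟩
    · exact continuous_const.div (by fun_prop) (fun z => norm_ne_zero_iff.2 (h z))
    · have := norm_pos_iff.2 (h z)
      simp only [ContinuousMap.coe_mk]; positivity
    · exact (div_le_one (norm_pos_iff.2 (h z))).2 z.2
    · have : (‖z.1.1‖ : ℂ) ≠ 0 := by simpa using h z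
      simp only [endMap, ContinuousMap.coe_mk]
      push_cast; field_simp
      linear_combination hd z
  | 1 =>
    have h : ∀ z : endRegion 1, z.1.1 - (-3) ≠ 0 := fun z h => z.1.2.2 (sub_eq_zero.1 h)
    obtain ⟨d, hd⟩ := hc _ (by fun_prop) h
    refine ⟨d, ⟨fun z => ‖z.1.1 - (-3)‖, by fun_prop⟩, fun z => ⟨norm_pos_iff.2 (h z), z.2, ?_⟩⟩
    simp only [endMap, ContinuousMap.coe_mk]
    linear_combination hd z
  | 2 =>
    have h : ∀ z : endRegion 2, z.1.1 - 3 ≠ 0 := fun z h => z.1.2.1 (sub_eq_zero.1 h)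
    obtain ⟨d, hd⟩ := hc _ (by fun_prop) h
    refine ⟨d, ⟨fun z => ‖z.1.1 - 3‖, by fun_prop⟩, fun z => ⟨norm_pos_iff.2 (h z), z.2, ?_⟩⟩
    simp only [endMap, ContinuousMap.coe_mk]
    linear_combination hd z

end ThreeHoledSphere

/-! ### The open book as a filling of the product -/

namespace ThreeHoledSphere

open OpenBookManifold

variable {k : Fin 3 → ℤ} {φ : ThreeHoledSphere ≃ₜ ThreeHoledSphere}

/-- The three solid tori that are glued to the mapping torus. -/
abbrev SolidTori : Type := ↥boundary × Metric.closedBall (0 : ℂ) 1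

variable (φ) in
/-- The coordinate of the disk factor on the solid tori, continued by `exp (2πit)` to the mapping
torus. -/
def diskCoordinate : OpenBookManifold boundary φ → ℂ :=
  lift (fun q => (Circle.exp (q.2 * (2 * Real.pi)) : ℂ)) (fun q => q.2.1) (fun _ => by simp)
    (fun _ _ _ hw => hw.symm)

/-- The page coordinate: the trivialization of the mapping torus by the rotation, continued to the
solid tori minus their cores by the collars of the page. The value on the cores is junk. -/
def pageCoordinate (R : PageRotation k φ) : OpenBookManifold boundary φ → ℂ :=
  lift (fun q => (R.toFun q.2 q.1).1)
    (fun q => endMap (boundaryHomeomorph.symm q.1).1 ((boundaryHomeomorph.symm q.1).2 *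
      (q.2.1 / ‖q.2.1‖) ^ k (boundaryHomeomorph.symm q.1).1) ‖q.2.1‖)
    (fun x => by rw [R.map_one, R.map_zero])
    (fun p t w hw => by
      have h := R.map_boundary t (boundaryHomeomorph.symm p).1 (boundaryHomeomorph.symm p).2 p.1 (by
        rw [← coe_boundaryHomeomorph, boundaryHomeomorph.apply_symm_apply])
      have h1 : ‖(Circle.exp (t * (2 * Real.pi)) : ℂ)‖ = 1 := Circle.norm_coe _
      dsimp only
      rw [hw, h, h1, Complex.ofReal_one, div_one, Circle.coe_mul, Circle.coe_zpow])

variable (φ) in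
/-- The coordinate along the core on the open solid tori, with junk value `0` elsewhere. -/
def bindingCoordinate : OpenBookManifold boundary φ → ℂ :=
  lift (fun _ => 0) (fun q => if ‖q.2.1‖ < 1 then ((boundaryHomeomorph.symm q.1).2 : ℂ) else 0)
    (fun _ => rfl) (fun p t w hw => by
      have h1 : ‖(Circle.exp (t * (2 * Real.pi)) : ℂ)‖ = 1 := Circle.norm_coe _
      simp only [hw, h1, lt_irrefl, if_false])

variable (φ) in
/-- The `i`-th open solid torus. -/
def bindingNeighborhood (i : Fin 3) : Set (OpenBookManifold boundary φ) :=
  {m | lift (fun _ => False) (fun q => (boundaryHomeomorph.symm q.1).1 = i ∧ ‖q.2.1‖ < 1)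
    (fun _ => rfl) (fun p t w hw => by
      have h1 : ‖(Circle.exp (t * (2 * Real.pi)) : ℂ)‖ = 1 := Circle.norm_coe _
      simp only [hw, h1, lt_irrefl, and_false]) m}

theorem isOpen_bindingNeighborhood (i : Fin 3) : IsOpen (bindingNeighborhood φ i) := by
  refine isOpen_iff.2 ⟨isOpen_empty, ?_⟩
  have h : Continuous fun q : SolidTori =>
    (boundaryHomeomorph.symm q.1).1 := by fun_prop
  exact ((isOpen_discrete {i}).preimage h).inter
    (isOpen_lt (f := fun q : SolidTori =>
      ‖q.2.1‖) (by fun_prop) continuous_const)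

theorem continuous_diskCoordinate : Continuous (diskCoordinate φ) := by
  refine continuous_iff_continuousAt.2 fun m => continuousAt_of_continuousOn isOpen_univ
    (Continuous.continuousOn ?_) (Continuous.continuousOn ?_) (Set.mem_univ m)
  · change Continuous fun q : ThreeHoledSphere × I => (Circle.exp (q.2 * (2 * Real.pi)) : ℂ)
    fun_prop
  · exact continuous_subtype_val.comp continuous_snd

theorem continuousAt_endMap {Y : Type*} [TopologicalSpace Y] (i : Fin 3) {q : Y → ℂ} {ρ : Y → ℝ}
    {y : Y} (hq : ContinuousAt q y) (hρ : ContinuousAt ρ y) (h0 : ρ y ≠ 0) :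
    ContinuousAt (fun y => endMap i (q y) (ρ y)) y := by
  match i with
  | 0 => exact ContinuousAt.div (by fun_prop) (by fun_prop) (by simpa using h0)
  | 1 => simp only [endMap]; fun_prop
  | 2 => simp only [endMap]; fun_prop

theorem continuousAt_pageCoordinate (R : PageRotation k φ) {m : OpenBookManifold boundary φ}
    (hm : diskCoordinate φ m ≠ 0) : ContinuousAt (pageCoordinate R) m := by
  refine continuousAt_of_continuousOn (isOpen_ne_fun continuous_diskCoordinate continuous_const)
    (Continuous.continuousOn ?_) ?_ hm
  · exact continuous_subtype_val.comp (R.continuous_toFun.comp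
      (by fun_prop : Continuous fun q : ThreeHoledSphere × I => (q.2, q.1)))
  · intro q hq
    refine ContinuousAt.continuousWithinAt ?_
    replace hq : q.2.1 ≠ 0 := hq
    have hβ : Continuous fun q : SolidTori =>
      boundaryHomeomorph.symm q.1 := by fun_prop
    set i := (boundaryHomeomorph.symm q.1).1 with hi
    have h1 : ∀ᶠ q' in nhds q, (boundaryHomeomorph.symm q'.1).1 = i :=
      (continuous_fst.comp hβ).continuousAt.preimage_mem_nhds ((isOpen_discrete {i}).mem_nhds rfl)
    have h2 : ContinuousAt (fun q : SolidTori => ((boundaryHomeomorph.symm q.1).2 : ℂ) *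
          (q.2.1 / ‖q.2.1‖) ^ k i) q := by
      refine ContinuousAt.mul (by fun_prop) (ContinuousAt.zpow₀ ?_ _ (Or.inl ?_))
      · exact ContinuousAt.div (by fun_prop) (by fun_prop) (by simpa using hq)
      · exact div_ne_zero hq (by simpa using hq)
    have h3 : ContinuousAt (fun q : SolidTori => endMap i ((boundaryHomeomorph.symm q.1).2 *
          (q.2.1 / ‖q.2.1‖) ^ k i) ‖q.2.1‖) q :=
      continuousAt_endMap i h2 (by fun_prop) (norm_ne_zero_iff.2 hq)
    refine h3.congr ?_
    filter_upwards [h1] with q' hq'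
    change _ = endMap _ _ _
    rw [hq']

theorem continuousAt_bindingCoordinate {i : Fin 3} {m : OpenBookManifold boundary φ}
    (hm : m ∈ bindingNeighborhood φ i) : ContinuousAt (bindingCoordinate φ) m := by
  refine continuousAt_of_continuousOn (isOpen_bindingNeighborhood i)
    (Continuous.continuousOn ?_) ?_ hm
  · exact continuous_const
  · have h : Continuous fun q : SolidTori =>
      ((boundaryHomeomorph.symm q.1).2 : ℂ) := by fun_prop
    exact h.continuousOn.congr fun q hq => if_pos hq.2

/-- The point of the closed disk with polar coordinates `ρ` and `u`. -/
def diskPoint (ρ : ℝ) (h0 : 0 ≤ ρ) (h1 : ρ ≤ 1) (u : Circle) : Metric.closedBall (0 : ℂ) 1 :=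
  ⟨ρ * u, by
    rwa [mem_closedBall_zero_iff, norm_mul, Circle.norm_coe, mul_one, Complex.norm_real,
      Real.norm_of_nonneg h0]⟩

theorem norm_diskPoint {ρ : ℝ} (h0 : 0 ≤ ρ) (h1 : ρ ≤ 1) (u : Circle) :
    ‖(diskPoint ρ h0 h1 u).1‖ = ρ := by
  rw [diskPoint, norm_mul, Circle.norm_coe, mul_one, Complex.norm_real, Real.norm_of_nonneg h0]

theorem diskPoint_div_norm {ρ : ℝ} (h0 : 0 < ρ) (h1 : ρ ≤ 1) (u : Circle) :
    (diskPoint ρ h0.le h1 u).1 / ‖(diskPoint ρ h0.le h1 u).1‖ = u := by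
  rw [norm_diskPoint]
  exact mul_div_cancel_left₀ _ (by simpa using h0.ne')

theorem exists_eq_diskPoint {w : Metric.closedBall (0 : ℂ) 1} (hw : w.1 ≠ 0) :
    ∃ u, w = diskPoint ‖w.1‖ (norm_nonneg _) (mem_closedBall_zero_iff.1 w.2) u := by
  refine ⟨⟨w.1 / ‖w.1‖, mem_sphere_zero_iff_norm.2 (by
    rw [norm_div, Complex.norm_real, norm_norm, div_self (norm_ne_zero_iff.2 hw)])⟩,
    Subtype.ext ?_⟩
  exact (mul_div_cancel₀ _ (by simpa using hw)).symm

/-- The point of the `i`-th solid torus with polar coordinates `ρ`, `u` in the disk factor. -/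
def solidTorusPoint (φ : ThreeHoledSphere ≃ₜ ThreeHoledSphere) (i : Fin 3) (q u : Circle) (ρ : ℝ)
    (h0 : 0 ≤ ρ) (h1 : ρ ≤ 1) : OpenBookManifold boundary φ :=
  ofTorus φ (boundaryHomeomorph (i, q), diskPoint ρ h0 h1 u)

theorem diskCoordinate_ofPage (q) :
    diskCoordinate φ (ofPage _ φ q) = Circle.exp (q.2 * (2 * Real.pi)) := rfl

theorem pageCoordinate_solidTorusPoint (R : PageRotation k φ) (i : Fin 3) (q u : Circle) {ρ : ℝ}
    (h0 : 0 < ρ) (h1 : ρ ≤ 1) : pageCoordinate R (solidTorusPoint φ i q u ρ h0.le h1) =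
      endMap i (q * u ^ k i : Circle) ρ := by
  change endMap (boundaryHomeomorph.symm (boundaryHomeomorph (i, q))).1
    ((boundaryHomeomorph.symm (boundaryHomeomorph (i, q))).2 * ((diskPoint ρ h0.le h1 u).1 /
      ‖(diskPoint ρ h0.le h1 u).1‖) ^ k (boundaryHomeomorph.symm (boundaryHomeomorph (i, q))).1)
    ‖(diskPoint ρ h0.le h1 u).1‖ = _
  rw [boundaryHomeomorph.symm_apply_apply, diskPoint_div_norm h0, norm_diskPoint]
  rfl

theorem exists_exp_eq (u : Circle) : ∃ t : I, Circle.exp (t * (2 * Real.pi)) = u := by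
  have hpi := Real.two_pi_pos
  obtain ⟨x, rfl⟩ := Circle.exp_surjective u
  refine ⟨⟨Int.fract (x / (2 * Real.pi)), Int.fract_nonneg _, (Int.fract_lt_one _).le⟩, ?_⟩
  rw [Circle.exp_eq_exp]
  refine ⟨-⌊x / (2 * Real.pi)⌋, ?_⟩
  simp only [Int.fract]
  push_cast
  field_simp
  ring

/-- Off the cores, a point lies in the mapping torus or in the interior of a solid torus. -/
theorem eq_ofPage_or_eq_solidTorusPoint {m : OpenBookManifold boundary φ}
    (hm : diskCoordinate φ m ≠ 0) : (∃ x t, m = ofPage boundary φ (x, t)) ∨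
      ∃ i q u ρ, ∃ (h0 : 0 < ρ) (h1 : ρ < 1), m = solidTorusPoint φ i q u ρ h0.le h1.le := by
  obtain ⟨⟨x, t⟩, rfl⟩ | ⟨⟨b, w⟩, rfl⟩ := exists_rep m
  · exact Or.inl ⟨x, t, rfl⟩
  · replace hm : w.1 ≠ 0 := hm
    obtain ⟨u, hu⟩ := exists_eq_diskPoint hm
    have hb : boundaryHomeomorph (boundaryHomeomorph.symm b) = b :=
      boundaryHomeomorph.apply_symm_apply b
    have h1 := mem_closedBall_zero_iff.1 w.2
    rcases h1.eq_or_lt with h | h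
    · obtain ⟨t, ht⟩ := exists_exp_eq u
      refine Or.inl ⟨b, t, (ofPage_eq_ofTorus b t w ?_).symm⟩
      rw [ht, hu]
      change (‖w.1‖ : ℂ) * u = u
      rw [h]; simp
    · refine Or.inr ⟨(boundaryHomeomorph.symm b).1, (boundaryHomeomorph.symm b).2, u, ‖w.1‖,
        norm_pos_iff.2 hm, h, ?_⟩
      rw [solidTorusPoint, Prod.mk.eta, hb, ← hu]

theorem pageCoordinate_ofPage (R : PageRotation k φ) (x t) :
    pageCoordinate R (ofPage boundary φ (x, t)) = (R.toFun t x).1 := rfl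

theorem eq_of_exp_eq {t t' : I}
    (h : Circle.exp (t * (2 * Real.pi)) = Circle.exp (t' * (2 * Real.pi))) :
    t = t' ∨ (t = 0 ∧ t' = 1) ∨ (t = 1 ∧ t' = 0) := by
  obtain ⟨n, hn⟩ := Circle.exp_eq_exp.1 h
  have hpi := Real.two_pi_pos
  have hn' : (t : ℝ) = t' + n := by
    have : (t : ℝ) * (2 * Real.pi) = (t' + n) * (2 * Real.pi) := by rw [hn]; ring
    exact mul_right_cancel₀ hpi.ne' this
  have a1 := t.2.1
  have a2 := t.2.2
  have a3 := t'.2.1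
  have a4 := t'.2.2
  have b1 : -1 ≤ n := by
    have : (-1 : ℝ) ≤ n := by linarith
    exact_mod_cast this
  have b2 : n ≤ 1 := by
    have : (n : ℝ) ≤ 1 := by linarith
    exact_mod_cast this
  obtain rfl | rfl | rfl : n = -1 ∨ n = 0 ∨ n = 1 := by omega
  · push_cast at hn'
    refine Or.inr (Or.inl ⟨Subtype.ext ?_, Subtype.ext ?_⟩)
    · change (t : ℝ) = 0; linarith
    · change (t' : ℝ) = 1; linarith
  · exact Or.inl (Subtype.ext (by simpa using hn'))
  · push_cast at hn'
    refine Or.inr (Or.inr ⟨Subtype.ext ?_, Subtype.ext ?_⟩)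
    · change (t : ℝ) = 1; linarith
    · change (t' : ℝ) = 0; linarith

theorem diskCoordinate_solidTorusPoint_div (i : Fin 3) (q u : Circle) {ρ : ℝ} (h0 : 0 < ρ)
    (h1 : ρ ≤ 1) : diskCoordinate φ (solidTorusPoint φ i q u ρ h0.le h1) /
      ‖diskCoordinate φ (solidTorusPoint φ i q u ρ h0.le h1)‖ = u :=
  diskPoint_div_norm h0 h1 u

theorem diskCoordinate_ofPage_div (x t) : diskCoordinate φ (ofPage boundary φ (x, t)) /
      ‖diskCoordinate φ (ofPage boundary φ (x, t))‖ = Circle.exp (t * (2 * Real.pi)) := by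
  rw [diskCoordinate_ofPage, Circle.norm_coe]; simp

/-- Off the cores, a point is determined by its page coordinate and its angle. -/
theorem eq_of_coordinates_eq (R : PageRotation k φ) {m m' : OpenBookManifold boundary φ}
    (hm : diskCoordinate φ m ≠ 0) (hm' : diskCoordinate φ m' ≠ 0)
    (hy : pageCoordinate R m = pageCoordinate R m')
    (ht : diskCoordinate φ m / ‖diskCoordinate φ m‖ =
      diskCoordinate φ m' / ‖diskCoordinate φ m'‖) : m = m' := by
  have hmixed : ∀ x t i q u ρ (h0 : 0 < ρ) (h1 : ρ < 1),
      pageCoordinate R (ofPage boundary φ (x, t)) ≠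
        pageCoordinate R (solidTorusPoint φ i q u ρ h0.le h1.le) := by
    intro x t i q u ρ h0 h1 h
    rw [pageCoordinate_ofPage, pageCoordinate_solidTorusPoint R i q u h0] at h
    have hP : PlaneMem (R.toFun t x).1 := (R.toFun t x).2
    rw [h] at hP
    exact absurd (one_le_of_planeMem_endMap (Circle.norm_coe _) h0 hP) (not_le.2 h1)
  obtain ⟨x, t, rfl⟩ | ⟨i, q, u, ρ, h0, h1, rfl⟩ := eq_ofPage_or_eq_solidTorusPoint hm <;>
    obtain ⟨x', t', rfl⟩ | ⟨i', q', u', ρ', h0', h1', rfl⟩ := eq_ofPage_or_eq_solidTorusPoint hm'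
  · rw [diskCoordinate_ofPage_div, diskCoordinate_ofPage_div] at ht
    rw [pageCoordinate_ofPage, pageCoordinate_ofPage] at hy
    have hy' := Subtype.ext hy
    obtain rfl | ⟨rfl, rfl⟩ | ⟨rfl, rfl⟩ := eq_of_exp_eq (Circle.ext ht)
    · rw [(R.toFun t).injective hy']
    · rw [R.map_zero, R.map_one] at hy'
      rw [ofPage_one, hy']
    · rw [R.map_zero, R.map_one] at hy'
      rw [ofPage_one, hy']
  · exact (hmixed _ _ _ _ _ _ h0' h1' hy).elim
  · exact (hmixed _ _ _ _ _ _ h0 h1 hy.symm).elim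
  · rw [diskCoordinate_solidTorusPoint_div _ _ _ h0, diskCoordinate_solidTorusPoint_div _ _ _ h0']
      at ht
    rw [pageCoordinate_solidTorusPoint R _ _ _ h0, pageCoordinate_solidTorusPoint R _ _ _ h0'] at hy
    obtain rfl := Circle.ext ht
    obtain ⟨rfl, hq, rfl⟩ := endMap_injective h0 h1.le h0' h1'.le hy
    rw [mul_right_cancel hq]

theorem exists_coordinates_eq (R : PageRotation k φ) (z : TwicePuncturedPlane) (u : Circle) :
    ∃ m : OpenBookManifold boundary φ, diskCoordinate φ m ≠ 0 ∧ pageCoordinate R m = z ∧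
      diskCoordinate φ m / ‖diskCoordinate φ m‖ = u := by
  rcases planeMem_or_mem_endRegion z with h | ⟨i, h⟩
  · obtain ⟨t, rfl⟩ := exists_exp_eq u
    refine ⟨ofPage boundary φ ((R.toFun t).symm ⟨z.1, h⟩, t), ?_, ?_, diskCoordinate_ofPage_div _ _⟩
    · rw [diskCoordinate_ofPage]; exact Circle.coe_ne_zero _
    · exact congrArg Subtype.val ((R.toFun t).apply_symm_apply ⟨z.1, h⟩)
  · obtain ⟨d, n, hdn⟩ := exists_endCoordinates i
    obtain ⟨h0, h1, hz⟩ := hdn ⟨z, h⟩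
    refine ⟨solidTorusPoint φ i (d ⟨z, h⟩ * (u ^ k i)⁻¹) u _ h0.le h1, ?_, ?_,
      diskCoordinate_solidTorusPoint_div _ _ _ h0 h1⟩
    · exact mul_ne_zero (by simpa using h0.ne') (Circle.coe_ne_zero _)
    · rw [pageCoordinate_solidTorusPoint R _ _ _ h0, inv_mul_cancel_right, hz]

/-- The inverse `e` of the product coordinates is continuous. The plane is the union of the
three-holed sphere and the collars, and `e` is given by explicit maps over these closed sets. -/
theorem continuous_of_coordinates (R : PageRotation k φ)
    {e : TwicePuncturedPlane × Circle → OpenBookManifold boundary φ}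
    (he : ∀ q, diskCoordinate φ (e q) ≠ 0 ∧ pageCoordinate R (e q) = q.1 ∧
      diskCoordinate φ (e q) / ‖diskCoordinate φ (e q)‖ = q.2) : Continuous e := by
  -- Over the three-holed sphere, `e` factors through the quotient map
  -- `(x, t) ↦ (ρ_t x, exp (2πit))`.
  let e' : ThreeHoledSphere × Circle → OpenBookManifold boundary φ :=
    fun q => e (⟨q.1.1, coe_ne q.1⟩, q.2)
  let g : ThreeHoledSphere × I → ThreeHoledSphere × Circle :=
    fun q => (R.toFun q.2 q.1, Circle.exp (q.2 * (2 * Real.pi)))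
  have hgc : Continuous g := by
    refine Continuous.prodMk ?_ (by fun_prop)
    exact R.continuous_toFun.comp
      (by fun_prop : Continuous fun q : ThreeHoledSphere × I => (q.2, q.1))
  have hgs : Function.Surjective g := by
    rintro ⟨x, u⟩
    obtain ⟨t, rfl⟩ := exists_exp_eq u
    exact ⟨((R.toFun t).symm x, t), Prod.ext ((R.toFun t).apply_symm_apply x) rfl⟩
  have he'g : e' ∘ g = ofPage boundary φ := by
    ext ⟨x, t⟩
    obtain ⟨h1, h2, h3⟩ := he (⟨(g (x, t)).1.1, coe_ne _⟩, (g (x, t)).2)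
    refine eq_of_coordinates_eq R h1 ?_ h2 ?_
    · rw [diskCoordinate_ofPage]; exact Circle.coe_ne_zero _
    · exact h3.trans (diskCoordinate_ofPage_div x t).symm
  have he' : Continuous e' := by
    rw [(hgc.isClosedMap.isQuotientMap hgc hgs).continuous_iff, he'g]
    exact continuous_ofPage
  let A : Option (Fin 3) → Set (TwicePuncturedPlane × Circle) := fun o =>
    o.elim {q | PlaneMem q.1.1} (fun i => {q | q.1 ∈ endRegion i})
  refine LocallyFinite.continuous (f := A) (locallyFinite_of_finite A) ?_ ?_ ?_
  · ext q
    simp only [Set.mem_iUnion, Set.mem_univ, iff_true]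
    rcases planeMem_or_mem_endRegion q.1 with h | ⟨i, h⟩
    · exact ⟨none, h⟩
    · exact ⟨some i, h⟩
  · rintro (_ | i)
    · exact isClosed_planeMem.preimage (continuous_subtype_val.comp continuous_fst)
    · exact (isClosed_endRegion i).preimage continuous_fst
  · rintro (_ | i)
    · rw [continuousOn_iff_continuous_domRestrict]
      let r : A none → ThreeHoledSphere := fun q => ⟨q.1.1.1, q.2⟩
      have hr : Continuous r := Continuous.subtype_mk
        (continuous_subtype_val.comp (continuous_fst.comp continuous_subtype_val)) _
      exact he'.comp (hr.prodMk (continuous_snd.comp continuous_subtype_val))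
    · rw [continuousOn_iff_continuous_domRestrict]
      obtain ⟨d, n, hdn⟩ := exists_endCoordinates i
      let r : A (some i) → endRegion i := fun q => ⟨q.1.1, q.2⟩
      have hr : Continuous r := by fun_prop
      have hc : Continuous fun q : A (some i) => ofTorus φ (boundaryHomeomorph
          (i, d (r q) * (q.1.2 ^ k i)⁻¹),
          diskPoint (n (r q)) (hdn (r q)).1.le (hdn (r q)).2.1 q.1.2) := by
        refine continuous_ofTorus.comp (Continuous.prodMk ?_ (Continuous.subtype_mk ?_ _))
        · fun_prop
        · fun_prop
      convert hc using 1
      ext q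
      obtain ⟨h1, h2, h3⟩ := he q.1
      obtain ⟨h0, h1', hz⟩ := hdn (r q)
      refine eq_of_coordinates_eq R h1 ?_ (h2.trans ?_) (h3.trans ?_)
      · exact mul_ne_zero (by simpa using h0.ne') (Circle.coe_ne_zero _)
      · refine Eq.trans ?_ (pageCoordinate_solidTorusPoint R i _ _ h0 h1').symm
        rw [inv_mul_cancel_right, hz]
      · exact (diskCoordinate_solidTorusPoint_div i _ _ h0 h1').symm

theorem mem_bindingNeighborhood {i : Fin 3} {m : OpenBookManifold boundary φ} :
    m ∈ bindingNeighborhood φ i ↔ ∃ (q : Circle) (w : Metric.closedBall (0 : ℂ) 1), ‖w.1‖ < 1 ∧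
      m = ofTorus φ (boundaryHomeomorph (i, q), w) := by
  constructor
  · intro hm
    obtain ⟨⟨x, t⟩, rfl⟩ | ⟨⟨b, w⟩, rfl⟩ := exists_rep m
    · exact hm.elim
    · obtain ⟨h1, h2⟩ := hm
      refine ⟨(boundaryHomeomorph.symm b).2, w, h2, ?_⟩
      rw [← h1, Prod.mk.eta, boundaryHomeomorph.apply_symm_apply]
  · rintro ⟨q, w, hw, rfl⟩
    exact ⟨by rw [boundaryHomeomorph.symm_apply_apply], hw⟩

theorem bindingCoordinate_ofTorus (i : Fin 3) (q : Circle) {w : Metric.closedBall (0 : ℂ) 1}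
    (hw : ‖w.1‖ < 1) :
    bindingCoordinate φ (ofTorus φ (boundaryHomeomorph (i, q), w)) = q := by
  refine (if_pos hw).trans ?_
  rw [boundaryHomeomorph.symm_apply_apply]

/-- The open book with a monodromy that is undone by rotating the boundary circles `k i` times is a
filling of the product. -/
def fillingAtlas (R : PageRotation k φ) : FillingAtlas k (OpenBookManifold boundary φ) where
  W := diskCoordinate φ
  continuous_W := continuous_diskCoordinate
  y := pageCoordinate R
  continuousAt_y _ hm := continuousAt_pageCoordinate R hm
  y_ne m hm := by
    obtain ⟨x, t, rfl⟩ | ⟨i, q, u, ρ, h0, h1, rfl⟩ := eq_ofPage_or_eq_solidTorusPoint hm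
    · rw [pageCoordinate_ofPage]
      exact coe_ne _
    · rw [pageCoordinate_solidTorusPoint R _ _ _ h0]
      exact endMap_ne (Circle.norm_coe _) h0 h1.le
  V := bindingNeighborhood φ
  isOpen_V := isOpen_bindingNeighborhood
  disjoint_V i j m hi hj := by
    obtain ⟨q, w, hw, rfl⟩ := mem_bindingNeighborhood.1 hi
    refine Eq.trans ?_ hj.1
    rw [boundaryHomeomorph.symm_apply_apply]
  cover m hm := by
    obtain ⟨⟨x, t⟩, rfl⟩ | ⟨⟨b, w⟩, rfl⟩ := exists_rep m
    · exact absurd hm (Circle.coe_ne_zero _)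
    · replace hm : w.1 = 0 := hm
      exact ⟨_, rfl, by rw [hm]; simp⟩
  p := bindingCoordinate φ
  continuousAt_p _ _ hm := continuousAt_bindingCoordinate hm
  norm_p i m hm := by
    obtain ⟨q, w, hw, rfl⟩ := mem_bindingNeighborhood.1 hm
    rw [bindingCoordinate_ofTorus i q hw, Circle.norm_coe]
  norm_W_lt i m hm := by
    obtain ⟨q, w, hw, rfl⟩ := mem_bindingNeighborhood.1 hm
    exact hw
  y_eq i m hm h0 := by
    obtain ⟨q, w, hw, rfl⟩ := mem_bindingNeighborhood.1 hm
    rw [bindingCoordinate_ofTorus i q hw]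
    change endMap (boundaryHomeomorph.symm (boundaryHomeomorph (i, q))).1
      ((boundaryHomeomorph.symm (boundaryHomeomorph (i, q))).2 * (w.1 / ‖w.1‖) ^
        k (boundaryHomeomorph.symm (boundaryHomeomorph (i, q))).1) ‖w.1‖ = _
    rw [boundaryHomeomorph.symm_apply_apply]
    rfl
  eN := ⟨fun q => (exists_coordinates_eq R q.1 q.2).choose, continuous_of_coordinates R fun q =>
    (exists_coordinates_eq R q.1 q.2).choose_spec⟩
  W_eN q := (exists_coordinates_eq R q.1 q.2).choose_spec.1
  y_eN q := (exists_coordinates_eq R q.1 q.2).choose_spec.2.1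
  t_eN q := (exists_coordinates_eq R q.1 q.2).choose_spec.2.2
  eN_eq m q h0 hy ht := by
    obtain ⟨h1, h2, h3⟩ := (exists_coordinates_eq R q.1 q.2).choose_spec
    exact eq_of_coordinates_eq R h1 h0 (h2.trans hy.symm) (h3.trans ht.symm)
  eV i := ⟨fun q => ofTorus φ (boundaryHomeomorph (i, q.1),
      ⟨q.2.1, Metric.ball_subset_closedBall q.2.2⟩),
    continuous_ofTorus.comp (Continuous.prodMk (by fun_prop) (by fun_prop))⟩
  eV_mem i q := mem_bindingNeighborhood.2 ⟨q.1, _, mem_ball_zero_iff.1 q.2.2, rfl⟩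
  p_eV i q := bindingCoordinate_ofTorus i q.1 (mem_ball_zero_iff.1 q.2.2)
  W_eV i q := rfl
  eV_eq i q m hm hp hW := by
    obtain ⟨q', w, hw, rfl⟩ := mem_bindingNeighborhood.1 hm
    rw [bindingCoordinate_ofTorus i q' hw] at hp
    obtain rfl := Circle.ext hp
    change w.1 = q.2.1 at hW
    have : w = ⟨q.2.1, Metric.ball_subset_closedBall q.2.2⟩ := Subtype.ext hW
    rw [this]
    rfl

end ThreeHoledSphere

end

/-- The powers and products of the twists are taken in the group of self-homeomorphisms of the
three-holed sphere under composition; `φ` is any homeomorphism in the mapping class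
`T₁ ^ a T₂ ^ b T₃ ^ c`. -/
theorem propositionA1 (a b c : ℤ) (hab : |a| ≤ |b|) (hbc : |b| ≤ |c|)
    (φ : ThreeHoledSphere ≃ₜ ThreeHoledSphere)
    (hφ : IsotopicRel ThreeHoledSphere.boundary φ
      (ThreeHoledSphere.T₁ ^ a * ThreeHoledSphere.T₂ ^ b * ThreeHoledSphere.T₃ ^ c)) :
    SimplyConnectedSpace (OpenBookManifold ThreeHoledSphere.boundary φ) ↔
      (a, b, c) ∈
        ({(0, -1, -1), (0, -1, 1), (0, 1, -1), (0, 1, 1)} ∪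
          {x | ∃ n : ℤ, x = (-1, 1, n) ∨ x = (1, -1, n)} ∪
          {(-1, -1, 1), (1, 1, -1)} ∪
          {(-1, 2, 3), (1, -2, -3)} : Set (ℤ × ℤ × ℤ)) := by
  change _ ↔ (a, b, c) ∈ sphereTriples
  obtain ⟨R⟩ := PageRotation.nonempty_of_isotopicRel hφ
  let A := ThreeHoledSphere.fillingAtlas R
  constructor
  · intro h
    by_contra hn
    obtain ⟨G, _, x₁, x₂, x₃, τ, hr, hne⟩ := exists_fillingRelations_of_notMem hab hbc hn
    refine hne (A.eq_one_of_simplyConnectedSpace (x := ![x₁, x₂, x₃]) (τ := τ) hr.prod fun i => ?_)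
    match i with
    | 0 => exact hr.rel₁
    | 1 => exact hr.rel₂
    | 2 => exact hr.rel₃
  · intro h
    refine A.simplyConnectedSpace_of_forall_eq_one fun {G} _ x τ hx hτ => ?_
    have hr : FillingRelations a b c (x 0) (x 1) (x 2) τ :=
      { prod := hx
        rel₁ := hτ 0
        rel₂ := hτ 1
        rel₃ := hτ 2 }
    obtain ⟨h0, h1, h2, h3⟩ := hr.eq_one h
    refine ⟨fun i => ?_, h3⟩
    match i with
    | 0 => exact h0
    | 1 => exact h1
    | 2 => exact h2
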